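/- Setting (units $8\pi G=c=1$, no cosmological constant). A Bianchi type I cosmology on a time interval $I$ is a metric $g=-dt^2+h_{ij}(t)\,dx^i dx^j$ ($h$ of class $C^2$, positive definite), a homogeneous 1-form $\mathcal J=\mathcal J_\mu(t)\,dx^\mu$ (the $j$-form, of class $C^1$) and a density $\rho(t)\ge 0$ of a perfect fluid comoving with $u=\partial_t$, with pressure $(\gamma-1)\rho$, such that $$R_{\mu\nu}-\tfrac12 R g_{\mu\nu}=T^{\rm pf}_{\mu\nu}+\mathcal J_\mu\mathcal J_\nu-\tfrac12 g_{\mu\nu}\mathcal J_\alpha\mathcal J^\alpha,\qquad d\mathcal J=0,\qquad d{\star}\mathcal J=0 .$$ Let $\theta_{ij}=\frac12\dot h_{ij}$, $H=\frac13 h^{ij}\theta_{ij}$, $\sigma=\theta-Hh$, $\mathcal J=-w u+v$ with $v\perp u$, and define $q$ by $\dot H=-(1+q)H^2$. For an expanding cosmology ($H>0$) its state at time $t$ in an orthonormal frame of $h(t)$ is $(\Sigma_{ab},V_a,W,\Omega_{\rm pf})=\big(\tfrac{\sigma_{ab}}{H},\tfrac{v_a}{\sqrt6H},\tfrac{w}{\sqrt6H},\tfrac{\rho}{3H^2}\big)$.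 The type I state space is the set of $(\Sigma,V,W,\Omega_{\rm pf})$ with $\Sigma$ symmetric and trace-free, $\Omega_{\rm pf}\ge0$, $WV_a=0$ and $\frac16\Sigma_{ab}\Sigma_{ab}+V_aV_a+W^2+\Omega_{\rm pf}=1$; its spatial part is $W=0$. A state of the spatial part is rotating if $V$ is non-zero and not an eigenvector of $\Sigma$; this means that $\nabla_u\mathcal J$ is not a multiple of $\mathcal J$. Theorem (the Edge). (1) For every $\gamma\in[0,2]$ the metric $$ds^2=-dt^2+t^2\big(dx+\sqrt2\,t^{-1/2}dz\big)^2+dy^2+t\,dz^2\qquad(t>0)$$ with $\mathcal J=\frac12dx$ and $\rho=0$ (so $\Omega_{\rm pf}=0$) is a Bianchi type I cosmology. It is self-similar: there is a vector field $X$ with $L_Xg=2g$ that is nowhere tangent to the surfaces of constant $t$. Its state in the frame dual to $t(dx+\sqrt2t^{-1/2}dz),\ dy,\ t^{1/2}dz$ does not depend on $t$; its $j$-form is spatial and rotating at all times; $H>0$ and $q=1$. (2) Let $\gamma\in[4/3,2)$. Through every point of the type I state space, at any time and with any value $H>0$, passes a cosmology that exists and expands for all later times; every expanding type I cosmology on a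 bounded interval has its states in the state space and extends, expanding, to all later times. On this state space the set $\mathcal E$ of states of the Edge (in all orthonormal frames) is the global attractor, in the following sense. For every type I cosmology that is expanding on some $(a,\infty)$ and has a rotating state at one time, the distance of its state to $\mathcal E$ tends to $0$ as $t\to\infty$. $\mathcal E$ is stable: for every $\varepsilon>0$ there is $\delta>0$ such that every cosmology expanding on some $(a,\infty)$ whose state is at distance less than $\delta$ from $\mathcal E$ at a time $t_1>a$ stays at distance less than $\varepsilon$ for all $t\ge t_1$. The rotating states form a relatively open and dense subset of the spatial part of the state space. -/

import Mathlib

noncomputable section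

namespace BianchiI

/-! ### Lorentzian geometry in one coordinate chart

Coordinates are `p : Fin 4 → ℝ`, with `p 0 = t` and `(p 1, p 2, p 3) = (x, y, z)`. -/

/-- The partial derivative `∂_m f` at `p`. -/
def pd (m : Fin 4) (f : (Fin 4 → ℝ) → ℝ) (p : Fin 4 → ℝ) : ℝ :=
  deriv (fun s => f (Function.update p m s)) (p m)

/-- The Christoffel symbol `Γ^l_{mn}` of the metric `g`. -/
def christoffel (g : (Fin 4 → ℝ) → Matrix (Fin 4) (Fin 4) ℝ) (l m n : Fin 4)
    (p : Fin 4 → ℝ) : ℝ :=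
  (1 / 2) * ∑ s, (g p)⁻¹ l s *
    (pd m (fun x => g x s n) p + pd n (fun x => g x s m) p - pd s (fun x => g x m n) p)

/-- The Ricci tensor `R_{mn}` of the metric `g`. -/
def ricci (g : (Fin 4 → ℝ) → Matrix (Fin 4) (Fin 4) ℝ) (m n : Fin 4) (p : Fin 4 → ℝ) : ℝ :=
  ∑ l, (pd l (christoffel g l m n) p - pd n (christoffel g l m l) p) +
    ∑ l, ∑ s, (christoffel g l l s p * christoffel g s m n p -
      christoffel g l n s p * christoffel g s m l p)

/-- The Ricci scalar. -/
def scalarCurvature (g : (Fin 4 → ℝ) → Matrix (Fin 4) (Fin 4) ℝ) (p : Fin 4 → ℝ) : ℝ :=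
  ∑ m, ∑ n, (g p)⁻¹ m n * ricci g m n p

/-- The Einstein tensor `R_{mn} - R g_{mn} / 2`. -/
def einstein (g : (Fin 4 → ℝ) → Matrix (Fin 4) (Fin 4) ℝ) (m n : Fin 4) (p : Fin 4 → ℝ) : ℝ :=
  ricci g m n p - (1 / 2) * scalarCurvature g p * g p m n

/-- The covariant derivative `∇_m J_n` of a 1-form. -/
def covDeriv (g : (Fin 4 → ℝ) → Matrix (Fin 4) (Fin 4) ℝ) (J : (Fin 4 → ℝ) → Fin 4 → ℝ)
    (m n : Fin 4) (p : Fin 4 → ℝ) : ℝ :=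
  pd m (fun x => J x n) p - ∑ l, christoffel g l m n p * J p l

/-- The Lie derivative `(L_X g)_{mn}` of the metric. -/
def lieDerivMetric (g : (Fin 4 → ℝ) → Matrix (Fin 4) (Fin 4) ℝ)
    (X : (Fin 4 → ℝ) → Fin 4 → ℝ) (m n : Fin 4) (p : Fin 4 → ℝ) : ℝ :=
  ∑ s, (X p s * pd s (fun x => g x m n) p + g p s n * pd m (fun x => X x s) p +
    g p m s * pd n (fun x => X x s) p)

/-- The energy-momentum tensor `J_m J_n - g_{mn} J_s J^s / 2` of the `j`-form. -/
def formStress (g : (Fin 4 → ℝ) → Matrix (Fin 4) (Fin 4) ℝ) (J : (Fin 4 → ℝ) → Fin 4 → ℝ)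
    (m n : Fin 4) (p : Fin 4 → ℝ) : ℝ :=
  J p m * J p n - (1 / 2) * g p m n * ∑ r, ∑ s, (g p)⁻¹ r s * J p r * J p s

/-- The covector `u_m` of the fundamental observers `u = ∂_t`. -/
def uLower (m : Fin 4) : ℝ := if m = 0 then -1 else 0

/-- The energy-momentum tensor `(ρ + P) u_m u_n + P g_{mn}` of a perfect fluid comoving with the
fundamental observers, with pressure `P = (γ - 1) ρ`. -/
def fluidStress (γ : ℝ) (g : (Fin 4 → ℝ) → Matrix (Fin 4) (Fin 4) ℝ) (ρ : (Fin 4 → ℝ) → ℝ)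
    (m n : Fin 4) (p : Fin 4 → ℝ) : ℝ :=
  (ρ p + (γ - 1) * ρ p) * uLower m * uLower n + (γ - 1) * ρ p * g p m n

/-! ### Bianchi type I cosmologies -/

/-- The metric `-dt² + h_{ij}(t) dx^i dx^j`. -/
def metric (h : ℝ → Matrix (Fin 3) (Fin 3) ℝ) (p : Fin 4 → ℝ) : Matrix (Fin 4) (Fin 4) ℝ :=
  Matrix.of fun m n =>
    Fin.cases (Fin.cases (-1) (fun _ => 0) n)
      (fun i => Fin.cases 0 (fun j => h (p 0) i j) n) m

/-- The spatially homogeneous 1-form field with components `J_m(t)`. -/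
def formField (J : ℝ → Fin 4 → ℝ) (p : Fin 4 → ℝ) : Fin 4 → ℝ := J (p 0)

/-- On the time interval `I`, the spatial metric `h`, the `j`-form `J` and the energy density
`ρ ≥ 0` of a `γ`-law perfect fluid solve the Einstein equations (without cosmological constant)
together with `dJ = 0` and `d⋆J = 0`. Conservation of the fluid alone is then a consequence. -/
structure IsTypeISolution (γ : ℝ) (I : Set ℝ) (h : ℝ → Matrix (Fin 3) (Fin 3) ℝ)
    (J : ℝ → Fin 4 → ℝ) (ρ : ℝ → ℝ) : Prop where
  metric_smooth : ∀ i j, ContDiffOn ℝ 2 (fun t => h t i j) I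
  metric_posDef : ∀ t ∈ I, (h t).PosDef
  form_smooth : ∀ m, ContDiffOn ℝ 1 (fun t => J t m) I
  density_nonneg : ∀ t ∈ I, 0 ≤ ρ t
  einstein_eq : ∀ p : Fin 4 → ℝ, p 0 ∈ I → ∀ m n, einstein (metric h) m n p =
    fluidStress γ (metric h) (fun x => ρ (x 0)) m n p + formStress (metric h) (formField J) m n p
  form_closed : ∀ p : Fin 4 → ℝ, p 0 ∈ I → ∀ m n,
    covDeriv (metric h) (formField J) m n p = covDeriv (metric h) (formField J) n m p
  form_coclosed : ∀ p : Fin 4 → ℝ, p 0 ∈ I →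
    ∑ m, ∑ n, (metric h p)⁻¹ m n * covDeriv (metric h) (formField J) m n p = 0

/-- The expansion tensor `θ_{ij} = ∇_{(i} u_{j)} = (d h_{ij} / dt) / 2` of the observers. -/
def expansion (h : ℝ → Matrix (Fin 3) (Fin 3) ℝ) (t : ℝ) : Matrix (Fin 3) (Fin 3) ℝ :=
  Matrix.of fun i j => (1 / 2) * deriv (fun s => h s i j) t

/-- The Hubble parameter, one third of the trace of the expansion tensor. -/
def hubble (h : ℝ → Matrix (Fin 3) (Fin 3) ℝ) (t : ℝ) : ℝ :=
  (1 / 3) * ((h t)⁻¹ * expansion h t).trace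

/-- The 1-form `J` is rotating at time `t`: its direction is not parallel along the observers,
i.e. `∇_u J` is not a multiple of `J`. -/
def IsRotatingAt (h : ℝ → Matrix (Fin 3) (Fin 3) ℝ) (J : ℝ → Fin 4 → ℝ) (t : ℝ) : Prop :=
  ∀ p : Fin 4 → ℝ, p 0 = t →
    ¬ ∃ c : ℝ, ∀ m, covDeriv (metric h) (formField J) 0 m p = c * J t m

/-- The spacetime is self-similar: it has a proper homothetic vector field `X`, `L_X g = 2 g`, that
is nowhere tangent to the surfaces `t = const` (with the translations of these surfaces, `X` spans
every tangent space). -/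
def IsSelfSimilar (I : Set ℝ) (h : ℝ → Matrix (Fin 3) (Fin 3) ℝ) : Prop :=
  ∃ X : (Fin 4 → ℝ) → Fin 4 → ℝ, ContDiffOn ℝ (⊤ : ℕ∞) X {p | p 0 ∈ I} ∧
    ∀ p : Fin 4 → ℝ, p 0 ∈ I → X p 0 ≠ 0 ∧
      ∀ m n, lieDerivMetric (metric h) X m n p = 2 * metric h p m n

/-! ### Expansion-normalized states -/

/-- The columns of `E` are an orthonormal frame `e_1, e_2, e_3` of the spatial metric `h`. -/
def IsFrame (h E : Matrix (Fin 3) (Fin 3) ℝ) : Prop := E.transpose * h * E = 1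

/-- Expansion-normalized states `(Σ_ab, V_a, W, Ω_pf)`: shear, spatial and temporal part of the
`j`-form, and perfect fluid. -/
abbrev State : Type := (Fin 3 → Fin 3 → ℝ) × (Fin 3 → ℝ) × ℝ × ℝ

/-- The state at time `t`, in the orthonormal frame `E`:
`Σ_ab = σ_ab / H`, `V_a = v_a / (√6 H)`, `W = w / (√6 H)`, `Ω_pf = ρ / (3 H²)`, where
`σ = θ - H h` and `J = -w u + v`. -/
def state (h : ℝ → Matrix (Fin 3) (Fin 3) ℝ) (J : ℝ → Fin 4 → ℝ) (ρ : ℝ → ℝ)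
    (E : Matrix (Fin 3) (Fin 3) ℝ) (t : ℝ) : State :=
  (fun a b => (E.transpose * (expansion h t - hubble h t • h t) * E) a b / hubble h t,
   fun a => (∑ i : Fin 3, J t i.succ * E i a) / (√6 * hubble h t),
   J t 0 / (√6 * hubble h t),
   ρ t / (3 * hubble h t ^ 2))

/-- The type I state space: trace-free symmetric shear, `Ω_pf ≥ 0`, the momentum constraint
`W V_a = 0` and the Friedmann constraint. -/
def stateSpace : Set State :=
  {s | (∀ a b, s.1 a b = s.1 b a) ∧ ∑ a, s.1 a a = 0 ∧ (∀ a, s.2.2.1 * s.2.1 a = 0) ∧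
    0 ≤ s.2.2.2 ∧
    (1 / 6) * ∑ a, ∑ b, s.1 a b ^ 2 + ∑ a, s.2.1 a ^ 2 + s.2.2.1 ^ 2 + s.2.2.2 = 1}

/-- The subspace of the type I state space in which the `j`-form is purely spatial. -/
def spatialStates : Set State := {s ∈ stateSpace | s.2.2.1 = 0}

/-- The states with a spatial and rotating `j`-form: since `∇_u v_a = -H (V_a + Σ_ab V_b) √6 H`,
rotation means that `V` is not an eigenvector of the shear (nor zero). -/
def rotatingStates : Set State :=
  {s ∈ spatialStates | ¬ ∃ c : ℝ, ∀ a, ∑ b, s.1 a b * s.2.1 b = c * s.2.1 a}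

/-- An expanding type I solution on the interval `I`, with a choice of orthonormal frames. -/
structure IsOrbit (γ : ℝ) (I : Set ℝ) (h : ℝ → Matrix (Fin 3) (Fin 3) ℝ)
    (J : ℝ → Fin 4 → ℝ) (ρ : ℝ → ℝ) (E : ℝ → Matrix (Fin 3) (Fin 3) ℝ) : Prop where
  solution : IsTypeISolution γ I h J ρ
  expanding : ∀ t ∈ I, 0 < hubble h t
  frame : ∀ t ∈ I, IsFrame (h t) (E t)

/-- For the fluid parameter `γ`, the set `A` of states is the global attractor of the type I state
space with spatial `j`-form. The first two clauses say that the cosmologies define a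
future-complete evolution on the whole state space. -/
structure IsGlobalAttractor (γ : ℝ) (A : Set State) : Prop where
  /-- Through each state of the state space there is an orbit that exists for all later times,
  with any value of the Hubble parameter. -/
  exists_orbit : ∀ s ∈ stateSpace, ∀ t₀ H₀ : ℝ, 0 < H₀ → ∃ a < t₀, ∃ h J ρ E,
    IsOrbit γ (Set.Ioi a) h J ρ E ∧ hubble h t₀ = H₀ ∧ state h J ρ (E t₀) t₀ = s
  /-- Every orbit stays in the state space and extends to all later times. -/
  mem_and_extends : ∀ a b : ℝ, a < b → ∀ h J ρ E, IsOrbit γ (Set.Ioo a b) h J ρ E →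
    (∀ t ∈ Set.Ioo a b, state h J ρ (E t) t ∈ stateSpace) ∧
    ∃ h' J' ρ' E', IsOrbit γ (Set.Ioi a) h' J' ρ' E' ∧
      ∀ t ∈ Set.Ioo a b, h' t = h t ∧ J' t = J t ∧ ρ' t = ρ t ∧ E' t = E t
  /-- Every orbit that passes through a state with a rotating `j`-form approaches `A`. -/
  attracts : ∀ a : ℝ, ∀ h J ρ E, IsOrbit γ (Set.Ioi a) h J ρ E →
    ∀ t₁ > a, state h J ρ (E t₁) t₁ ∈ rotatingStates →
      Filter.Tendsto (fun t => Metric.infDist (state h J ρ (E t) t) A) Filter.atTop (nhds 0)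
  /-- `A` is stable: orbits that start close to `A` stay close to `A`. -/
  stable : ∀ ε > 0, ∃ δ > 0, ∀ a : ℝ, ∀ h J ρ E, IsOrbit γ (Set.Ioi a) h J ρ E →
    ∀ t₁ > a, Metric.infDist (state h J ρ (E t₁) t₁) A < δ →
      ∀ t ≥ t₁, Metric.infDist (state h J ρ (E t) t) A < ε
  /-- The basin is generic: open and dense in the states with spatial `j`-form. -/
  basin_open : ∃ U : Set State, IsOpen U ∧ rotatingStates = U ∩ spatialStates
  basin_dense : spatialStates ⊆ closure rotatingStates

/-! ### The Edge -/

/-- The rows are the coframe `ω¹ = t (dx + √2 t^(-1/2) dz)`, `ω² = dy`, `ω³ = t^(1/2) dz`. -/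
def edgeCoframe (t : ℝ) : Matrix (Fin 3) (Fin 3) ℝ :=
  !![t, 0, t * (√2 * t ^ (-(1 / 2) : ℝ)); 0, 1, 0; 0, 0, t ^ (1 / 2 : ℝ)]

/-- The spatial metric `(ω¹)² + (ω²)² + (ω³)² = t² (dx + √2 t^(-1/2) dz)² + dy² + t dz²`. -/
def edgeMetric (t : ℝ) : Matrix (Fin 3) (Fin 3) ℝ :=
  (edgeCoframe t).transpose * edgeCoframe t

/-- The `j`-form `dx / 2` of the Edge. -/
def edgeForm (_ : ℝ) : Fin 4 → ℝ := ![0, 1 / 2, 0, 0]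

/-- The Edge contains no perfect fluid. -/
def edgeDensity (_ : ℝ) : ℝ := 0

/-- All the states of the Edge, in all orthonormal frames. -/
def edgeStates : Set State :=
  {s | ∃ t > 0, ∃ E, IsFrame (edgeMetric t) E ∧ s = state edgeMetric edgeForm edgeDensity E t}

end BianchiI

end

noncomputable section

namespace BianchiI

open Set Filter Topology Matrix

/-! ### Ordinary differential equations -/

section ODE

variable {E : Type*} [NormedAddCommGroup E] [NormedSpace ℝ E]

/-! The proof rests on an explicit monotone function whose maximum is attained exactly on the Edge,
so neither linearization nor limit sets are needed.

Because everything depends on `t` alone, the field equations are equivalent to ordinary differential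
equations with constraints (`einstein_iff`, `IsReduced`). In an orthonormal frame parallel along the
observers they become polynomial (`IsFrameSol`), the constraints propagate
(`IsFrameSol.constraints`), and the Friedmann constraint bounds all components by the trace of the
expansion tensor, which stays positive and decreases. This gives global existence to the future
(`exists_isFrameSol`), and with uniqueness for the reduced equations every orbit is covered
(`IsOrbit.exists_isFrameSol`). The frames of an orbit may be chosen arbitrarily at each time, so
only quantities invariant under `rotate` can be followed in time. The invariants used are the
moments `V · Σ^n V`.

If `V` and `ΣV` are independent, Gram-Schmidt applied to `V, ΣV` gives a frame with `V = (v, 0, 0)`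
and tridiagonal `Σ`, with diagonal `A, b, -A - b` and off-diagonal entries `Y, k`
(`exists_rotate_eq_triState`). There the monotone function is `M = v⁶ Y² / (6 - 2A - b)⁸`. The
Friedmann constraint bounds `v² + Y²/3` by `(6 - 2A - b)² / 24`, and the inequality of arithmetic
and geometric means then gives `M ≤ 2⁻²⁰`, with equality only at `A = 1`, `b = k = Ω = 0`, `v² = Y²
= 1/2`, that is, on the Edge (`pow_three_mul_div_le`, `eq_of_pow_three_mul_div_eq`,
`edgeStates_eq`). Along solutions `M' = 2 H M (Q + 12 (3γ - 4) Ω) / (6 - 2A - b)` with a positive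
definite form `Q` in `(A - 1, b)` (`Evolves.deriv_lyapunov`); this is where `γ ≥ 4/3` enters.
Stability follows by compactness from monotonicity.

For attraction one has to exclude that `M` stays below some `m < 2⁻²⁰`. Where the rate of `M`
vanishes, the quantity `-(A + b) + (A - 1)(v² - Y²)/6` still grows strictly unless the state is the
Edge (`auxRate_pos`; this uses `γ < 2`). By compactness a suitable combination with `log M` grows at
least at a rate `c H` (`exists_le_auxRate`). Adding `(c/3) log H` keeps it nondecreasing, although
it is bounded above by a constant plus `(c/3) log H`, which tends to `-∞` because `H ≤ 1 / (t - t₁)`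
(`hubble_le`). This contradiction is `exists_lt_lyapunov`.

Rotating states are those with nonzero Gram determinant of `V, ΣV`, a polynomial condition; hence
they are open, and dense because the polynomial does not vanish at the Edge. -/

/-- A bounded Lipschitz vector field has solutions on arbitrarily large intervals. -/
lemma exists_solution_of_lipschitz_of_bounded [CompleteSpace E] {F : E → E} {K L : NNReal}
    (hK : LipschitzWith K F) (hL : ∀ x, ‖F x‖ ≤ L) (t₀ : ℝ) (x₀ : E) {T : ℝ} (hT : 0 < T) :
    ∃ x : ℝ → E, x t₀ = x₀ ∧ ∀ t ∈ Ioo (t₀ - T) (t₀ + T), HasDerivAt x (F (x t)) t := by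
  have ht₀ : t₀ ∈ Icc (t₀ - T) (t₀ + T) := ⟨by linarith, by linarith⟩
  -- The radius `L * T` is the distance that a curve of speed at most `L` can cover in time `T`, so
  -- the restriction on the length of the interval holds with equality.
  have hPL : IsPicardLindelof (fun _ => F) (⟨t₀, ht₀⟩ : Icc (t₀ - T) (t₀ + T)) x₀
      (L * T.toNNReal) 0 L K :=
    { lipschitzOnWith := fun t _ => hK.lipschitzOnWith
      continuousOn := fun x _ => continuousOn_const
      norm_le := fun t _ x _ => hL x
      mul_max_le := by simp [hT.le] }
  obtain ⟨x, hx0, hx⟩ := hPL.exists_eq_forall_mem_Icc_hasDerivWithinAt₀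
  exact ⟨x, hx0, fun t ht => (hx t (Ioo_subset_Icc_self ht)).hasDerivAt (Icc_mem_nhds ht.1 ht.2)⟩

/-- Two solutions of a `C¹` autonomous equation that agree at one time agree. -/
lemma eqOn_of_hasDerivAt [FiniteDimensional ℝ E] {F : E → E} (hF : ContDiff ℝ 1 F) {I : Set ℝ}
    (hI : I.OrdConnected) {x y : ℝ → E}
    (hx : ∀ t ∈ I, HasDerivAt x (F (x t)) t) (hy : ∀ t ∈ I, HasDerivAt y (F (y t)) t) {t₀ : ℝ}
    (ht₀ : t₀ ∈ I) (h0 : x t₀ = y t₀) : EqOn x y I := by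
  -- Both curves stay in one closed ball between `t₀` and `t`, and a `C¹` field is Lipschitz on it.
  have key : ∀ t ∈ I, ∃ K, ∃ s : Set E, LipschitzOnWith K F s ∧
      ∀ τ ∈ uIcc t₀ t, x τ ∈ s ∧ y τ ∈ s := by
    intro t ht
    have hsub : uIcc t₀ t ⊆ I := hI.uIcc_subset ht₀ ht
    have hcx : ContinuousOn x (uIcc t₀ t) := fun τ hτ =>
      (hx τ (hsub hτ)).continuousAt.continuousWithinAt
    have hcy : ContinuousOn y (uIcc t₀ t) := fun τ hτ =>
      (hy τ (hsub hτ)).continuousAt.continuousWithinAt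
    have hcomp := (isCompact_uIcc.image_of_continuousOn hcx).union
      (isCompact_uIcc.image_of_continuousOn hcy)
    obtain ⟨R, hR⟩ := hcomp.isBounded.subset_closedBall (0 : E)
    obtain ⟨K, hK⟩ := (hF.contDiffOn (s := Metric.closedBall (0 : E) R)).exists_lipschitzOnWith
      one_ne_zero (convex_closedBall _ _) (isCompact_closedBall _ _)
    exact ⟨K, _, hK, fun τ hτ => ⟨hR (Or.inl ⟨τ, hτ, rfl⟩), hR (Or.inr ⟨τ, hτ, rfl⟩)⟩⟩
  intro t ht
  obtain ⟨K, s, hs, hmem⟩ := key t ht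
  have hsub : uIcc t₀ t ⊆ I := hI.uIcc_subset ht₀ ht
  rcases le_total t₀ t with h | h
  · rw [uIcc_of_le h] at hmem hsub
    exact ODE_solution_unique_of_mem_Icc_right (v := fun _ => F) (s := fun _ => s)
      (fun _ _ => hs)
      (fun τ hτ => (hx τ (hsub hτ)).continuousAt.continuousWithinAt)
      (fun τ hτ => (hx τ (hsub (Ico_subset_Icc_self hτ))).hasDerivWithinAt)
      (fun τ hτ => (hmem τ (Ico_subset_Icc_self hτ)).1)
      (fun τ hτ => (hy τ (hsub hτ)).continuousAt.continuousWithinAt)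
      (fun τ hτ => (hy τ (hsub (Ico_subset_Icc_self hτ))).hasDerivWithinAt)
      (fun τ hτ => (hmem τ (Ico_subset_Icc_self hτ)).2) h0 (right_mem_Icc.2 h)
  · rw [uIcc_of_ge h] at hmem hsub
    exact ODE_solution_unique_of_mem_Icc_left (v := fun _ => F) (s := fun _ => s)
      (fun _ _ => hs)
      (fun τ hτ => (hx τ (hsub hτ)).continuousAt.continuousWithinAt)
      (fun τ hτ => (hx τ (hsub (Ioc_subset_Icc_self hτ))).hasDerivWithinAt)
      (fun τ hτ => (hmem τ (Ioc_subset_Icc_self hτ)).1)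
      (fun τ hτ => (hy τ (hsub hτ)).continuousAt.continuousWithinAt)
      (fun τ hτ => (hy τ (hsub (Ioc_subset_Icc_self hτ))).hasDerivWithinAt)
      (fun τ hτ => (hmem τ (Ioc_subset_Icc_self hτ)).2) h0 (left_mem_Icc.2 h)

/-- If the solutions on `[t₀, T]` starting at `x₀` obey an a priori bound, then there is a solution
on a neighbourhood of `[t₀, T]`. -/
lemma exists_solution_of_bound [FiniteDimensional ℝ E] {F : E → E} (hF : ContDiff ℝ 1 F)
    (t₀ : ℝ) (x₀ : E) {T R : ℝ} (hT : t₀ < T)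
    (hR : ∀ x : ℝ → E, ∀ τ ∈ Icc t₀ T, x t₀ = x₀ →
      (∀ t ∈ Icc t₀ τ, HasDerivAt x (F (x t)) t) → ‖x τ‖ ≤ R) :
    ∃ x : ℝ → E, x t₀ = x₀ ∧ ∃ a < t₀, ∀ t ∈ Ioc a T, HasDerivAt x (F (x t)) t := by
  -- The field is cut off outside the ball of radius `R'`. The margin `+ 1` makes the a priori bound
  -- contradict arrival at the boundary of this ball.
  let R' := max R ‖x₀‖ + 1
  have hR' : 0 < R' := by
    have := (norm_nonneg x₀).trans (le_max_right R ‖x₀‖)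
    simp only [R']; linarith
  let χ : ContDiffBump (0 : E) := ⟨R', R' + 1, hR', by linarith⟩
  let G : E → E := fun x => χ x • F x
  have hG : ContDiff ℝ 1 G := (χ.contDiff).smul hF
  have hGs : HasCompactSupport G := χ.hasCompactSupport.smul_right
  have hGF : ∀ x, ‖x‖ ≤ R' → G x = F x := fun x hx => by
    have : χ x = 1 := χ.one_of_mem_closedBall (by simpa [χ] using hx)
    simp [G, this]
  obtain ⟨K, hK⟩ := hG.lipschitzWith_of_hasCompactSupport hGs one_ne_zero
  obtain ⟨L, hL⟩ := hGs.exists_bound_of_continuous hG.continuous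
  have hL0 : 0 ≤ L := (norm_nonneg _).trans (hL 0)
  obtain ⟨x, hx0, hx⟩ := exists_solution_of_lipschitz_of_bounded hK (L := ⟨L, hL0⟩) hL t₀ x₀
    (T := T - t₀ + 1) (by linarith)
  have hcont : ∀ t ∈ Icc t₀ T, ContinuousAt x t := fun t ht =>
    (hx t ⟨by linarith [ht.1, ht.2], by linarith [ht.1, ht.2]⟩).continuousAt
  have hbd : ∀ t ∈ Icc t₀ T, ‖x t‖ < R' := by
    by_contra! hcon
    obtain ⟨t, ht, hbig⟩ := hcon
    let S := Icc t₀ t ∩ (fun τ => ‖x τ‖) ⁻¹' Ici R'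
    have hcn : ContinuousOn (fun τ => ‖x τ‖) (Icc t₀ t) := fun τ hτ =>
      (hcont τ ⟨hτ.1, hτ.2.trans ht.2⟩).norm.continuousWithinAt
    have hSc : IsCompact S := isCompact_Icc.of_isClosed_subset
      (hcn.preimage_isClosed_of_isClosed isClosed_Icc isClosed_Ici) inter_subset_left
    -- At the first time `τ` at which the norm reaches `R'`, the curve has so far solved the
    -- original equation, hence its norm is at most `R < R'`.
    obtain ⟨τ, ⟨hτ1, hτ2⟩, hτmin⟩ := hSc.exists_isLeast ⟨t, right_mem_Icc.2 ht.1, hbig⟩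
    have hle : ∀ u ∈ Ico t₀ τ, ‖x u‖ < R' := fun u hu => by
      by_contra! hc
      exact absurd (hτmin ⟨⟨hu.1, hu.2.le.trans hτ1.2⟩, hc⟩) (not_le.2 hu.2)
    have hlt : t₀ < τ := by
      rcases hτ1.1.eq_or_lt with h | h
      · exfalso
        rw [← h] at hτ2
        simp only [mem_preimage, hx0, mem_Ici, R'] at hτ2
        linarith [le_max_right R ‖x₀‖]
      · exact h
    have hτR : ‖x τ‖ ≤ R' := by
      have hc : ContinuousWithinAt (fun u => ‖x u‖) (Ico t₀ τ) τ :=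
        ((hcont τ ⟨hτ1.1, hτ1.2.trans ht.2⟩).norm).continuousWithinAt
      have hcl : τ ∈ closure (Ico t₀ τ) := by
        rw [closure_Ico hlt.ne]; exact right_mem_Icc.2 hlt.le
      have := hc.mem_closure hcl (t := Iic R') (fun u hu => (hle u hu).le)
      simpa using this
    have := hR x τ ⟨hτ1.1, hτ1.2.trans ht.2⟩ hx0 (fun u hu => by
      have hn : ‖x u‖ ≤ R' := by
        rcases hu.2.eq_or_lt with h | h
        · rw [h]; exact hτR
        · exact (hle u ⟨hu.1, h⟩).le
      rw [← hGF _ hn]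
      exact hx u ⟨by linarith [hu.1], by linarith [hu.2, hτ1.2, ht.2]⟩)
    have h2 : R' ≤ ‖x τ‖ := hτ2
    simp only [R'] at h2
    linarith [le_max_left R ‖x₀‖]
  have hnear : ∀ᶠ t in 𝓝 t₀, ‖x t‖ < R' :=
    (hcont t₀ (left_mem_Icc.2 hT.le)).norm.eventually_lt continuousAt_const
      (hbd t₀ (left_mem_Icc.2 hT.le))
  obtain ⟨δ, hδ, hball⟩ := Metric.eventually_nhds_iff.1 hnear
  refine ⟨x, hx0, t₀ - min δ 1, by linarith [lt_min hδ one_pos], fun t ht => ?_⟩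
  have hn : ‖x t‖ < R' := by
    rcases le_or_gt t₀ t with h | h
    · exact hbd t ⟨h, ht.2⟩
    · refine hball ?_
      rw [Real.dist_eq, abs_of_neg (by linarith)]
      linarith [ht.1, min_le_left δ 1]
  rw [← hGF _ hn.le]
  exact hx t ⟨by linarith [ht.1, min_le_right δ 1], by linarith [ht.2]⟩

/-- A priori bounds on bounded time intervals imply existence for all later times. -/
theorem exists_global_solution [FiniteDimensional ℝ E] {F : E → E} (hF : ContDiff ℝ 1 F)
    (t₀ : ℝ) (x₀ : E)
    (hb : ∀ T > t₀, ∃ R, ∀ x : ℝ → E, ∀ τ ∈ Icc t₀ T, x t₀ = x₀ →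
      (∀ t ∈ Icc t₀ τ, HasDerivAt x (F (x t)) t) → ‖x τ‖ ≤ R) :
    ∃ a < t₀, ∃ x : ℝ → E, x t₀ = x₀ ∧ ∀ t > a, HasDerivAt x (F (x t)) t := by
  have hn : ∀ n : ℕ, t₀ < t₀ + (n + 1) := fun n => by linarith [(n.cast_nonneg : (0:ℝ) ≤ n)]
  choose R hR using fun n : ℕ => hb (t₀ + (n + 1)) (hn n)
  choose x hx0 a ha hx using fun n : ℕ => exists_solution_of_bound hF t₀ x₀ (hn n) (hR n)
  have hagree : ∀ n m : ℕ, n ≤ m → ∀ t ∈ Icc t₀ (t₀ + (n + 1)), x n t = x m t := by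
    intro n m hnm t ht
    have hnm' : (n : ℝ) ≤ m := by exact_mod_cast hnm
    exact eqOn_of_hasDerivAt hF ordConnected_Icc
      (fun s hs => hx n s ⟨(ha n).trans_le hs.1, hs.2⟩)
      (fun s hs => hx m s ⟨(ha m).trans_le hs.1, hs.2.trans (by linarith)⟩)
      (left_mem_Icc.2 (hn n).le) ((hx0 n).trans (hx0 m).symm) ht
  -- The natural ceiling is `0` for `t ≤ t₀`, so the past comes from `x 0`. For `t > t₀` the chosen
  -- solution lives until `t₀ + ⌈t - t₀⌉₊ + 1`, which is strictly after `t`.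
  refine ⟨a 0, ha 0, fun t => x ⌈t - t₀⌉₊ t, by simp [hx0], fun t ht => ?_⟩
  have hval : ∀ m : ℕ, ∀ t, t₀ ≤ t → t ≤ t₀ + (m + 1) → x ⌈t - t₀⌉₊ t = x m t := by
    intro m t h1 h2
    have h3 : t - t₀ ≤ ⌈t - t₀⌉₊ := Nat.le_ceil _
    rcases le_total ⌈t - t₀⌉₊ m with h | h
    · exact hagree _ _ h t ⟨h1, by linarith⟩
    · exact (hagree _ _ h t ⟨h1, h2⟩).symm
  have hceil0 : ∀ t ≤ t₀, ⌈t - t₀⌉₊ = 0 := fun t h => Nat.ceil_eq_zero.2 (by linarith)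
  rcases lt_or_ge t₀ t with h | h
  · obtain ⟨m, hm⟩ := exists_nat_gt (t - t₀)
    have hloc : (fun t => x ⌈t - t₀⌉₊ t) =ᶠ[𝓝 t] x m := by
      filter_upwards [Ioo_mem_nhds h (show t < t₀ + m by linarith)] with s hs
      exact hval m s hs.1.le (by linarith [hs.2])
    beta_reduce
    rw [show x ⌈t - t₀⌉₊ t = _ from hloc.eq_of_nhds]
    exact (hx m t ⟨(ha m).trans h, by linarith⟩).congr_of_eventuallyEq hloc
  · have hloc : (fun t => x ⌈t - t₀⌉₊ t) =ᶠ[𝓝 t] x 0 := by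
      filter_upwards [Iio_mem_nhds (show t < t₀ + 1 by linarith)] with s hs
      rcases le_total t₀ s with h' | h'
      · exact hval 0 s h' (by simpa using (le_of_lt hs))
      · simp only [hceil0 s h']
    beta_reduce
    rw [show x ⌈t - t₀⌉₊ t = _ from hloc.eq_of_nhds]
    exact (hx 0 t ⟨ht, by simp; linarith⟩).congr_of_eventuallyEq hloc

end ODE

/-! ### Scalar linear equations and integrating factors -/

section ScalarODE

lemma exists_primitive_Icc {g : ℝ → ℝ} {a b : ℝ} (hab : a ≤ b) (hg : ContinuousOn g (Icc a b)) :
    ∃ G : ℝ → ℝ, ∀ t ∈ Icc a b, HasDerivAt G (g t) t := by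
  have hc : Continuous (IccExtend hab ((Icc a b).domRestrict g)) :=
    (continuousOn_iff_continuous_domRestrict.1 hg).Icc_extend'
  refine ⟨fun t => ∫ s in a..t, IccExtend hab ((Icc a b).domRestrict g) s, fun t ht => ?_⟩
  have := hc.integral_hasStrictDerivAt a t
  rw [IccExtend_of_mem hab _ ht] at this
  exact this.hasDerivAt

/-- A function with `y' ≥ g y` dominates a positive multiple of its initial value. -/
lemma exists_pos_mul_le_of_hasDerivAt {y g r : ℝ → ℝ} {a b : ℝ} (hab : a ≤ b)
    (hg : ContinuousOn g (Icc a b)) (hr : ∀ t ∈ Icc a b, 0 ≤ r t)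
    (hy : ∀ t ∈ Icc a b, HasDerivAt y (g t * y t + r t) t) : ∃ c > 0, c * y a ≤ y b := by
  obtain ⟨G, hG⟩ := exists_primitive_Icc hab hg
  have hd : ∀ t ∈ Icc a b, HasDerivAt (fun t => y t * Real.exp (-G t))
      (r t * Real.exp (-G t)) t := fun t ht => by
    refine ((hy t ht).mul (hG t ht).neg.exp).congr_deriv ?_
    simp only [Pi.neg_apply]
    ring
  have hmono : MonotoneOn (fun t => y t * Real.exp (-G t)) (Icc a b) := by
    refine monotoneOn_of_hasDerivWithinAt_nonneg (convex_Icc a b)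
      (fun t ht => (hd t ht).continuousAt.continuousWithinAt)
      (fun t ht => (hd t (interior_subset ht)).hasDerivWithinAt)
      (fun t ht => mul_nonneg (hr t (interior_subset ht)) (Real.exp_pos _).le)
  have := hmono (left_mem_Icc.2 hab) (right_mem_Icc.2 hab) hab
  refine ⟨Real.exp (-G a) / Real.exp (-G b), by positivity, ?_⟩
  rw [div_mul_eq_mul_div, div_le_iff₀ (Real.exp_pos _), mul_comm]
  exact this

/-- The values of a solution of `y' = g y` are positive multiples of each other. -/
lemma exists_pos_mul_eq_of_hasDerivAt {y g : ℝ → ℝ} {I : Set ℝ} (hI : I.OrdConnected)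
    (hg : ContinuousOn g I) (hy : ∀ t ∈ I, HasDerivAt y (g t * y t) t) {s t : ℝ}
    (hs : s ∈ I) (ht : t ∈ I) : ∃ c > 0, y t = c * y s := by
  wlog hst : s ≤ t generalizing s t
  · obtain ⟨c, hc, h⟩ := this ht hs (le_of_not_ge hst)
    exact ⟨c⁻¹, inv_pos.2 hc, by rw [h]; field_simp⟩
  have hsub : Icc s t ⊆ I := hI.out hs ht
  obtain ⟨G, hG⟩ := exists_primitive_Icc hst (hg.mono hsub)
  have hd : ∀ τ ∈ Icc s t, HasDerivAt (fun τ => y τ * Real.exp (-G τ)) 0 τ := fun τ hτ => by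
    refine ((hy τ (hsub hτ)).mul (hG τ hτ).neg.exp).congr_deriv ?_
    simp only [Pi.neg_apply]
    ring
  have hconst := constant_of_has_deriv_right_zero
    (fun τ hτ => (hd τ hτ).continuousAt.continuousWithinAt)
    (fun τ hτ => (hd τ (Ico_subset_Icc_self hτ)).hasDerivWithinAt) t (right_mem_Icc.2 hst)
  refine ⟨Real.exp (-G s) / Real.exp (-G t), by positivity, ?_⟩
  field_simp
  linarith

end ScalarODE

/-! ### Derivatives of matrix-valued functions -/

/-- The matrix-valued function `A` has the entrywise derivative `A'` at `t`. -/
def HasMatDerivAt {m n : Type*} (A : ℝ → Matrix m n ℝ) (A' : Matrix m n ℝ) (t : ℝ) : Prop :=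
  ∀ i j, HasDerivAt (fun s => A s i j) (A' i j) t

namespace HasMatDerivAt

variable {l m n : Type*} {A B : ℝ → Matrix m n ℝ} {A' B' : Matrix m n ℝ} {t : ℝ}

lemma congr_deriv (hA : HasMatDerivAt A A' t) (h : A' = B') : HasMatDerivAt A B' t := h ▸ hA

lemma congr_of_eventuallyEq (hA : HasMatDerivAt A A' t) (h : B =ᶠ[𝓝 t] A) :
    HasMatDerivAt B A' t := fun i j =>
  (hA i j).congr_of_eventuallyEq (h.mono fun s hs => by simp only [hs])

lemma unique (hA : HasMatDerivAt A A' t) (hB : HasMatDerivAt A B' t) : A' = B' := by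
  ext i j
  exact (hA i j).unique (hB i j)

lemma const (M : Matrix m n ℝ) : HasMatDerivAt (fun _ => M) 0 t := fun _ _ => hasDerivAt_const _ _

lemma const_smul (c : ℝ) (hA : HasMatDerivAt A A' t) :
    HasMatDerivAt (fun s => c • A s) (c • A') t := fun i j => (hA i j).const_mul c

lemma transpose (hA : HasMatDerivAt A A' t) :
    HasMatDerivAt (fun s => (A s)ᵀ) A'ᵀ t := fun i j => hA j i

lemma mul [Fintype n] {B : ℝ → Matrix n l ℝ} {B' : Matrix n l ℝ} (hA : HasMatDerivAt A A' t)
    (hB : HasMatDerivAt B B' t) : HasMatDerivAt (fun s => A s * B s) (A' * B t + A t * B') t := by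
  intro i j
  simp only [Matrix.mul_apply, Matrix.add_apply, ← Finset.sum_add_distrib]
  exact HasDerivAt.fun_sum fun k _ => (hA i k).mul (hB k j)

lemma trace [Fintype n] {A : ℝ → Matrix n n ℝ} {A' : Matrix n n ℝ} (hA : HasMatDerivAt A A' t) :
    HasDerivAt (fun s => (A s).trace) A'.trace t := by
  simp only [Matrix.trace, Matrix.diag_apply]
  exact HasDerivAt.fun_sum fun k _ => hA k k

lemma mulVec [Fintype n] {x : ℝ → n → ℝ} {x' : n → ℝ} (hA : HasMatDerivAt A A' t)
    (hx : ∀ i, HasDerivAt (fun s => x s i) (x' i) t) (i : m) :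
    HasDerivAt (fun s => (A s *ᵥ x s) i) ((A' *ᵥ x t + A t *ᵥ x') i) t := by
  simp only [Matrix.mulVec, dotProduct, Pi.add_apply, ← Finset.sum_add_distrib]
  exact HasDerivAt.fun_sum fun k _ => (hA i k).mul (hx k)

/-- Differentiability of the inverse. -/
lemma inv [Fintype n] [DecidableEq n] {A : ℝ → Matrix n n ℝ} {A' : Matrix n n ℝ}
    (hA : HasMatDerivAt A A' t) (hdet : ∀ᶠ s in 𝓝 t, (A s).det ≠ 0) :
    HasMatDerivAt (fun s => (A s)⁻¹) (-((A t)⁻¹ * A' * (A t)⁻¹)) t := by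
  have hAd : DifferentiableAt ℝ (fun s => (fun i j => A s i j : n → n → ℝ)) t :=
    differentiableAt_pi.2 fun i => differentiableAt_pi.2 fun j => (hA i j).differentiableAt
  have hdetd : DifferentiableAt ℝ (fun s => (A s).det) t := by
    simp only [Matrix.det_apply]
    refine DifferentiableAt.fun_sum fun σ _ => ?_
    refine DifferentiableAt.const_smul ?_ _
    exact DifferentiableAt.fun_finsetProd fun i _ => (hA _ _).differentiableAt
  have hadj : ∀ i j, DifferentiableAt ℝ (fun s => (A s).adjugate i j) t := fun i j => by
    simp only [Matrix.adjugate_apply, Matrix.det_apply]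
    refine DifferentiableAt.fun_sum fun σ _ => ?_
    refine DifferentiableAt.const_smul ?_ _
    refine DifferentiableAt.fun_finsetProd fun k _ => ?_
    simp only [Matrix.updateRow_apply]
    split_ifs
    · exact differentiableAt_const _
    · exact (hA _ _).differentiableAt
  have hinv : ∀ i j, DifferentiableAt ℝ (fun s => (A s)⁻¹ i j) t := fun i j => by
    simp only [Matrix.inv_def, Matrix.smul_apply, Ring.inverse_eq_inv', smul_eq_mul]
    exact (hdetd.inv hdet.self_of_nhds).mul (hadj i j)
  -- Cramer's rule gives differentiability only; the value of the derivative is found by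
  -- differentiating `A * A⁻¹ = 1`.
  let D : Matrix n n ℝ := Matrix.of fun i j => deriv (fun s => (A s)⁻¹ i j) t
  have hD : HasMatDerivAt (fun s => (A s)⁻¹) D t := fun i j => (hinv i j).hasDerivAt
  have h1 : HasMatDerivAt (fun s => A s * (A s)⁻¹) 0 t :=
    (const (1 : Matrix n n ℝ)).congr_of_eventuallyEq (hdet.mono fun s hs =>
      Matrix.mul_nonsing_inv _ (isUnit_iff_ne_zero.2 hs))
  have h2 := (hA.mul hD).unique h1
  refine hD.congr_deriv ?_
  have hu := isUnit_iff_ne_zero.2 hdet.self_of_nhds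
  have h3 : (A t)⁻¹ * (A t * D) = -((A t)⁻¹ * A' * (A t)⁻¹) := by
    rw [eq_neg_of_add_eq_zero_right h2]
    simp [Matrix.mul_assoc]
  rwa [← Matrix.mul_assoc, Matrix.nonsing_inv_mul _ hu, Matrix.one_mul] at h3

end HasMatDerivAt

lemma hasDerivAt_dotProduct {n : Type*} [Fintype n] {x y : ℝ → n → ℝ} {x' y' : n → ℝ} {t : ℝ}
    (hx : ∀ i, HasDerivAt (fun s => x s i) (x' i) t)
    (hy : ∀ i, HasDerivAt (fun s => y s i) (y' i) t) :
    HasDerivAt (fun s => x s ⬝ᵥ y s) (x' ⬝ᵥ y t + x t ⬝ᵥ y') t := by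
  simp only [dotProduct, ← Finset.sum_add_distrib]
  exact HasDerivAt.fun_sum fun k _ => (hx k).mul (hy k)

/-! ### Curvature of `-dt² + h_{ij}(t) dx^i dx^j` -/

section Curvature

variable {h : ℝ → Matrix (Fin 3) (Fin 3) ℝ}

@[simp] lemma metric_zero_zero (p : Fin 4 → ℝ) : metric h p 0 0 = -1 := rfl
@[simp] lemma metric_zero_succ (p : Fin 4 → ℝ) (i : Fin 3) : metric h p 0 i.succ = 0 := rfl
@[simp] lemma metric_succ_zero (p : Fin 4 → ℝ) (i : Fin 3) : metric h p i.succ 0 = 0 := rfl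
@[simp] lemma metric_succ_succ (p : Fin 4 → ℝ) (i j : Fin 3) :
    metric h p i.succ j.succ = h (p 0) i j := rfl

/-- The inverse metric, in terms of the inverse spatial metric. -/
def blockInv (K : Matrix (Fin 3) (Fin 3) ℝ) : Matrix (Fin 4) (Fin 4) ℝ :=
  Matrix.of fun m n =>
    Fin.cases (Fin.cases (-1) (fun _ => 0) n) (fun i => Fin.cases 0 (fun j => K i j) n) m

@[simp] lemma blockInv_zero_zero (K : Matrix (Fin 3) (Fin 3) ℝ) : blockInv K 0 0 = -1 := rfl
@[simp] lemma blockInv_zero_succ (K : Matrix (Fin 3) (Fin 3) ℝ) (i : Fin 3) :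
    blockInv K 0 i.succ = 0 := rfl
@[simp] lemma blockInv_succ_zero (K : Matrix (Fin 3) (Fin 3) ℝ) (i : Fin 3) :
    blockInv K i.succ 0 = 0 := rfl
@[simp] lemma blockInv_succ_succ (K : Matrix (Fin 3) (Fin 3) ℝ) (i j : Fin 3) :
    blockInv K i.succ j.succ = K i j := rfl

lemma metric_inv {p : Fin 4 → ℝ} (hp : (h (p 0)).det ≠ 0) :
    (metric h p)⁻¹ = blockInv (h (p 0))⁻¹ := by
  refine Matrix.inv_eq_right_inv ?_
  have hu := Matrix.mul_nonsing_inv _ (isUnit_iff_ne_zero.2 hp)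
  ext m n
  rw [Matrix.mul_apply, Fin.sum_univ_succ]
  refine Fin.cases ?_ (fun i => ?_) m <;> refine Fin.cases ?_ (fun j => ?_) n
  · simp
  · simp [(Fin.succ_ne_zero j).symm]
  · simp [Fin.succ_ne_zero i]
  · simpa [Matrix.mul_apply, Matrix.one_apply] using congrFun (congrFun hu i) j

lemma pd_zero_of_time (f : ℝ → ℝ) (p : Fin 4 → ℝ) : pd 0 (fun x => f (x 0)) p = deriv f (p 0) := by
  simp [pd]

lemma pd_succ_of_time (f : ℝ → ℝ) (p : Fin 4 → ℝ) (i : Fin 3) :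
    pd i.succ (fun x => f (x 0)) p = 0 := by
  simp [pd, (Fin.succ_ne_zero i).symm]

lemma pd_zero_congr {f : (Fin 4 → ℝ) → ℝ} {g : ℝ → ℝ} {p : Fin 4 → ℝ}
    (hfg : ∀ᶠ s in 𝓝 (p 0), f (Function.update p 0 s) = g s) : pd 0 f p = deriv g (p 0) :=
  Filter.EventuallyEq.deriv_eq hfg

lemma pd_succ_eq_zero {f : (Fin 4 → ℝ) → ℝ} {c : ℝ} {p : Fin 4 → ℝ} {i : Fin 3}
    (hf : ∀ s, f (Function.update p i.succ s) = c) : pd i.succ f p = 0 := by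
  simp [pd, hf]

/-- The mixed expansion tensor `θ^i_j`. -/
def mixedExpansion (h : ℝ → Matrix (Fin 3) (Fin 3) ℝ) (t : ℝ) : Matrix (Fin 3) (Fin 3) ℝ :=
  (h t)⁻¹ * expansion h t

/-- The Christoffel symbols as functions of time. -/
def timeChristoffel (h : ℝ → Matrix (Fin 3) (Fin 3) ℝ) (l m n : Fin 4) (t : ℝ) : ℝ :=
  Fin.cases
    (Fin.cases 0 (fun i => Fin.cases 0 (fun j => expansion h t i j) n) m)
    (fun k => Fin.cases (Fin.cases 0 (fun j => mixedExpansion h t k j) n)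
      (fun i => Fin.cases (mixedExpansion h t k i) (fun _ => 0) n) m) l

/-- The metric depends on `t` alone, so only the time derivatives of `h` survive. Both sides are
written with `deriv`, so neither differentiability nor symmetry of `h` is needed. -/
lemma christoffel_eq {p : Fin 4 → ℝ}
    (hp : (h (p 0)).det ≠ 0) (l m n : Fin 4) :
    christoffel (metric h) l m n p = timeChristoffel h l m n (p 0) := by
  have e00 : ∀ k, pd k (fun x => metric h x 0 0) p = 0 := fun k => by simp [pd]
  have e0s : ∀ k j, pd k (fun x => metric h x 0 (Fin.succ j)) p = 0 := fun k j => by simp [pd]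
  have es0 : ∀ k j, pd k (fun x => metric h x (Fin.succ j) 0) p = 0 := fun k j => by simp [pd]
  have ess0 : ∀ i j, pd 0 (fun x => metric h x (Fin.succ i) (Fin.succ j)) p =
      deriv (fun s => h s i j) (p 0) := fun i j => pd_zero_of_time (fun s => h s i j) p
  have esss : ∀ k i j, pd (Fin.succ k) (fun x => metric h x (Fin.succ i) (Fin.succ j)) p = 0 :=
    fun k i j => pd_succ_of_time (fun s => h s i j) p k
  rw [christoffel, metric_inv hp, Fin.sum_univ_succ]
  refine Fin.cases ?_ (fun k => ?_) l <;> refine Fin.cases ?_ (fun i => ?_) m <;>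
    refine Fin.cases ?_ (fun j => ?_) n <;>
    simp only [e00, e0s, es0, ess0, esss, blockInv_zero_zero, blockInv_zero_succ,
      blockInv_succ_zero, blockInv_succ_succ, timeChristoffel, Fin.cases_zero, Fin.cases_succ] <;>
    simp [mixedExpansion, expansion, Matrix.mul_apply, Finset.mul_sum] <;>
    exact Finset.sum_congr rfl fun s _ => by ring

variable {p : Fin 4 → ℝ}

lemma pd_zero_christoffel (hp : ∀ᶠ s in 𝓝 (p 0), (h s).det ≠ 0)
    (l m n : Fin 4) :
    pd 0 (christoffel (metric h) l m n) p = deriv (timeChristoffel h l m n) (p 0) :=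
  pd_zero_congr (hp.mono fun s hs => by
    rw [christoffel_eq (by simpa using hs)]; simp)

lemma pd_succ_christoffel (hp : ∀ᶠ s in 𝓝 (p 0), (h s).det ≠ 0)
    (i : Fin 3) (l m n : Fin 4) :
    pd i.succ (christoffel (metric h) l m n) p = 0 :=
  pd_succ_eq_zero (c := timeChristoffel h l m n (p 0)) fun s => by
    have h0 : Function.update p i.succ s 0 = p 0 := by simp [(Fin.succ_ne_zero i).symm]
    rw [christoffel_eq (by rw [h0]; exact hp.self_of_nhds), h0]

/-- This is the geometric side of the Raychaudhuri equation for the geodesic, irrotational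
observers. -/
lemma ricci_zero_zero (hp : ∀ᶠ s in 𝓝 (p 0), (h s).det ≠ 0) : ricci (metric h) 0 0 p =
    -∑ i, deriv (fun s => mixedExpansion h s i i) (p 0) -
      (mixedExpansion h (p 0) * mixedExpansion h (p 0)).trace := by
  have hd : ∀ i : Fin 3, timeChristoffel h i.succ 0 i.succ = fun s => mixedExpansion h s i i :=
    fun i => rfl
  have hd0 : timeChristoffel h 0 0 0 = fun s => 0 := rfl
  have hd1 : ∀ i : Fin 3, timeChristoffel h i.succ 0 0 = fun s => 0 := fun i => rfl
  simp only [ricci, Fin.sum_univ_succ (n := 3), pd_zero_christoffel hp, pd_succ_christoffel hp,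
    christoffel_eq hp.self_of_nhds, hd, hd0, hd1]
  simp [timeChristoffel, Matrix.trace, Matrix.mul_apply, Finset.sum_neg_distrib]
  ring

lemma ricci_zero_succ (hp : ∀ᶠ s in 𝓝 (p 0), (h s).det ≠ 0)
    (i : Fin 3) : ricci (metric h) 0 i.succ p = 0 := by
  have hd0 : timeChristoffel h 0 0 i.succ = fun s => 0 := rfl
  simp only [ricci, Fin.sum_univ_succ (n := 3), pd_zero_christoffel hp, pd_succ_christoffel hp,
    christoffel_eq hp.self_of_nhds, hd0]
  simp [timeChristoffel]

lemma ricci_succ_zero (hp : ∀ᶠ s in 𝓝 (p 0), (h s).det ≠ 0)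
    (i : Fin 3) : ricci (metric h) i.succ 0 p = 0 := by
  have hd0 : timeChristoffel h 0 i.succ 0 = fun s => 0 := rfl
  have hd1 : ∀ j : Fin 3, timeChristoffel h j.succ i.succ j.succ = fun s => 0 := fun j => rfl
  simp only [ricci, Fin.sum_univ_succ (n := 3), pd_zero_christoffel hp, pd_succ_christoffel hp,
    christoffel_eq hp.self_of_nhds, hd0, hd1]
  simp [timeChristoffel]

/-- The slices are flat, so only expansion terms occur. The two products at the end agree once `h`
is symmetric; they are kept apart because symmetry is not assumed here. -/
lemma ricci_succ_succ (hp : ∀ᶠ s in 𝓝 (p 0), (h s).det ≠ 0)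
    (i j : Fin 3) : ricci (metric h) i.succ j.succ p =
    deriv (fun s => expansion h s i j) (p 0) +
      (mixedExpansion h (p 0)).trace * expansion h (p 0) i j -
      (expansion h (p 0) * mixedExpansion h (p 0)) j i -
      (expansion h (p 0) * mixedExpansion h (p 0)) i j := by
  have hd0 : timeChristoffel h 0 i.succ j.succ = fun s => expansion h s i j := rfl
  simp only [ricci, Fin.sum_univ_succ (n := 3), pd_zero_christoffel hp, pd_succ_christoffel hp,
    christoffel_eq hp.self_of_nhds, hd0]
  simp [timeChristoffel, Matrix.trace, Matrix.mul_apply, Finset.sum_sub_distrib,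
    Finset.mul_sum, mul_comm]
  ring

end Curvature

/-! ### The reduced field equations -/

/-- The spatial components of the `j`-form. -/
def spatial (J : ℝ → Fin 4 → ℝ) (t : ℝ) : Fin 3 → ℝ := fun i => J t i.succ

/-- The right-hand side of the evolution equation of the mixed expansion tensor. -/
def mixedRate (γ : ℝ) (K Θ : Matrix (Fin 3) (Fin 3) ℝ) (j : Fin 3 → ℝ) (r : ℝ) :
    Matrix (Fin 3) (Fin 3) ℝ :=
  -(Θ.trace • Θ) + vecMulVec (K *ᵥ j) j + ((2 - γ) / 2 * r) • (1 : Matrix (Fin 3) (Fin 3) ℝ)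

/-- The Einstein equations and the equations of the `j`-form as ordinary differential equations and
constraints for the spatial metric `h` and the mixed expansion tensor `Θ`. -/
structure IsReduced (γ : ℝ) (I : Set ℝ) (h Θ : ℝ → Matrix (Fin 3) (Fin 3) ℝ)
    (J : ℝ → Fin 4 → ℝ) (ρ : ℝ → ℝ) : Prop where
  posDef : ∀ t ∈ I, (h t).PosDef
  density_nonneg : ∀ t ∈ I, 0 ≤ ρ t
  deriv_metric : ∀ t ∈ I, HasMatDerivAt h ((2 : ℝ) • (h t * Θ t)) t
  deriv_mixed : ∀ t ∈ I, HasMatDerivAt Θ (mixedRate γ (h t)⁻¹ (Θ t) (spatial J t) (ρ t)) t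
  deriv_form_zero : ∀ t ∈ I, HasDerivAt (fun s => J s 0) (-(Θ t).trace * J t 0) t
  deriv_form_succ : ∀ t ∈ I, ∀ i : Fin 3, HasDerivAt (fun s => J s i.succ) 0 t
  momentum : ∀ t ∈ I, ∀ i : Fin 3, J t 0 * J t i.succ = 0
  friedmann : ∀ t ∈ I, (Θ t).trace ^ 2 - (Θ t * Θ t).trace =
    2 * ρ t + J t 0 ^ 2 + spatial J t ⬝ᵥ ((h t)⁻¹ *ᵥ spatial J t)

/-! ### The field equations at one point -/

section Pointwise

variable {γ : ℝ} {h : ℝ → Matrix (Fin 3) (Fin 3) ℝ} {J : ℝ → Fin 4 → ℝ} {ρ : ℝ → ℝ}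
  {p : Fin 4 → ℝ}

lemma covDeriv_zero_zero (hp : (h (p 0)).det ≠ 0) :
    covDeriv (metric h) (formField J) 0 0 p = deriv (fun s => J s 0) (p 0) := by
  have : pd 0 (fun x => formField J x 0) p = deriv (fun s => J s 0) (p 0) :=
    pd_zero_of_time (fun s => J s 0) p
  rw [covDeriv, this]
  simp [Fin.sum_univ_succ (n := 3), christoffel_eq hp, timeChristoffel]

lemma covDeriv_zero_succ (hp : (h (p 0)).det ≠ 0) (i : Fin 3) :
    covDeriv (metric h) (formField J) 0 i.succ p = deriv (fun s => J s i.succ) (p 0) -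
      ∑ k, mixedExpansion h (p 0) k i * J (p 0) k.succ := by
  have : pd 0 (fun x => formField J x i.succ) p = deriv (fun s => J s i.succ) (p 0) :=
    pd_zero_of_time (fun s => J s i.succ) p
  rw [covDeriv, this]
  simp [Fin.sum_univ_succ (n := 3), christoffel_eq hp, timeChristoffel, formField]

lemma covDeriv_succ_zero (hp : (h (p 0)).det ≠ 0) (i : Fin 3) :
    covDeriv (metric h) (formField J) i.succ 0 p =
      -∑ k, mixedExpansion h (p 0) k i * J (p 0) k.succ := by
  have : pd i.succ (fun x => formField J x 0) p = 0 := pd_succ_of_time (fun s => J s 0) p i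
  rw [covDeriv, this]
  simp [Fin.sum_univ_succ (n := 3), christoffel_eq hp, timeChristoffel, formField]

lemma covDeriv_succ_succ (hp : (h (p 0)).det ≠ 0) (i j : Fin 3) :
    covDeriv (metric h) (formField J) i.succ j.succ p = -(expansion h (p 0) i j * J (p 0) 0) := by
  have : pd i.succ (fun x => formField J x j.succ) p = 0 :=
    pd_succ_of_time (fun s => J s j.succ) p i
  rw [covDeriv, this]
  simp [Fin.sum_univ_succ (n := 3), christoffel_eq hp, timeChristoffel, formField]

lemma form_norm_eq (hp : (h (p 0)).det ≠ 0) :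
    ∑ r, ∑ s, (metric h p)⁻¹ r s * formField J p r * formField J p s =
      -J (p 0) 0 ^ 2 + spatial J (p 0) ⬝ᵥ ((h (p 0))⁻¹ *ᵥ spatial J (p 0)) := by
  rw [metric_inv hp]
  simp only [Fin.sum_univ_succ (n := 3), blockInv_zero_zero, blockInv_zero_succ,
    blockInv_succ_zero, blockInv_succ_succ, formField, dotProduct, Matrix.mulVec, spatial,
    Finset.mul_sum]
  simp only [zero_mul, Finset.sum_const_zero, add_zero, zero_add]
  congr 1
  · ring
  · exact Finset.sum_congr rfl fun i _ => Finset.sum_congr rfl fun j _ => by ring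

variable {T : Matrix (Fin 3) (Fin 3) ℝ}

lemma trace_mul_transpose_of_symm {K X : Matrix (Fin 3) (Fin 3) ℝ} (hK : Kᵀ = K) :
    ∑ i, ∑ j, K i j * X i j = (K * X).trace := by
  conv_rhs => rw [← hK]
  simp only [Matrix.trace, Matrix.diag_apply, Matrix.mul_apply, Matrix.transpose_apply]
  exact Finset.sum_comm

/-- The Einstein equations at a point, in terms of the mixed expansion tensor. -/
lemma einstein_iff (hp : ∀ᶠ s in 𝓝 (p 0), (h s).det ≠ 0) (hs : ∀ᶠ s in 𝓝 (p 0), (h s)ᵀ = h s)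
    (hh : HasMatDerivAt h ((2 : ℝ) • expansion h (p 0)) (p 0))
    (hT : HasMatDerivAt (mixedExpansion h) T (p 0)) :
    (∀ m n, einstein (metric h) m n p = fluidStress γ (metric h) (fun x => ρ (x 0)) m n p +
      formStress (metric h) (formField J) m n p) ↔
    (∀ i : Fin 3, J (p 0) 0 * J (p 0) i.succ = 0) ∧
    ((mixedExpansion h (p 0)).trace ^ 2 - (mixedExpansion h (p 0) * mixedExpansion h (p 0)).trace =
      2 * ρ (p 0) + J (p 0) 0 ^ 2 + spatial J (p 0) ⬝ᵥ ((h (p 0))⁻¹ *ᵥ spatial J (p 0))) ∧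
    T = mixedRate γ (h (p 0))⁻¹ (mixedExpansion h (p 0)) (spatial J (p 0)) (ρ (p 0)) := by
  set t := p 0 with ht
  set Θ := mixedExpansion h t with hΘ
  set K := (h t)⁻¹ with hK
  set j := spatial J t with hj
  have hdet : IsUnit (h t).det := isUnit_iff_ne_zero.2 hp.self_of_nhds
  have hsym : (h t)ᵀ = h t := hs.self_of_nhds
  have hKh : K * h t = 1 := Matrix.nonsing_inv_mul _ hdet
  have hhK : h t * K = 1 := Matrix.mul_nonsing_inv _ hdet
  have hKsym : Kᵀ = K := by rw [hK, Matrix.transpose_nonsing_inv, hsym]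
  have hθ : ∀ s, (h s).det ≠ 0 → expansion h s = h s * mixedExpansion h s := fun s hs => by
    rw [mixedExpansion, ← Matrix.mul_assoc, Matrix.mul_nonsing_inv _ (isUnit_iff_ne_zero.2 hs),
      Matrix.one_mul]
  have hθt : expansion h t = h t * Θ := hθ t hp.self_of_nhds
  have hθsym : (expansion h t)ᵀ = expansion h t := by
    have h1 := hh.transpose.congr_of_eventuallyEq (hs.mono fun s hs => hs.symm)
    have h2 := h1.unique hh
    rw [Matrix.transpose_smul] at h2
    exact smul_right_injective _ (two_ne_zero (α := ℝ)) h2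
  have hθΘ : (expansion h t * Θ)ᵀ = expansion h t * Θ := by
    rw [hΘ, mixedExpansion, ← hK, Matrix.transpose_mul, Matrix.transpose_mul, hθsym, hKsym,
      Matrix.mul_assoc]
  have hdθ : HasMatDerivAt (expansion h) ((2 : ℝ) • (expansion h t * Θ) + h t * T) t := by
    refine ((hh.mul hT).congr_of_eventuallyEq (hp.mono hθ)).congr_deriv ?_
    rw [Matrix.smul_mul]
  -- `X` is the mixed spatial Ricci tensor: with `h' = 2 h Θ`, the derivative of `h Θ` cancels the
  -- two quadratic terms of the spatial Ricci tensor.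
  set X := T + Θ.trace • Θ with hX
  have hR00 : ricci (metric h) 0 0 p = -T.trace - (Θ * Θ).trace := by
    rw [ricci_zero_zero hp]
    congr 1
    rw [Matrix.trace]
    exact congrArg _ (Finset.sum_congr rfl fun i _ => (hT i i).deriv)
  have hRij : ∀ i k : Fin 3, ricci (metric h) i.succ k.succ p = (h t * X) i k := fun i k => by
    rw [ricci_succ_succ hp, (hdθ i k).deriv, ← ht, ← hΘ,
      show (expansion h t * Θ) k i = (expansion h t * Θ) i k from congrFun (congrFun hθΘ i) k]
    simp only [hX, Matrix.mul_add, Matrix.mul_smul, Matrix.add_apply, Matrix.smul_apply, ← hθt,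
      smul_eq_mul]
    ring
  have hR : scalarCurvature (metric h) p = T.trace + (Θ * Θ).trace + X.trace := by
    rw [scalarCurvature, metric_inv hp.self_of_nhds]
    simp only [Fin.sum_univ_succ (n := 3), blockInv_zero_zero, blockInv_zero_succ,
      blockInv_succ_zero, blockInv_succ_succ, hR00, hRij, zero_mul, Finset.sum_const_zero,
      add_zero, zero_add]
    rw [← ht, ← hK, trace_mul_transpose_of_symm hKsym, ← Matrix.mul_assoc, hKh, Matrix.one_mul]
    ring
  have htrX : X.trace = T.trace + Θ.trace ^ 2 := by
    simp [hX, Matrix.trace_add, Matrix.trace_smul, pow_two]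
  have hN := form_norm_eq (J := J) hp.self_of_nhds
  rw [← ht, ← hK, ← hj] at hN
  set N := -J t 0 ^ 2 + j ⬝ᵥ (K *ᵥ j) with hNdef
  have e00 : (einstein (metric h) 0 0 p = fluidStress γ (metric h) (fun x => ρ (x 0)) 0 0 p +
      formStress (metric h) (formField J) 0 0 p) ↔
      Θ.trace ^ 2 - (Θ * Θ).trace = 2 * ρ t + J t 0 ^ 2 + j ⬝ᵥ (K *ᵥ j) := by
    simp only [einstein, fluidStress, formStress, hN, hR00, hR, htrX, metric_zero_zero, uLower]
    simp only [formField, ← ht, hNdef, if_true]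
    constructor <;> intro h <;> linarith
  have e0i : ∀ i : Fin 3, (einstein (metric h) 0 i.succ p =
      fluidStress γ (metric h) (fun x => ρ (x 0)) 0 i.succ p +
      formStress (metric h) (formField J) 0 i.succ p) ↔ J t 0 * J t i.succ = 0 := fun i => by
    simp only [einstein, fluidStress, formStress, ricci_zero_succ hp, metric_zero_succ, uLower,
      formField, ← ht, Fin.succ_ne_zero, if_false]
    constructor <;> intro h <;> linarith
  have ei0 : ∀ i : Fin 3, (einstein (metric h) i.succ 0 p =
      fluidStress γ (metric h) (fun x => ρ (x 0)) i.succ 0 p +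
      formStress (metric h) (formField J) i.succ 0 p) ↔ J t 0 * J t i.succ = 0 := fun i => by
    simp only [einstein, fluidStress, formStress, ricci_succ_zero hp, metric_succ_zero, uLower,
      formField, ← ht, Fin.succ_ne_zero, if_false]
    constructor <;> intro h <;> linarith
  have eij : (∀ i k : Fin 3, einstein (metric h) i.succ k.succ p =
      fluidStress γ (metric h) (fun x => ρ (x 0)) i.succ k.succ p +
      formStress (metric h) (formField J) i.succ k.succ p) ↔
      X = vecMulVec (K *ᵥ j) j + ((1 / 2) * (T.trace + (Θ * Θ).trace + X.trace) +
        (γ - 1) * ρ t - (1 / 2) * N) • (1 : Matrix (Fin 3) (Fin 3) ℝ) := by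
    have hmat : (∀ i k : Fin 3, einstein (metric h) i.succ k.succ p =
      fluidStress γ (metric h) (fun x => ρ (x 0)) i.succ k.succ p +
      formStress (metric h) (formField J) i.succ k.succ p) ↔
      h t * X = vecMulVec j j + ((1 / 2) * (T.trace + (Θ * Θ).trace + X.trace) +
        (γ - 1) * ρ t - (1 / 2) * N) • h t := by
      rw [← Matrix.ext_iff]
      refine forall_congr' fun i => forall_congr' fun k => ?_
      simp only [einstein, fluidStress, formStress, hRij, hR, hN, metric_succ_succ, uLower]
      simp only [formField, ← ht, Fin.succ_ne_zero, if_false, Matrix.add_apply, Matrix.smul_apply,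
        vecMulVec_apply, smul_eq_mul, hj, spatial]
      constructor <;> intro h <;> linarith
    rw [hmat]
    constructor
    · intro h1
      have h2 := congrArg (K * ·) h1
      simpa only [← Matrix.mul_assoc, hKh, Matrix.one_mul, Matrix.mul_add, Matrix.mul_smul,
        Matrix.mul_vecMulVec] using h2
    · intro h1
      have h2 := congrArg (h t * ·) h1
      simpa only [Matrix.mul_add, Matrix.mul_smul, Matrix.mul_vecMulVec, Matrix.mulVec_mulVec, hhK,
        Matrix.one_mulVec, Matrix.mul_one] using h2
  have htrv : (vecMulVec (K *ᵥ j) j).trace = j ⬝ᵥ (K *ᵥ j) := by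
    rw [Matrix.trace_vecMulVec, dotProduct_comm]
  have hsplit : (∀ m n, einstein (metric h) m n p = fluidStress γ (metric h) (fun x => ρ (x 0)) m n p +
      formStress (metric h) (formField J) m n p) ↔
      (∀ i : Fin 3, J t 0 * J t i.succ = 0) ∧
      (Θ.trace ^ 2 - (Θ * Θ).trace = 2 * ρ t + J t 0 ^ 2 + j ⬝ᵥ (K *ᵥ j)) ∧
      X = vecMulVec (K *ᵥ j) j + ((1 / 2) * (T.trace + (Θ * Θ).trace + X.trace) +
        (γ - 1) * ρ t - (1 / 2) * N) • (1 : Matrix (Fin 3) (Fin 3) ℝ) := by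
    rw [← eij, ← e00]
    constructor
    · exact fun H => ⟨fun i => (e0i i).1 (H _ _), H _ _, fun i k => H _ _⟩
    · rintro ⟨h1, h2, h3⟩ m n
      refine Fin.cases ?_ (fun i => ?_) m <;> refine Fin.cases ?_ (fun k => ?_) n
      · exact h2
      · exact (e0i k).2 (h1 k)
      · exact (ei0 i).2 (h1 i)
      · exact h3 i k
  rw [hsplit]
  -- The scalar coefficient in the spatial equation still contains the trace of `X`. Taking the
  -- trace and inserting the Friedmann constraint determines it as `(2 - γ) ρ / 2`.
  refine and_congr_right fun _ => and_congr_right fun hF => ?_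
  constructor
  · intro h1
    have h2 := congrArg Matrix.trace h1
    rw [htrX, Matrix.trace_add (vecMulVec _ _), Matrix.trace_smul, htrv, Matrix.trace_one] at h2
    simp only [Fintype.card_fin, smul_eq_mul, hNdef] at h2
    have hc : (1 / 2) * (T.trace + (Θ * Θ).trace + X.trace) + (γ - 1) * ρ t - (1 / 2) * N =
        (2 - γ) / 2 * ρ t := by
      rw [htrX, hNdef]; push_cast at h2; linarith
    rw [hc] at h1
    rw [mixedRate, ← sub_eq_zero]
    rw [← sub_eq_zero] at h1
    rw [← h1, hX]
    abel
  · intro h1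
    have hX' : X = vecMulVec (K *ᵥ j) j + ((2 - γ) / 2 * ρ t) • (1 : Matrix (Fin 3) (Fin 3) ℝ) := by
      rw [hX, h1, mixedRate]; abel
    have h2 := congrArg Matrix.trace hX'
    rw [htrX, Matrix.trace_add, Matrix.trace_smul, htrv, Matrix.trace_one] at h2
    simp only [Fintype.card_fin, smul_eq_mul] at h2
    have hc : (1 / 2) * (T.trace + (Θ * Θ).trace + X.trace) + (γ - 1) * ρ t - (1 / 2) * N =
        (2 - γ) / 2 * ρ t := by
      rw [htrX, hNdef]; push_cast at h2; linarith
    rw [hc, hX']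

end Pointwise

/-! ### Equivalence of the field equations and the reduced equations -/

lemma contDiffOn_one_of_hasDerivAt {f f' : ℝ → ℝ} {I : Set ℝ} (hI : IsOpen I)
    (hf : ∀ t ∈ I, HasDerivAt f (f' t) t) (hc : ContinuousOn f' I) : ContDiffOn ℝ 1 f I := by
  have := (contDiffOn_succ_iff_deriv_of_isOpen (𝕜 := ℝ) (n := 0) (f := f) hI).2
    ⟨fun t ht => (hf t ht).differentiableAt.differentiableWithinAt, by simp,
      contDiffOn_zero.2 (hc.congr fun t ht => (hf t ht).deriv)⟩
  simpa using this

lemma contDiffOn_two_of_hasDerivAt {f f' f'' : ℝ → ℝ} {I : Set ℝ} (hI : IsOpen I)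
    (hf : ∀ t ∈ I, HasDerivAt f (f' t) t) (hf' : ∀ t ∈ I, HasDerivAt f' (f'' t) t)
    (hc : ContinuousOn f'' I) : ContDiffOn ℝ 2 f I := by
  have := (contDiffOn_succ_iff_deriv_of_isOpen (𝕜 := ℝ) (n := 1) (f := f) hI).2
    ⟨fun t ht => (hf t ht).differentiableAt.differentiableWithinAt, by simp,
      (contDiffOn_one_of_hasDerivAt hI hf' hc).congr fun t ht => (hf t ht).deriv⟩
  rwa [one_add_one_eq_two] at this

lemma posDef_det_ne_zero {M : Matrix (Fin 3) (Fin 3) ℝ} (hM : M.PosDef) : M.det ≠ 0 := hM.det_pos.ne'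

lemma posDef_transpose {M : Matrix (Fin 3) (Fin 3) ℝ} (hM : M.PosDef) : Mᵀ = M := by
  simpa [Matrix.IsHermitian, conjTranspose_eq_transpose_of_trivial] using hM.isHermitian

variable {γ : ℝ} {I : Set ℝ} {h Θ : ℝ → Matrix (Fin 3) (Fin 3) ℝ} {J : ℝ → Fin 4 → ℝ} {ρ : ℝ → ℝ}

lemma expansion_eq_of_hasMatDerivAt {t : ℝ} {A : Matrix (Fin 3) (Fin 3) ℝ}
    (hh : HasMatDerivAt h ((2 : ℝ) • A) t) : expansion h t = A := by
  ext i j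
  simp [expansion, (hh i j).deriv]

lemma IsReduced.mixedExpansion_eq (H : IsReduced γ I h Θ J ρ) {t : ℝ} (ht : t ∈ I) :
    mixedExpansion h t = Θ t := by
  rw [mixedExpansion, expansion_eq_of_hasMatDerivAt (H.deriv_metric t ht), ← Matrix.mul_assoc,
    Matrix.nonsing_inv_mul _ (isUnit_iff_ne_zero.2 (posDef_det_ne_zero (H.posDef t ht))),
    Matrix.one_mul]

lemma trace_inv_mul_expansion {t : ℝ} (hK : ((h t)⁻¹)ᵀ = (h t)⁻¹) :
    ∑ i, ∑ j, (h t)⁻¹ i j * expansion h t i j = (mixedExpansion h t).trace :=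
  trace_mul_transpose_of_symm hK

lemma coclosed_sum_eq {p : Fin 4 → ℝ} (hp : (h (p 0)).PosDef) :
    ∑ m, ∑ n, (metric h p)⁻¹ m n * covDeriv (metric h) (formField J) m n p =
      -deriv (fun s => J s 0) (p 0) - (mixedExpansion h (p 0)).trace * J (p 0) 0 := by
  have hdet := posDef_det_ne_zero hp
  have hK : ((h (p 0))⁻¹)ᵀ = (h (p 0))⁻¹ := by
    rw [Matrix.transpose_nonsing_inv, posDef_transpose hp]
  rw [← trace_inv_mul_expansion hK, metric_inv hdet]
  simp only [Fin.sum_univ_succ (n := 3), blockInv_zero_zero, blockInv_zero_succ,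
    blockInv_succ_zero, blockInv_succ_succ, covDeriv_zero_zero hdet, covDeriv_succ_succ hdet,
    zero_mul, Finset.sum_const_zero, add_zero, zero_add, Finset.sum_mul, mul_neg,
    Finset.sum_neg_distrib, mul_assoc]
  ring

/-- Solutions of the field equations solve the reduced equations. -/
theorem IsTypeISolution.isReduced (hI : IsOpen I) (H : IsTypeISolution γ I h J ρ) :
    IsReduced γ I h (mixedExpansion h) J ρ := by
  have hmem : ∀ t ∈ I, I ∈ 𝓝 t := fun t ht => hI.mem_nhds ht
  have hp : ∀ t ∈ I, ∀ᶠ s in 𝓝 t, (h s).det ≠ 0 := fun t ht =>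
    Filter.mem_of_superset (hmem t ht) fun s hs => posDef_det_ne_zero (H.metric_posDef s hs)
  have hs : ∀ t ∈ I, ∀ᶠ s in 𝓝 t, (h s)ᵀ = h s := fun t ht =>
    Filter.mem_of_superset (hmem t ht) fun s hs => posDef_transpose (H.metric_posDef s hs)
  have hh : ∀ t ∈ I, HasMatDerivAt h ((2 : ℝ) • expansion h t) t := fun t ht i j => by
    have := ((H.metric_smooth i j).contDiffAt (hmem t ht)).differentiableAt (by simp)
    refine this.hasDerivAt.congr_deriv ?_
    simp [expansion]
  have hex : ∀ t ∈ I, ∃ T, HasMatDerivAt (expansion h) T t := fun t ht => by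
    refine ⟨Matrix.of fun i j => (1 / 2) * deriv (deriv (fun s => h s i j)) t, fun i j => ?_⟩
    have h1 := (contDiffOn_succ_iff_deriv_of_isOpen (𝕜 := ℝ) (n := 1) hI).1
      (by simpa [one_add_one_eq_two] using H.metric_smooth i j)
    have h2 : DifferentiableAt ℝ (deriv (fun s => h s i j)) t :=
      (h1.2.2.contDiffAt (hmem t ht)).differentiableAt (by simp)
    exact h2.hasDerivAt.const_mul (1 / 2)
  have hmx : ∀ t ∈ I, ∃ T, HasMatDerivAt (mixedExpansion h) T t := fun t ht => by
    obtain ⟨T, hT⟩ := hex t ht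
    exact ⟨_, ((hh t ht).inv (hp t ht)).mul hT⟩
  have hJ : ∀ t ∈ I, ∀ m, HasDerivAt (fun s => J s m) (deriv (fun s => J s m) t) t :=
    fun t ht m => (((H.form_smooth m).contDiffAt (hmem t ht)).differentiableAt (by simp)).hasDerivAt
  have key : ∀ t ∈ I, ∃ p : Fin 4 → ℝ, p 0 = t := fun t _ => ⟨fun _ => t, rfl⟩
  have hE : ∀ t ∈ I, (∀ i : Fin 3, J t 0 * J t i.succ = 0) ∧
      ((mixedExpansion h t).trace ^ 2 - (mixedExpansion h t * mixedExpansion h t).trace =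
        2 * ρ t + J t 0 ^ 2 + spatial J t ⬝ᵥ ((h t)⁻¹ *ᵥ spatial J t)) ∧
      HasMatDerivAt (mixedExpansion h)
        (mixedRate γ (h t)⁻¹ (mixedExpansion h t) (spatial J t) (ρ t)) t := by
    intro t ht
    obtain ⟨T, hT⟩ := hmx t ht
    obtain ⟨p, rfl⟩ := key t ht
    obtain ⟨h1, h2, h3⟩ := (einstein_iff (hp _ ht) (hs _ ht) (hh _ ht) hT).1 (H.einstein_eq p ht)
    exact ⟨h1, h2, h3 ▸ hT⟩
  exact
    { posDef := H.metric_posDef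
      density_nonneg := H.density_nonneg
      deriv_metric := fun t ht => by
        refine (hh t ht).congr_deriv ?_
        rw [mixedExpansion, ← Matrix.mul_assoc, Matrix.mul_nonsing_inv _
          (isUnit_iff_ne_zero.2 (hp t ht).self_of_nhds), Matrix.one_mul]
      deriv_mixed := fun t ht => (hE t ht).2.2
      deriv_form_zero := fun t ht => by
        obtain ⟨p, rfl⟩ := key t ht
        have h1 := H.form_coclosed p ht
        rw [coclosed_sum_eq (H.metric_posDef _ ht)] at h1
        exact (hJ _ ht 0).congr_deriv (by linarith)
      deriv_form_succ := fun t ht i => by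
        obtain ⟨p, rfl⟩ := key t ht
        have h1 := H.form_closed p ht 0 i.succ
        rw [covDeriv_zero_succ (hp _ ht).self_of_nhds,
          covDeriv_succ_zero (hp _ ht).self_of_nhds] at h1
        exact (hJ _ ht i.succ).congr_deriv (by linarith)
      momentum := fun t ht => (hE t ht).1
      friedmann := fun t ht => (hE t ht).2.1 }

lemma IsReduced.hasMatDerivAt_inv (hI : IsOpen I) (H : IsReduced γ I h Θ J ρ) {t : ℝ} (ht : t ∈ I) :
    HasMatDerivAt (fun s => (h s)⁻¹) (-((2 : ℝ) • (Θ t * (h t)⁻¹))) t := by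
  have hp : ∀ᶠ s in 𝓝 t, (h s).det ≠ 0 :=
    Filter.mem_of_superset (hI.mem_nhds ht) fun s hs => posDef_det_ne_zero (H.posDef s hs)
  refine ((H.deriv_metric t ht).inv hp).congr_deriv ?_
  rw [Matrix.mul_smul, ← Matrix.mul_assoc, Matrix.nonsing_inv_mul _
    (isUnit_iff_ne_zero.2 hp.self_of_nhds), Matrix.one_mul, Matrix.smul_mul]

lemma HasMatDerivAt.continuousOn {m n : Type*} {A : ℝ → Matrix m n ℝ} {A' : ℝ → Matrix m n ℝ}
    (hA : ∀ t ∈ I, HasMatDerivAt A (A' t) t) (i : m) (j : n) : ContinuousOn (fun t => A t i j) I :=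
  fun t ht => (hA t ht i j).continuousAt.continuousWithinAt

lemma continuousOn_matMul {A B : ℝ → Matrix (Fin 3) (Fin 3) ℝ}
    (hA : ∀ i j, ContinuousOn (fun t => A t i j) I) (hB : ∀ i j, ContinuousOn (fun t => B t i j) I)
    (i j : Fin 3) : ContinuousOn (fun t => (A t * B t) i j) I := by
  simp only [Matrix.mul_apply]
  exact continuousOn_finsetSum _ fun k _ => (hA i k).mul (hB k j)

/-- Conservation of the energy of the fluid. -/
lemma IsReduced.deriv_density (hI : IsOpen I) (H : IsReduced γ I h Θ J ρ) {t : ℝ} (ht : t ∈ I) :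
    HasDerivAt ρ (-(γ * (Θ t).trace) * ρ t) t := by
  have hK := H.hasMatDerivAt_inv hI ht
  have hΘ := H.deriv_mixed t ht
  have hJs : ∀ i, HasDerivAt (fun s => spatial J s i) ((0 : Fin 3 → ℝ) i) t :=
    H.deriv_form_succ t ht
  have hv := hasDerivAt_dotProduct hJs (hK.mulVec hJs)
  have hd := (((hΘ.trace.pow 2).sub (hΘ.mul hΘ).trace).sub
    ((H.deriv_form_zero t ht).pow 2)).sub hv |>.const_mul (1 / 2)
  -- The density is not assumed differentiable; the Friedmann constraint expresses it through
  -- differentiable quantities, and its derivative is the conservation law.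
  have heq : ρ =ᶠ[𝓝 t] fun s => (1 / 2) * ((Θ s).trace ^ 2 - (Θ s * Θ s).trace - J s 0 ^ 2 -
      spatial J s ⬝ᵥ ((h s)⁻¹ *ᵥ spatial J s)) := by
    filter_upwards [hI.mem_nhds ht] with s hs
    linarith [H.friedmann s hs]
  refine (hd.congr_of_eventuallyEq heq).congr_deriv ?_
  have hF := H.friedmann t ht
  have htr : (vecMulVec ((h t)⁻¹ *ᵥ spatial J t) (spatial J t)).trace =
      spatial J t ⬝ᵥ ((h t)⁻¹ *ᵥ spatial J t) := by
    rw [Matrix.trace_vecMulVec, dotProduct_comm]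
  set N := spatial J t ⬝ᵥ ((h t)⁻¹ *ᵥ spatial J t)
  have h1 : (mixedRate γ (h t)⁻¹ (Θ t) (spatial J t) (ρ t)).trace =
      -(Θ t).trace ^ 2 + N + 3 * ((2 - γ) / 2 * ρ t) := by
    simp only [mixedRate, Matrix.trace_add, Matrix.trace_neg, Matrix.trace_smul, htr,
      Matrix.trace_one, smul_eq_mul, Fintype.card_fin]
    push_cast; ring
  have h3 : (Θ t * vecMulVec ((h t)⁻¹ *ᵥ spatial J t) (spatial J t)).trace =
      spatial J t ⬝ᵥ ((Θ t * (h t)⁻¹) *ᵥ spatial J t) := by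
    rw [Matrix.mul_vecMulVec, Matrix.trace_vecMulVec, dotProduct_comm, Matrix.mulVec_mulVec]
  set P := spatial J t ⬝ᵥ ((Θ t * (h t)⁻¹) *ᵥ spatial J t)
  have h2 : (Θ t * mixedRate γ (h t)⁻¹ (Θ t) (spatial J t) (ρ t)).trace =
      -(Θ t).trace * (Θ t * Θ t).trace + P + (2 - γ) / 2 * ρ t * (Θ t).trace := by
    simp only [mixedRate, Matrix.mul_add, Matrix.mul_neg, Matrix.mul_smul, Matrix.mul_one,
      Matrix.trace_add, Matrix.trace_neg, Matrix.trace_smul, h3, smul_eq_mul]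
    ring
  rw [Matrix.trace_add, Matrix.trace_mul_comm (mixedRate _ _ _ _ _), h2, h1]
  simp only [zero_dotProduct, Matrix.mulVec_zero, add_zero, zero_add, Matrix.neg_mulVec,
    Matrix.smul_mulVec, dotProduct_neg, dotProduct_smul, smul_eq_mul]
  simp only [P] at *
  push_cast
  linear_combination (-(Θ t).trace) * hF

/-- Solutions of the reduced equations solve the field equations. -/
theorem IsReduced.isTypeISolution (hI : IsOpen I) (H : IsReduced γ I h Θ J ρ) :
    IsTypeISolution γ I h J ρ := by
  have hmem : ∀ t ∈ I, I ∈ 𝓝 t := fun t ht => hI.mem_nhds ht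
  have hp : ∀ t ∈ I, ∀ᶠ s in 𝓝 t, (h s).det ≠ 0 := fun t ht =>
    Filter.mem_of_superset (hmem t ht) fun s hs => posDef_det_ne_zero (H.posDef s hs)
  have hs : ∀ t ∈ I, ∀ᶠ s in 𝓝 t, (h s)ᵀ = h s := fun t ht =>
    Filter.mem_of_superset (hmem t ht) fun s hs => posDef_transpose (H.posDef s hs)
  have hΘ : ∀ t ∈ I, mixedExpansion h =ᶠ[𝓝 t] Θ := fun t ht =>
    Filter.mem_of_superset (hmem t ht) fun s hs => H.mixedExpansion_eq hs
  have hcK : ∀ i j, ContinuousOn (fun t => (h t)⁻¹ i j) I :=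
    HasMatDerivAt.continuousOn fun t ht => H.hasMatDerivAt_inv hI ht
  have hch := HasMatDerivAt.continuousOn H.deriv_metric
  have hcΘ := HasMatDerivAt.continuousOn H.deriv_mixed
  have hcJ : ∀ i : Fin 3, ContinuousOn (fun t => J t i.succ) I := fun i t ht =>
    (H.deriv_form_succ t ht i).continuousAt.continuousWithinAt
  have hcJ0 : ContinuousOn (fun t => J t 0) I := fun t ht =>
    (H.deriv_form_zero t ht).continuousAt.continuousWithinAt
  have hcρ : ContinuousOn ρ I := fun t ht =>
    (H.deriv_density hI ht).continuousAt.continuousWithinAt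
  have hctr : ContinuousOn (fun t => (Θ t).trace) I := fun t ht =>
    (H.deriv_mixed t ht).trace.continuousAt.continuousWithinAt
  refine
    { metric_smooth := fun i j => ?_
      metric_posDef := H.posDef
      form_smooth := fun m => ?_
      density_nonneg := H.density_nonneg
      einstein_eq := fun p hpI => ?_
      form_closed := fun p hpI m n => ?_
      form_coclosed := fun p hpI => ?_ }
  · refine contDiffOn_two_of_hasDerivAt hI (fun t ht => H.deriv_metric t ht i j)
      (fun t ht => (((H.deriv_metric t ht).mul (H.deriv_mixed t ht)).const_smul 2) i j) ?_
    have hcR : ∀ i j, ContinuousOn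
        (fun t => mixedRate γ (h t)⁻¹ (Θ t) (spatial J t) (ρ t) i j) I := fun i j => by
      have h1 : ContinuousOn (fun t => ∑ k : Fin 3, (h t)⁻¹ i k * J t k.succ) I :=
        continuousOn_finsetSum _ fun k _ => (hcK i k).mul (hcJ k)
      exact ((hctr.mul (hcΘ i j)).neg.add (h1.mul (hcJ j))).add
        ((hcρ.const_mul ((2 - γ) / 2)).mul_const ((1 : Matrix (Fin 3) (Fin 3) ℝ) i j))
    exact continuousOn_const.mul ((continuousOn_matMul (A := fun t => (2 : ℝ) • (h t * Θ t))
      (fun i j => continuousOn_const.mul (continuousOn_matMul hch hcΘ i j)) hcΘ i j).add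
        (continuousOn_matMul hch hcR i j))
  · refine Fin.cases ?_ (fun i => ?_) m
    · exact contDiffOn_one_of_hasDerivAt hI H.deriv_form_zero (hctr.neg.mul hcJ0)
    · exact contDiffOn_one_of_hasDerivAt hI (fun t ht => H.deriv_form_succ t ht i)
        continuousOn_const
  · have hΘp : mixedExpansion h (p 0) = Θ (p 0) := H.mixedExpansion_eq hpI
    refine (einstein_iff (hp _ hpI) (hs _ hpI) ?_
      ((H.deriv_mixed _ hpI).congr_of_eventuallyEq (hΘ _ hpI))).2 ?_
    · rw [expansion_eq_of_hasMatDerivAt (H.deriv_metric _ hpI)]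
      exact H.deriv_metric _ hpI
    · rw [hΘp]
      exact ⟨H.momentum _ hpI, H.friedmann _ hpI, rfl⟩
  · have hdet := (hp _ hpI).self_of_nhds
    have hexs : (expansion h (p 0))ᵀ = expansion h (p 0) := by
      have h1 := H.deriv_metric _ hpI
      have h2 := (h1.transpose.congr_of_eventuallyEq ((hs _ hpI).mono fun s hs => hs.symm)).unique h1
      rw [expansion_eq_of_hasMatDerivAt h1]
      rw [Matrix.transpose_smul] at h2
      exact smul_right_injective _ (two_ne_zero (α := ℝ)) h2
    have hJ0 : ∀ i : Fin 3, deriv (fun s => J s i.succ) (p 0) = 0 := fun i =>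
      (H.deriv_form_succ _ hpI i).deriv
    refine Fin.cases ?_ (fun i => ?_) m <;> refine Fin.cases ?_ (fun k => ?_) n
    · rfl
    · rw [covDeriv_zero_succ hdet, covDeriv_succ_zero hdet, hJ0, zero_sub]
    · rw [covDeriv_zero_succ hdet, covDeriv_succ_zero hdet, hJ0, zero_sub]
    · rw [covDeriv_succ_succ hdet, covDeriv_succ_succ hdet,
        show expansion h (p 0) k i = expansion h (p 0) i k from congrFun (congrFun hexs i) k]
  · rw [coclosed_sum_eq (H.posDef _ hpI), (H.deriv_form_zero _ hpI).deriv, H.mixedExpansion_eq hpI]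
    ring

lemma eq_of_hasDerivAt_zero {f : ℝ → ℝ} {I : Set ℝ} (hI : I.OrdConnected)
    (hf : ∀ t ∈ I, HasDerivAt f 0 t) {s t : ℝ} (hs : s ∈ I) (ht : t ∈ I) : f t = f s := by
  wlog hst : s ≤ t generalizing s t
  · exact (this ht hs (le_of_not_ge hst)).symm
  have hsub : Icc s t ⊆ I := hI.out hs ht
  exact constant_of_has_deriv_right_zero
    (fun τ hτ => (hf τ (hsub hτ)).continuousAt.continuousWithinAt)
    (fun τ hτ => (hf τ (hsub (Ico_subset_Icc_self hτ))).hasDerivWithinAt) t (right_mem_Icc.2 hst)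

/-! ### The field equations in a parallel orthonormal frame -/

/-- The evolution equations in an orthonormal frame `E` that is parallel along the observers, with
dual coframe `C`. -/
structure IsFrameSol (γ : ℝ) (I : Set ℝ) (C E θ : ℝ → Matrix (Fin 3) (Fin 3) ℝ)
    (v : ℝ → Fin 3 → ℝ) (w ρ : ℝ → ℝ) : Prop where
  deriv_coframe : ∀ t ∈ I, HasMatDerivAt C (θ t * C t) t
  deriv_frame : ∀ t ∈ I, HasMatDerivAt E (-(E t * θ t)) t
  deriv_expansion : ∀ t ∈ I, HasMatDerivAt θ (mixedRate γ 1 (θ t) (v t) (ρ t)) t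
  deriv_spatial : ∀ t ∈ I, ∀ a, HasDerivAt (fun s => v s a) (-(θ t *ᵥ v t) a) t
  deriv_temporal : ∀ t ∈ I, HasDerivAt w (-(θ t).trace * w t) t
  deriv_density : ∀ t ∈ I, HasDerivAt ρ (-(γ * (θ t).trace) * ρ t) t

/-- The constraints in an orthonormal frame. -/
structure FrameConstraints (C E θ : Matrix (Fin 3) (Fin 3) ℝ) (v : Fin 3 → ℝ) (w ρ : ℝ) :
    Prop where
  dual : E * C = 1
  symm : θᵀ = θ
  momentum : ∀ a, w * v a = 0
  friedmann : θ.trace ^ 2 - (θ * θ).trace = 2 * ρ + w ^ 2 + v ⬝ᵥ v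
  density_nonneg : 0 ≤ ρ

namespace FrameConstraints

variable {C E θ : Matrix (Fin 3) (Fin 3) ℝ} {v : Fin 3 → ℝ} {w ρ : ℝ}

lemma trace_sq (H : FrameConstraints C E θ v w ρ) : (θ * θ).trace = ∑ a, ∑ b, θ a b ^ 2 := by
  simp only [Matrix.trace, Matrix.diag_apply, Matrix.mul_apply]
  refine Finset.sum_congr rfl fun a _ => Finset.sum_congr rfl fun b _ => ?_
  rw [show θ b a = θ a b from congrFun (congrFun H.symm a) b, pow_two]

/-- Cauchy-Schwarz for the diagonal entries. -/
lemma trace_sq_le (H : FrameConstraints C E θ v w ρ) : θ.trace ^ 2 ≤ 3 * (θ * θ).trace := by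
  rw [H.trace_sq]
  simp only [Matrix.trace, Matrix.diag_apply, Fin.sum_univ_three]
  nlinarith [sq_nonneg (θ 0 0 - θ 1 1), sq_nonneg (θ 1 1 - θ 2 2), sq_nonneg (θ 0 0 - θ 2 2),
    sq_nonneg (θ 0 1), sq_nonneg (θ 0 2), sq_nonneg (θ 1 0), sq_nonneg (θ 1 2), sq_nonneg (θ 2 0),
    sq_nonneg (θ 2 1)]

lemma dotProduct_self_nonneg' (v : Fin 3 → ℝ) : 0 ≤ v ⬝ᵥ v :=
  Finset.sum_nonneg fun i _ => mul_self_nonneg (v i)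

/-- In the Friedmann constraint all terms other than the squared trace have a definite sign, so the
trace bounds every other component. This bound and the three that follow are the a priori estimates
for global existence. -/
lemma abs_expansion_le (H : FrameConstraints C E θ v w ρ) {τ : ℝ} (hτ : 0 ≤ τ) (h : θ.trace ^ 2 ≤ τ ^ 2)
    (a b : Fin 3) : |θ a b| ≤ τ := by
  refine abs_le_of_sq_le_sq ?_ hτ
  have h1 : θ a b ^ 2 ≤ ∑ a, ∑ b, θ a b ^ 2 :=
    (Finset.single_le_sum (f := fun b => θ a b ^ 2) (fun _ _ => sq_nonneg _) (Finset.mem_univ b)).trans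
      (Finset.single_le_sum (f := fun a => ∑ b, θ a b ^ 2)
        (fun _ _ => Finset.sum_nonneg fun _ _ => sq_nonneg _) (Finset.mem_univ a))
  rw [← H.trace_sq] at h1
  nlinarith [H.friedmann, H.density_nonneg, sq_nonneg w, dotProduct_self_nonneg' v]

lemma abs_spatial_le (H : FrameConstraints C E θ v w ρ) {τ : ℝ} (hτ : 0 ≤ τ) (h : θ.trace ^ 2 ≤ τ ^ 2)
    (a : Fin 3) : |v a| ≤ τ := by
  refine abs_le_of_sq_le_sq ?_ hτ
  have h1 : v a * v a ≤ v ⬝ᵥ v :=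
    Finset.single_le_sum (f := fun a => v a * v a) (fun _ _ => mul_self_nonneg _) (Finset.mem_univ a)
  nlinarith [H.friedmann, H.density_nonneg, sq_nonneg w, H.trace_sq_le, sq_nonneg θ.trace]

lemma abs_temporal_le (H : FrameConstraints C E θ v w ρ) {τ : ℝ} (hτ : 0 ≤ τ)
    (h : θ.trace ^ 2 ≤ τ ^ 2) : |w| ≤ τ := by
  refine abs_le_of_sq_le_sq ?_ hτ
  nlinarith [H.friedmann, H.density_nonneg, H.trace_sq_le, sq_nonneg θ.trace,
    dotProduct_self_nonneg' v]

lemma density_le (H : FrameConstraints C E θ v w ρ) {τ : ℝ} (h : θ.trace ^ 2 ≤ τ ^ 2) :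
    |ρ| ≤ τ ^ 2 := by
  rw [abs_of_nonneg H.density_nonneg]
  nlinarith [H.friedmann, H.density_nonneg, H.trace_sq_le, sq_nonneg θ.trace, sq_nonneg w,
    dotProduct_self_nonneg' v]

lemma dual' (H : FrameConstraints C E θ v w ρ) : C * E = 1 := mul_eq_one_comm.1 H.dual

end FrameConstraints

lemma trace_mixedRate_one (γ : ℝ) (θ : Matrix (Fin 3) (Fin 3) ℝ) (v : Fin 3 → ℝ) (r : ℝ) :
    (mixedRate γ 1 θ v r).trace = -θ.trace ^ 2 + v ⬝ᵥ v + 3 * ((2 - γ) / 2 * r) := by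
  simp only [mixedRate, Matrix.trace_add, Matrix.trace_neg, Matrix.trace_smul, Matrix.one_mulVec,
    Matrix.trace_vecMulVec, Matrix.trace_one, smul_eq_mul, Fintype.card_fin]
  push_cast; ring

lemma trace_mul_mixedRate_one (γ : ℝ) (θ : Matrix (Fin 3) (Fin 3) ℝ) (v : Fin 3 → ℝ) (r : ℝ) :
    (θ * mixedRate γ 1 θ v r).trace =
      -θ.trace * (θ * θ).trace + v ⬝ᵥ (θ *ᵥ v) + (2 - γ) / 2 * r * θ.trace := by
  simp only [mixedRate, Matrix.mul_add, Matrix.mul_neg, Matrix.mul_smul, Matrix.mul_one,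
    Matrix.trace_add, Matrix.trace_neg, Matrix.trace_smul, Matrix.one_mulVec, Matrix.mul_vecMulVec,
    Matrix.trace_vecMulVec, smul_eq_mul]
  rw [dotProduct_comm]; ring

namespace IsFrameSol

variable {γ : ℝ} {I : Set ℝ} {C E θ : ℝ → Matrix (Fin 3) (Fin 3) ℝ} {v : ℝ → Fin 3 → ℝ}
  {w ρ : ℝ → ℝ} {t₀ t : ℝ}

lemma mono (H : IsFrameSol γ I C E θ v w ρ) {I' : Set ℝ} (h : I' ⊆ I) :
    IsFrameSol γ I' C E θ v w ρ :=
  ⟨fun t ht => H.1 t (h ht), fun t ht => H.2 t (h ht), fun t ht => H.3 t (h ht),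
    fun t ht => H.4 t (h ht), fun t ht => H.5 t (h ht), fun t ht => H.6 t (h ht)⟩

lemma continuousOn_trace (H : IsFrameSol γ I C E θ v w ρ) :
    ContinuousOn (fun t => (θ t).trace) I := fun t ht =>
  (H.deriv_expansion t ht).trace.continuousAt.continuousWithinAt

/-- The constraints propagate. -/
lemma constraints (H : IsFrameSol γ I C E θ v w ρ) (hI : I.OrdConnected) (ht₀ : t₀ ∈ I)
    (H₀ : FrameConstraints (C t₀) (E t₀) (θ t₀) (v t₀) (w t₀) (ρ t₀)) (ht : t ∈ I) :
    FrameConstraints (C t) (E t) (θ t) (v t) (w t) (ρ t) := by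
  have hdual : ∀ t ∈ I, E t * C t = 1 := fun t ht => by
    rw [← H₀.dual]
    ext i j
    refine eq_of_hasDerivAt_zero hI (f := fun s => (E s * C s) i j) (fun s hs => ?_) ht₀ ht
    have := ((H.deriv_frame s hs).mul (H.deriv_coframe s hs)) i j
    refine this.congr_deriv ?_
    rw [Matrix.neg_mul, Matrix.mul_assoc, neg_add_cancel, Matrix.zero_apply]
  -- The source terms are symmetric, so the antisymmetric part of `θ` solves `y' = -(tr θ) y` and
  -- stays zero.
  have hsymm : ∀ t ∈ I, (θ t)ᵀ = θ t := fun t ht => by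
    ext i j
    obtain ⟨c, -, hc⟩ := exists_pos_mul_eq_of_hasDerivAt (y := fun s => θ s j i - θ s i j) hI
      H.continuousOn_trace.neg (fun s hs => by
        refine (((H.deriv_expansion s hs) j i).sub ((H.deriv_expansion s hs) i j)).congr_deriv ?_
        simp only [mixedRate, Matrix.add_apply, Matrix.neg_apply, Matrix.smul_apply,
          vecMulVec_apply, Matrix.one_mulVec, smul_eq_mul, Matrix.one_apply, eq_comm (a := j)]
        simp only [Pi.neg_apply]
        ring) ht₀ ht
    have h0 : θ t₀ j i - θ t₀ i j = 0 := sub_eq_zero.2 (congrFun (congrFun H₀.symm i) j)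
    rw [h0, mul_zero] at hc
    exact sub_eq_zero.1 hc
  -- `v C` are the coordinate components of the spatial part of the form; they are constant by
  -- closedness.
  have hform : ∀ t ∈ I, v t ᵥ* C t = v t₀ ᵥ* C t₀ := fun t ht => by
    funext i
    refine eq_of_hasDerivAt_zero hI (f := fun s => (v s ᵥ* C s) i) (fun s hs => ?_) ht₀ ht
    have := hasDerivAt_dotProduct (H.deriv_spatial s hs) (fun a => H.deriv_coframe s hs a i)
    refine this.congr_deriv ?_
    have h1 : (fun a => (θ s * C s) a i) = θ s *ᵥ (fun a => C s a i) := rfl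
    rw [h1, Matrix.dotProduct_mulVec, ← Matrix.mulVec_transpose, hsymm s hs]
    change (-(θ s *ᵥ v s)) ⬝ᵥ _ + _ = _
    rw [neg_dotProduct, neg_add_cancel]
  have hw : w t₀ = 0 → w t = 0 := fun h0 => by
    obtain ⟨c, -, hc⟩ := exists_pos_mul_eq_of_hasDerivAt hI H.continuousOn_trace.neg
      H.deriv_temporal ht₀ ht
    rw [hc, h0, mul_zero]
  have hv : v t₀ = 0 → v t = 0 := fun h0 => by
    have h1 := hform t ht
    rw [h0, Matrix.zero_vecMul] at h1
    have h2 : (v t ᵥ* C t) ᵥ* E t = 0 := by rw [h1, Matrix.zero_vecMul]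
    rwa [Matrix.vecMul_vecMul, mul_eq_one_comm.1 (hdual t ht), Matrix.vecMul_one] at h2
  refine ⟨hdual t ht, hsymm t ht, fun a => ?_, ?_, ?_⟩
  -- One of `w` and `v` vanishes initially, and either of them stays zero once it is zero.
  · by_cases h0 : w t₀ = 0
    · rw [hw h0, zero_mul]
    · rw [hv (funext fun b => (mul_eq_zero.1 (H₀.momentum b)).resolve_left h0), Pi.zero_apply,
        mul_zero]
  -- The defect of the Friedmann constraint solves `y' = -2 (tr θ) y`.
  · obtain ⟨c, -, hc⟩ := exists_pos_mul_eq_of_hasDerivAt (g := fun s => -2 * (θ s).trace)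
      (y := fun s => (θ s).trace ^ 2 -
        (θ s * θ s).trace - 2 * ρ s - w s ^ 2 - v s ⬝ᵥ v s) hI
      (H.continuousOn_trace.const_mul (-2))
      (fun s hs => by
        have hθ := H.deriv_expansion s hs
        have hd := ((((hθ.trace.pow 2).sub (hθ.mul hθ).trace).sub
          ((H.deriv_density s hs).const_mul 2)).sub ((H.deriv_temporal s hs).pow 2)).sub
          (hasDerivAt_dotProduct (H.deriv_spatial s hs) (H.deriv_spatial s hs))
        refine hd.congr_deriv ?_
        rw [Matrix.trace_add, Matrix.trace_mul_comm (mixedRate _ _ _ _ _),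
          trace_mul_mixedRate_one, trace_mixedRate_one]
        change _ - ((-(θ s *ᵥ v s)) ⬝ᵥ v s + v s ⬝ᵥ (-(θ s *ᵥ v s))) = _
        rw [neg_dotProduct, dotProduct_neg, dotProduct_comm (θ s *ᵥ v s)]
        push_cast
        ring) ht₀ ht
    have h0 := H₀.friedmann
    rw [show (θ t₀).trace ^ 2 - (θ t₀ * θ t₀).trace - 2 * ρ t₀ - w t₀ ^ 2 - v t₀ ⬝ᵥ v t₀ = 0 by
      linarith, mul_zero] at hc
    linarith
  · obtain ⟨c, hc0, hc⟩ := exists_pos_mul_eq_of_hasDerivAt hI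
      (H.continuousOn_trace.const_mul γ).neg H.deriv_density ht₀ ht
    rw [hc]
    exact mul_nonneg hc0.le H₀.density_nonneg

lemma deriv_trace (H : IsFrameSol γ I C E θ v w ρ) (ht : t ∈ I) :
    HasDerivAt (fun s => (θ s).trace)
      (-(θ t).trace * (θ t).trace + (v t ⬝ᵥ v t + 3 * ((2 - γ) / 2 * ρ t))) t :=
  (H.deriv_expansion t ht).trace.congr_deriv (by rw [trace_mixedRate_one]; ring)

/-- Expansion persists. -/
lemma trace_pos (H : IsFrameSol γ I C E θ v w ρ) (hI : I.OrdConnected) (hγ : γ ≤ 2) (ht₀ : t₀ ∈ I)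
    (H₀ : FrameConstraints (C t₀) (E t₀) (θ t₀) (v t₀) (w t₀) (ρ t₀)) (hpos : 0 < (θ t₀).trace)
    (ht : t ∈ I) (htt : t₀ ≤ t) : 0 < (θ t).trace := by
  have hsub : Icc t₀ t ⊆ I := hI.out ht₀ ht
  obtain ⟨c, hc, h⟩ := exists_pos_mul_le_of_hasDerivAt htt (H.continuousOn_trace.mono hsub).neg
    (fun s hs => by
      have h1 := FrameConstraints.dotProduct_self_nonneg' (v s)
      have h2 := (H.constraints hI ht₀ H₀ (hsub hs)).density_nonneg
      have h3 : 0 ≤ (2 - γ) / 2 * ρ s := mul_nonneg (by linarith) h2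
      linarith)
    (fun s hs => H.deriv_trace (hsub hs))
  exact (mul_pos hc hpos).trans_le h

/-- The rate of expansion decreases. -/
lemma trace_antitone (H : IsFrameSol γ I C E θ v w ρ) (hI : I.OrdConnected) (hγ : 2 / 3 ≤ γ)
    (ht₀ : t₀ ∈ I) (H₀ : FrameConstraints (C t₀) (E t₀) (θ t₀) (v t₀) (w t₀) (ρ t₀))
    (ht : t ∈ I) (htt : t₀ ≤ t) : (θ t).trace ≤ (θ t₀).trace := by
  have hsub : Icc t₀ t ⊆ I := hI.out ht₀ ht
  refine antitoneOn_of_hasDerivWithinAt_nonpos (convex_Icc t₀ t) (H.continuousOn_trace.mono hsub)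
    (fun s hs => (H.deriv_trace (hsub (interior_subset hs))).hasDerivWithinAt) (fun s hs => ?_)
    (left_mem_Icc.2 htt) (right_mem_Icc.2 htt) htt
  have h1 := H.constraints hI ht₀ H₀ (hsub (interior_subset hs))
  -- For `γ ≥ 2/3` the coefficient `3 (2 - γ) / 2` is at most `2`, and the Friedmann constraint with
  -- Cauchy-Schwarz gives `v · v + 2 ρ ≤ (2/3) (tr θ)²`, so the derivative is at most zero.
  nlinarith [h1.friedmann, h1.trace_sq_le, sq_nonneg (w s), sq_nonneg (θ s).trace,
    mul_nonneg (sub_nonneg.2 hγ) h1.density_nonneg]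

end IsFrameSol

/-- The `j`-form with temporal part `w` and frame components `v`. -/
def frameForm (C : ℝ → Matrix (Fin 3) (Fin 3) ℝ) (v : ℝ → Fin 3 → ℝ) (w : ℝ → ℝ) (t : ℝ) :
    Fin 4 → ℝ := Fin.cons (w t) (v t ᵥ* C t)

/-- The metric with coframe `C`. -/
def frameMetric (C : ℝ → Matrix (Fin 3) (Fin 3) ℝ) (t : ℝ) : Matrix (Fin 3) (Fin 3) ℝ :=
  (C t)ᵀ * C t

/-- The normalized state in an orthonormal frame with expansion tensor `θ`. -/
def frameState (θ : Matrix (Fin 3) (Fin 3) ℝ) (v : Fin 3 → ℝ) (w ρ : ℝ) : State :=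
  (fun a b => (θ - (θ.trace / 3) • (1 : Matrix (Fin 3) (Fin 3) ℝ)) a b / (θ.trace / 3),
   fun a => v a / (√6 * (θ.trace / 3)), w / (√6 * (θ.trace / 3)), ρ / (3 * (θ.trace / 3) ^ 2))

section

variable {C E θ : Matrix (Fin 3) (Fin 3) ℝ} {v : Fin 3 → ℝ} {w ρ : ℝ}

lemma FrameConstraints.inv_metric (H : FrameConstraints C E θ v w ρ) :
    (Cᵀ * C)⁻¹ = E * Eᵀ := by
  refine Matrix.inv_eq_left_inv ?_
  have h1 : Eᵀ * Cᵀ = 1 := by rw [← Matrix.transpose_mul, H.dual', Matrix.transpose_one]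
  rw [Matrix.mul_assoc, ← Matrix.mul_assoc Eᵀ, h1, Matrix.one_mul, H.dual]

lemma FrameConstraints.posDef (H : FrameConstraints C E θ v w ρ) : (Cᵀ * C).PosDef := by
  have := Matrix.PosDef.conjTranspose_mul_self C (fun x y hxy => by
    have h2 := congrArg (E *ᵥ ·) hxy
    simpa [Matrix.mulVec_mulVec, H.dual] using h2)
  simpa [conjTranspose_eq_transpose_of_trivial] using this

lemma FrameConstraints.inv_mulVec (H : FrameConstraints C E θ v w ρ) :
    (Cᵀ * C)⁻¹ *ᵥ (v ᵥ* C) = E *ᵥ v := by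
  rw [H.inv_metric, ← Matrix.mulVec_mulVec, Matrix.mulVec_transpose, Matrix.vecMul_vecMul, H.dual',
    Matrix.vecMul_one]

end

namespace IsFrameSol

variable {γ : ℝ} {I : Set ℝ} {C E θ : ℝ → Matrix (Fin 3) (Fin 3) ℝ} {v : ℝ → Fin 3 → ℝ}
  {w ρ : ℝ → ℝ} {t₀ t : ℝ}

/-- Solutions in a parallel frame yield solutions of the reduced equations. -/
theorem isReduced (H : IsFrameSol γ I C E θ v w ρ)
    (hc : ∀ t ∈ I, FrameConstraints (C t) (E t) (θ t) (v t) (w t) (ρ t)) :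
    IsReduced γ I (frameMetric C) (fun t => E t * θ t * C t) (frameForm C v w) ρ := by
  have htr : ∀ t ∈ I, (E t * θ t * C t).trace = (θ t).trace := fun t ht => by
    rw [Matrix.trace_mul_comm, ← Matrix.mul_assoc, (hc t ht).dual', Matrix.one_mul]
  refine
    { posDef := fun t ht => (hc t ht).posDef
      density_nonneg := fun t ht => (hc t ht).density_nonneg
      deriv_metric := fun t ht => ?_
      deriv_mixed := fun t ht => ?_
      deriv_form_zero := fun t ht => by
        rw [htr t ht]
        exact H.deriv_temporal t ht
      deriv_form_succ := fun t ht i => ?_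
      momentum := fun t ht i => ?_
      friedmann := fun t ht => ?_ }
  · refine ((H.deriv_coframe t ht).transpose.mul (H.deriv_coframe t ht)).congr_deriv ?_
    rw [frameMetric, Matrix.transpose_mul, (hc t ht).symm, two_smul]
    have : (C t)ᵀ * C t * (E t * θ t * C t) = (C t)ᵀ * (θ t * C t) := by
      rw [Matrix.mul_assoc (C t)ᵀ, ← Matrix.mul_assoc (C t) (E t * θ t), ← Matrix.mul_assoc (C t) (E t),
        (hc t ht).dual', Matrix.one_mul]
    rw [this, Matrix.mul_assoc]
  · refine (((H.deriv_frame t ht).mul (H.deriv_expansion t ht)).mul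
      (H.deriv_coframe t ht)).congr_deriv ?_
    have hsp : spatial (frameForm C v w) t = v t ᵥ* C t := rfl
    rw [hsp, mixedRate, mixedRate, frameMetric, (hc t ht).inv_mulVec, htr t ht]
    simp only [Matrix.one_mulVec, Matrix.mul_add, Matrix.add_mul, Matrix.mul_neg, Matrix.neg_mul,
      Matrix.mul_smul, Matrix.smul_mul, Matrix.mul_one, (hc t ht).dual, Matrix.mul_vecMulVec,
      Matrix.vecMulVec_mul, Matrix.mul_assoc]
    abel
  · have := hasDerivAt_dotProduct (H.deriv_spatial t ht) (fun a => H.deriv_coframe t ht a i)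
    refine this.congr_deriv ?_
    have h1 : (fun a => (θ t * C t) a i) = θ t *ᵥ (fun a => C t a i) := rfl
    rw [h1, Matrix.dotProduct_mulVec, ← Matrix.mulVec_transpose, (hc t ht).symm]
    change (-(θ t *ᵥ v t)) ⬝ᵥ _ + _ = _
    rw [neg_dotProduct, neg_add_cancel]
  · change w t * ∑ a, v t a * C t a i = 0
    rw [Finset.mul_sum]
    exact Finset.sum_eq_zero fun a _ => by rw [← mul_assoc, (hc t ht).momentum, zero_mul]
  · have hsp : spatial (frameForm C v w) t = v t ᵥ* C t := rfl
    have h1 : (E t * θ t * C t * (E t * θ t * C t)).trace = (θ t * θ t).trace := by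
      have : E t * θ t * C t * (E t * θ t * C t) = E t * (θ t * θ t * C t) := by
        simp only [Matrix.mul_assoc]
        rw [← Matrix.mul_assoc (C t) (E t), (hc t ht).dual', Matrix.one_mul]
      rw [this, Matrix.trace_mul_comm, Matrix.mul_assoc, (hc t ht).dual', Matrix.mul_one]
    rw [hsp, frameMetric, (hc t ht).inv_mulVec, htr t ht, h1, Matrix.dotProduct_mulVec,
      Matrix.vecMul_vecMul, (hc t ht).dual', Matrix.vecMul_one]
    exact (hc t ht).friedmann

lemma isFrame (hc : FrameConstraints (C t) (E t) (θ t) (v t) (w t) (ρ t)) :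
    IsFrame (frameMetric C t) (E t) := by
  have h1 : (E t)ᵀ * (C t)ᵀ = 1 := by rw [← Matrix.transpose_mul, hc.dual', Matrix.transpose_one]
  rw [IsFrame, frameMetric, ← Matrix.mul_assoc, h1, Matrix.one_mul, hc.dual']

lemma hubble_eq (H : IsFrameSol γ I C E θ v w ρ)
    (hc : ∀ t ∈ I, FrameConstraints (C t) (E t) (θ t) (v t) (w t) (ρ t)) (ht : t ∈ I) :
    hubble (frameMetric C) t = (θ t).trace / 3 := by
  have h1 := (H.isReduced hc).mixedExpansion_eq ht
  rw [mixedExpansion] at h1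
  rw [hubble, h1, Matrix.trace_mul_comm, ← Matrix.mul_assoc, (hc t ht).dual', Matrix.one_mul]
  ring

/-- A solution in a parallel frame is an orbit. -/
theorem isOrbit (H : IsFrameSol γ I C E θ v w ρ) (hI : IsOpen I)
    (hc : ∀ t ∈ I, FrameConstraints (C t) (E t) (θ t) (v t) (w t) (ρ t))
    (hpos : ∀ t ∈ I, 0 < (θ t).trace) : IsOrbit γ I (frameMetric C) (frameForm C v w) ρ E where
  solution := (H.isReduced hc).isTypeISolution hI
  expanding t ht := by rw [H.hubble_eq hc ht]; linarith [hpos t ht]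
  frame t ht := isFrame (hc t ht)

end IsFrameSol

/-! ### Existence of solutions -/

/-- The space of unknowns `(C, E, θ, v, w, ρ)`. -/
abbrev FrameSpace : Type :=
  (Fin 3 → Fin 3 → ℝ) × (Fin 3 → Fin 3 → ℝ) × (Fin 3 → Fin 3 → ℝ) × (Fin 3 → ℝ) × ℝ × ℝ

/-- The vector field of the evolution equations in a parallel frame. -/
def frameField (γ : ℝ) (x : FrameSpace) : FrameSpace :=
  (fun a i => ∑ b, x.2.2.1 a b * x.1 b i, fun i a => -∑ b, x.2.1 i b * x.2.2.1 b a,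
   fun a b => -((∑ c, x.2.2.1 c c) * x.2.2.1 a b) + x.2.2.2.1 a * x.2.2.2.1 b +
     (2 - γ) / 2 * x.2.2.2.2.2 * (1 : Matrix (Fin 3) (Fin 3) ℝ) a b,
   fun a => -∑ b, x.2.2.1 a b * x.2.2.2.1 b, -(∑ c, x.2.2.1 c c) * x.2.2.2.2.1,
   -(γ * ∑ c, x.2.2.1 c c) * x.2.2.2.2.2)

/-- Coframe and frame are independent unknowns, so no inverse occurs and the field is polynomial. -/
lemma contDiff_frameField (γ : ℝ) : ContDiff ℝ 1 (frameField γ) := by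
  unfold frameField
  have h1 : ∀ a b, ContDiff ℝ 1 fun x : FrameSpace => x.1 a b := fun a b => by fun_prop
  have h2 : ∀ a b, ContDiff ℝ 1 fun x : FrameSpace => x.2.1 a b := fun a b => by fun_prop
  have h3 : ∀ a b, ContDiff ℝ 1 fun x : FrameSpace => x.2.2.1 a b := fun a b => by fun_prop
  have h4 : ∀ a, ContDiff ℝ 1 fun x : FrameSpace => x.2.2.2.1 a := fun a => by fun_prop
  have h5 : ContDiff ℝ 1 fun x : FrameSpace => x.2.2.2.2.1 := by fun_prop
  have h6 : ContDiff ℝ 1 fun x : FrameSpace => x.2.2.2.2.2 := by fun_prop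
  fun_prop

lemma isFrameSol_of_hasDerivAt {γ : ℝ} {I : Set ℝ} {x : ℝ → FrameSpace}
    (hx : ∀ t ∈ I, HasDerivAt x (frameField γ (x t)) t) :
    IsFrameSol γ I (fun t => Matrix.of (x t).1) (fun t => Matrix.of (x t).2.1)
      (fun t => Matrix.of (x t).2.2.1) (fun t => (x t).2.2.2.1) (fun t => (x t).2.2.2.2.1)
      (fun t => (x t).2.2.2.2.2) := by
  refine ⟨fun t ht i j => ?_, fun t ht i j => ?_, fun t ht i j => ?_, fun t ht i => ?_,
    fun t ht => ?_, fun t ht => ?_⟩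
  · exact hasDerivAt_pi.1 (hasDerivAt_pi.1 (hx t ht).fst i) j
  · exact hasDerivAt_pi.1 (hasDerivAt_pi.1 (hx t ht).snd.fst i) j
  · refine (hasDerivAt_pi.1 (hasDerivAt_pi.1 (hx t ht).snd.snd.fst i) j).congr_deriv ?_
    simp [frameField, mixedRate, Matrix.trace, vecMulVec_apply]
  · exact hasDerivAt_pi.1 (hx t ht).snd.snd.snd.fst i
  · exact (hx t ht).snd.snd.snd.snd.fst
  · exact (hx t ht).snd.snd.snd.snd.snd

/-- The equation of the coframe is linear with coefficients bounded by `τ`; the factor `3` counts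
the summands of a matrix product in the sup norm. Grönwall's inequality then bounds the coframe on
bounded intervals. -/
lemma norm_sum_mul_le {A B : Fin 3 → Fin 3 → ℝ} {τ : ℝ} (hτ : 0 ≤ τ) (hA : ∀ a b, |A a b| ≤ τ) :
    ‖(fun a i => ∑ b, A a b * B b i : Fin 3 → Fin 3 → ℝ)‖ ≤ 3 * τ * ‖B‖ := by
  refine (pi_norm_le_iff_of_nonneg (by positivity)).2 fun a =>
    (pi_norm_le_iff_of_nonneg (by positivity)).2 fun i => ?_
  refine (norm_sum_le _ _).trans ?_
  have : ∀ b ∈ Finset.univ, ‖A a b * B b i‖ ≤ τ * ‖B‖ := fun b _ => by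
    rw [norm_mul]
    exact mul_le_mul (hA a b) ((norm_le_pi_norm (B b) i).trans (norm_le_pi_norm B b))
      (norm_nonneg _) hτ
  refine (Finset.sum_le_sum this).trans (le_of_eq ?_)
  simp; ring

lemma norm_sum_mul_le' {A B : Fin 3 → Fin 3 → ℝ} {τ : ℝ} (hτ : 0 ≤ τ) (hA : ∀ a b, |A a b| ≤ τ) :
    ‖(fun i a => -∑ b, B i b * A b a : Fin 3 → Fin 3 → ℝ)‖ ≤ 3 * τ * ‖B‖ := by
  refine (pi_norm_le_iff_of_nonneg (by positivity)).2 fun i =>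
    (pi_norm_le_iff_of_nonneg (by positivity)).2 fun a => ?_
  rw [norm_neg]
  refine (norm_sum_le _ _).trans ?_
  have : ∀ b ∈ Finset.univ, ‖B i b * A b a‖ ≤ τ * ‖B‖ := fun b _ => by
    rw [norm_mul, mul_comm]
    exact mul_le_mul (hA b a) ((norm_le_pi_norm (B i) b).trans (norm_le_pi_norm B i))
      (norm_nonneg _) hτ
  refine (Finset.sum_le_sum this).trans (le_of_eq ?_)
  simp; ring

lemma norm_le_of_norm_deriv_le {F : Type*} [NormedAddCommGroup F] [NormedSpace ℝ F] {f f' : ℝ → F}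
    {a b T K : ℝ} (hab : a ≤ b) (hbT : b ≤ T) (hK : 0 ≤ K) (hf : ∀ t ∈ Icc a b, HasDerivAt f (f' t) t)
    (hb : ∀ t ∈ Icc a b, ‖f' t‖ ≤ K * ‖f t‖) : ‖f b‖ ≤ ‖f a‖ * Real.exp (K * (T - a)) := by
  have := norm_le_gronwallBound_of_norm_deriv_right_le (ε := 0)
    (fun t ht => (hf t ht).continuousAt.continuousWithinAt)
    (fun t ht => (hf t (Ico_subset_Icc_self ht)).hasDerivWithinAt) le_rfl
    (fun t ht => by rw [add_zero]; exact hb t (Ico_subset_Icc_self ht)) b (right_mem_Icc.2 hab)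
  rw [gronwallBound_ε0] at this
  refine this.trans ?_
  gcongr

/-- Global existence to the future. -/
theorem exists_isFrameSol {γ : ℝ} (hγ : γ ∈ Icc (2 / 3 : ℝ) 2) (t₀ : ℝ)
    {C₀ E₀ θ₀ : Matrix (Fin 3) (Fin 3) ℝ} {v₀ : Fin 3 → ℝ} {w₀ ρ₀ : ℝ}
    (H₀ : FrameConstraints C₀ E₀ θ₀ v₀ w₀ ρ₀) (hpos : 0 < θ₀.trace) :
    ∃ a < t₀, ∃ C E θ v w ρ, IsFrameSol γ (Ioi a) C E θ v w ρ ∧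
      (∀ t > a, FrameConstraints (C t) (E t) (θ t) (v t) (w t) (ρ t)) ∧
      (∀ t > a, 0 < (θ t).trace) ∧
      C t₀ = C₀ ∧ E t₀ = E₀ ∧ θ t₀ = θ₀ ∧ v t₀ = v₀ ∧ w t₀ = w₀ ∧ ρ t₀ = ρ₀ := by
  set x₀ : FrameSpace := (C₀, E₀, θ₀, v₀, w₀, ρ₀)
  set τ := θ₀.trace with hτ
  obtain ⟨a, ha, x, hx0, hx⟩ := exists_global_solution (contDiff_frameField γ) t₀ x₀ (by
    intro T hT
    -- Expansion tensor, form and density are bounded by the initial trace `τ`, which is not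
    -- exceeded later; coframe and frame can grow at most by the Grönwall factor `B`.
    set B := Real.exp (3 * τ * (T - t₀))
    refine ⟨max (‖(x₀.1)‖ * B) (max (‖x₀.2.1‖ * B) (max τ (τ ^ 2))), fun x b hb hx0 hx => ?_⟩
    have hsol := isFrameSol_of_hasDerivAt hx
    have ht₀ : t₀ ∈ Icc t₀ b := left_mem_Icc.2 hb.1
    have H₀' : FrameConstraints (Matrix.of (x t₀).1) (Matrix.of (x t₀).2.1)
        (Matrix.of (x t₀).2.2.1) (x t₀).2.2.2.1 (x t₀).2.2.2.2.1 (x t₀).2.2.2.2.2 := by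
      rw [hx0]; exact H₀
    have hτ0 : (Matrix.of (x t₀).2.2.1).trace = τ := by rw [hx0]; rfl
    have hc := fun t ht => hsol.constraints (t := t) ordConnected_Icc ht₀ H₀' ht
    have htr : ∀ t ∈ Icc t₀ b, (Matrix.of (x t).2.2.1).trace ^ 2 ≤ τ ^ 2 := fun t ht => by
      have h1 := hsol.trace_pos ordConnected_Icc hγ.2 ht₀ H₀' (hτ0 ▸ hpos) ht ht.1
      have h2 := hsol.trace_antitone ordConnected_Icc hγ.1 ht₀ H₀' ht ht.1
      rw [hτ0] at h2
      exact pow_le_pow_left₀ h1.le h2 2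
    have hbb : b ∈ Icc t₀ b := right_mem_Icc.2 hb.1
    have hC : ‖(x b).1‖ ≤ ‖x₀.1‖ * B := by
      have := norm_le_of_norm_deriv_le (f := fun t => (x t).1) (K := 3 * τ) hb.1 hb.2 (by positivity)
        (fun t ht => (hx t ht).fst)
        (fun t ht => norm_sum_mul_le hpos.le fun a b => (hc t ht).abs_expansion_le hpos.le (htr t ht) a b)
      rwa [hx0] at this
    have hE : ‖(x b).2.1‖ ≤ ‖x₀.2.1‖ * B := by
      have := norm_le_of_norm_deriv_le (f := fun t => (x t).2.1) (K := 3 * τ) hb.1 hb.2 (by positivity)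
        (fun t ht => (hx t ht).snd.fst)
        (fun t ht => norm_sum_mul_le' hpos.le fun a b => (hc t ht).abs_expansion_le hpos.le (htr t ht) a b)
      rwa [hx0] at this
    have hθ : ‖(x b).2.2.1‖ ≤ τ := (pi_norm_le_iff_of_nonneg hpos.le).2 fun i =>
      (pi_norm_le_iff_of_nonneg hpos.le).2 fun j =>
        (hc b hbb).abs_expansion_le hpos.le (htr b hbb) i j
    have hv : ‖(x b).2.2.2.1‖ ≤ τ := (pi_norm_le_iff_of_nonneg hpos.le).2 fun i =>
      (hc b hbb).abs_spatial_le hpos.le (htr b hbb) i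
    have hw : ‖(x b).2.2.2.2.1‖ ≤ τ := (hc b hbb).abs_temporal_le hpos.le (htr b hbb)
    have hρ : ‖(x b).2.2.2.2.2‖ ≤ τ ^ 2 := (hc b hbb).density_le (htr b hbb)
    simp only [Prod.norm_def]
    grind)
  have hsol := isFrameSol_of_hasDerivAt (I := Ioi a) hx
  have hinit : FrameConstraints (Matrix.of (x t₀).1) (Matrix.of (x t₀).2.1)
      (Matrix.of (x t₀).2.2.1) (x t₀).2.2.2.1 (x t₀).2.2.2.2.1 (x t₀).2.2.2.2.2 := by
    rw [hx0]; exact H₀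
  have hc := fun t ht => hsol.constraints (t := t) ordConnected_Ioi ha hinit ht
  have hτ0 : 0 < (Matrix.of (x t₀).2.2.1).trace := by rw [hx0]; exact hpos
  have hnear : ∀ᶠ t in 𝓝 t₀, 0 < (Matrix.of (x t).2.2.1).trace :=
    (hsol.deriv_trace ha).continuousAt.eventually (lt_mem_nhds hτ0)
  -- Positivity of the trace propagates only forwards, so the interval before `t₀` is shortened
  -- until continuity provides it there.
  obtain ⟨δ, hδ, hball⟩ := Metric.eventually_nhds_iff.1 hnear
  have hsub : Ioi (max a (t₀ - δ)) ⊆ Ioi a := Ioi_subset_Ioi (le_max_left _ _)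
  refine ⟨max a (t₀ - δ), max_lt ha (by linarith), _, _, _, _, _, _, hsol.mono hsub,
    fun t ht => hc t (hsub ht), fun t ht => ?_, ?_⟩
  · rcases le_or_gt t₀ t with h | h
    · exact hsol.trace_pos ordConnected_Ioi hγ.2 ha hinit hτ0 (hsub ht) h
    · refine hball ?_
      rw [Real.dist_eq, abs_of_neg (by linarith)]
      linarith [(le_max_right a (t₀ - δ)).trans_lt ht]
  · rw [hx0]
    exact ⟨rfl, rfl, rfl, rfl, rfl, rfl⟩

/-! ### Uniqueness of solutions -/

/-- The space of unknowns `(h, h⁻¹, Θ, j, J_0, ρ)`. -/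
abbrev MixedSpace : Type :=
  (Fin 3 → Fin 3 → ℝ) × (Fin 3 → Fin 3 → ℝ) × (Fin 3 → Fin 3 → ℝ) × (Fin 3 → ℝ) × ℝ × ℝ

/-- The vector field of the reduced equations. -/
def mixedField (γ : ℝ) (x : MixedSpace) : MixedSpace :=
  (fun i j => 2 * ∑ k, x.1 i k * x.2.2.1 k j, fun i j => -(2 * ∑ k, x.2.2.1 i k * x.2.1 k j),
   fun i j => -((∑ c, x.2.2.1 c c) * x.2.2.1 i j) +
     (∑ k, x.2.1 i k * x.2.2.2.1 k) * x.2.2.2.1 j +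
     (2 - γ) / 2 * x.2.2.2.2.2 * (1 : Matrix (Fin 3) (Fin 3) ℝ) i j,
   fun _ => 0, -(∑ c, x.2.2.1 c c) * x.2.2.2.2.1, -(γ * ∑ c, x.2.2.1 c c) * x.2.2.2.2.2)

/-- Carrying `h⁻¹` as a separate unknown makes the field polynomial, so uniqueness needs no
invertibility condition on the whole space. -/
lemma contDiff_mixedField (γ : ℝ) : ContDiff ℝ 1 (mixedField γ) := by
  unfold mixedField
  have h1 : ∀ a b, ContDiff ℝ 1 fun x : MixedSpace => x.1 a b := fun a b => by fun_prop
  have h2 : ∀ a b, ContDiff ℝ 1 fun x : MixedSpace => x.2.1 a b := fun a b => by fun_prop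
  have h3 : ∀ a b, ContDiff ℝ 1 fun x : MixedSpace => x.2.2.1 a b := fun a b => by fun_prop
  have h4 : ∀ a, ContDiff ℝ 1 fun x : MixedSpace => x.2.2.2.1 a := fun a => by fun_prop
  have h5 : ContDiff ℝ 1 fun x : MixedSpace => x.2.2.2.2.1 := by fun_prop
  have h6 : ContDiff ℝ 1 fun x : MixedSpace => x.2.2.2.2.2 := by fun_prop
  fun_prop

section Uniqueness

variable {γ : ℝ} {I : Set ℝ} {h h' Θ Θ' : ℝ → Matrix (Fin 3) (Fin 3) ℝ} {J J' : ℝ → Fin 4 → ℝ}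
  {ρ ρ' : ℝ → ℝ}

/-- The unknowns of the reduced equations as a curve in a normed space. -/
def mixedUnknowns (h Θ : ℝ → Matrix (Fin 3) (Fin 3) ℝ) (J : ℝ → Fin 4 → ℝ) (ρ : ℝ → ℝ) (t : ℝ) :
    MixedSpace :=
  (h t, ((h t)⁻¹ : Matrix (Fin 3) (Fin 3) ℝ), Θ t, spatial J t, J t 0, ρ t)

lemma IsReduced.hasDerivAt_mixed (hI : IsOpen I) (H : IsReduced γ I h Θ J ρ) {t : ℝ} (ht : t ∈ I) :
    HasDerivAt (mixedUnknowns h Θ J ρ) (mixedField γ (mixedUnknowns h Θ J ρ t)) t := by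
  refine HasDerivAt.prodMk (hasDerivAt_pi.2 fun i => hasDerivAt_pi.2 fun j => ?_) ?_
  · exact H.deriv_metric t ht i j
  refine HasDerivAt.prodMk (hasDerivAt_pi.2 fun i => hasDerivAt_pi.2 fun j => ?_) ?_
  · refine (H.hasMatDerivAt_inv hI ht i j).congr_deriv ?_
    simp [Matrix.mul_apply, mixedUnknowns]
  refine HasDerivAt.prodMk (hasDerivAt_pi.2 fun i => hasDerivAt_pi.2 fun j => ?_) ?_
  · refine (H.deriv_mixed t ht i j).congr_deriv ?_
    simp [mixedUnknowns, mixedRate, Matrix.trace, vecMulVec_apply, Matrix.mulVec, dotProduct]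
  refine HasDerivAt.prodMk (hasDerivAt_pi.2 fun i => ?_) ?_
  · exact H.deriv_form_succ t ht i
  exact (H.deriv_form_zero t ht).prodMk (H.deriv_density hI ht)

/-- Solutions of the reduced equations are determined by their values at one time. -/
theorem IsReduced.unique (hI : IsOpen I) (hI' : I.OrdConnected) (H : IsReduced γ I h Θ J ρ)
    (H' : IsReduced γ I h' Θ' J' ρ') {t₀ : ℝ} (ht₀ : t₀ ∈ I) (eh : h t₀ = h' t₀)
    (eΘ : Θ t₀ = Θ' t₀) (eJ : J t₀ = J' t₀) (eρ : ρ t₀ = ρ' t₀) {t : ℝ} (ht : t ∈ I) :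
    h t = h' t ∧ J t = J' t ∧ ρ t = ρ' t := by
  have es : spatial J t₀ = spatial J' t₀ := by funext i; simp only [spatial, eJ]
  have key := eqOn_of_hasDerivAt (contDiff_mixedField γ) hI' (fun t ht => H.hasDerivAt_mixed hI ht)
    (fun t ht => H'.hasDerivAt_mixed hI ht) ht₀ (by simp only [mixedUnknowns, eh, eΘ, es, eJ, eρ]) ht
  have key' := congrArg (fun x : MixedSpace => x.2.2.2) key
  exact ⟨congrArg (fun x : MixedSpace => x.1) key, funext fun m =>
    Fin.cases (congrArg (fun x => x.2.1) key') (fun i => congrFun (congrArg (fun x => x.1) key') i) m,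
    congrArg (fun x => x.2.2) key'⟩

end Uniqueness

/-! ### Orbits in parallel frames -/

section Orbit

variable {γ : ℝ} {I : Set ℝ} {h : ℝ → Matrix (Fin 3) (Fin 3) ℝ} {J : ℝ → Fin 4 → ℝ} {ρ : ℝ → ℝ}
  {E : ℝ → Matrix (Fin 3) (Fin 3) ℝ} {t : ℝ}

lemma IsFrame.isUnit_det {h E : Matrix (Fin 3) (Fin 3) ℝ} (H : IsFrame h E) : IsUnit E.det :=
  (Matrix.isUnit_iff_isUnit_det _).1 (IsUnit.of_mul_eq_one_right _ H)

lemma IsFrame.inv_eq {h E : Matrix (Fin 3) (Fin 3) ℝ} (H : IsFrame h E) : E⁻¹ = Eᵀ * h :=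
  Matrix.inv_eq_left_inv H

lemma IsFrame.metric_eq {h E : Matrix (Fin 3) (Fin 3) ℝ} (H : IsFrame h E) :
    h = (E⁻¹)ᵀ * E⁻¹ := by
  rw [H.inv_eq, ← Matrix.mul_assoc, ← H.inv_eq, Matrix.transpose_nonsing_inv,
    Matrix.nonsing_inv_mul _ (by rw [Matrix.det_transpose]; exact H.isUnit_det), Matrix.one_mul]

lemma IsFrame.inv_metric_eq {h E : Matrix (Fin 3) (Fin 3) ℝ} (H : IsFrame h E) :
    h⁻¹ = E * Eᵀ := by
  refine Matrix.inv_eq_left_inv ?_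
  rw [Matrix.mul_assoc, ← H.inv_eq, Matrix.mul_nonsing_inv _ H.isUnit_det]

/-- Components of a solution in an orthonormal frame obey the constraints. -/
lemma IsReduced.frameConstraints {Θ : ℝ → Matrix (Fin 3) (Fin 3) ℝ} (hI : IsOpen I)
    (H : IsReduced γ I h Θ J ρ) (ht : t ∈ I)
    {F : Matrix (Fin 3) (Fin 3) ℝ} (hF : IsFrame (h t) F) :
    FrameConstraints F⁻¹ F (F⁻¹ * Θ t * F) (spatial J t ᵥ* F) (J t 0) (ρ t) := by
  have hFi := Matrix.mul_nonsing_inv _ hF.isUnit_det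
  refine ⟨hFi, ?_, fun a => ?_, ?_, H.density_nonneg t ht⟩
  · have h1 := H.deriv_metric t ht
    have h2 := (h1.transpose.congr_of_eventuallyEq (B := h) (Filter.mem_of_superset (hI.mem_nhds ht)
      fun s hs => (posDef_transpose (H.posDef s hs)).symm)).unique h1
    rw [Matrix.transpose_smul] at h2
    have h3 : (h t * Θ t)ᵀ = h t * Θ t := smul_right_injective _ (two_ne_zero (α := ℝ)) h2
    rw [hF.inv_eq, Matrix.mul_assoc Fᵀ, Matrix.transpose_mul, Matrix.transpose_mul, h3,
      Matrix.transpose_transpose]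
    simp only [Matrix.mul_assoc]
  · simp only [Matrix.vecMul, dotProduct, spatial, Finset.mul_sum]
    exact Finset.sum_eq_zero fun i _ => by rw [← mul_assoc, H.momentum t ht, zero_mul]
  · have h1 : (F⁻¹ * Θ t * F).trace = (Θ t).trace := by
      rw [Matrix.trace_mul_comm, ← Matrix.mul_assoc, hFi, Matrix.one_mul]
    have h2 : (F⁻¹ * Θ t * F * (F⁻¹ * Θ t * F)).trace = (Θ t * Θ t).trace := by
      have : F⁻¹ * Θ t * F * (F⁻¹ * Θ t * F) = F⁻¹ * (Θ t * Θ t * F) := by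
        simp only [Matrix.mul_assoc]
        rw [← Matrix.mul_assoc F, hFi, Matrix.one_mul]
      rw [this, Matrix.trace_mul_comm, Matrix.mul_assoc, hFi, Matrix.mul_one]
    rw [h1, h2, H.friedmann t ht, hF.inv_metric_eq, ← Matrix.mulVec_mulVec, Matrix.dotProduct_mulVec,
      Matrix.mulVec_transpose]

lemma hubble_eq_trace (h : ℝ → Matrix (Fin 3) (Fin 3) ℝ) (t : ℝ) :
    hubble h t = (mixedExpansion h t).trace / 3 := by
  rw [hubble, mixedExpansion]; ring

/-- Every orbit is, to the future of a given time, an orbit of the frame equations. -/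
theorem IsOrbit.exists_isFrameSol (hγ : γ ∈ Icc (2 / 3 : ℝ) 2) (hI : IsOpen I) (hI' : I.OrdConnected)
    (H : IsOrbit γ I h J ρ E) {t₁ : ℝ} (ht₁ : t₁ ∈ I) :
    ∃ a < t₁, ∃ C F θ v w r, IsFrameSol γ (Ioi a) C F θ v w r ∧
      (∀ t > a, FrameConstraints (C t) (F t) (θ t) (v t) (w t) (r t)) ∧
      (∀ t > a, 0 < (θ t).trace) ∧ F t₁ = E t₁ ∧
      ∀ t ∈ I, a < t → h t = frameMetric C t ∧ J t = frameForm C v w t ∧ ρ t = r t := by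
  have HR := H.solution.isReduced hI
  have hF := H.frame t₁ ht₁
  have hFi := Matrix.mul_nonsing_inv _ hF.isUnit_det
  have hpos : 0 < ((E t₁)⁻¹ * mixedExpansion h t₁ * E t₁).trace := by
    rw [Matrix.trace_mul_comm, ← Matrix.mul_assoc, hFi, Matrix.one_mul]
    have := H.expanding t₁ ht₁
    rw [hubble_eq_trace] at this
    linarith
  obtain ⟨a, ha, C, F, θ, v, w, r, hsol, hc, hp, e1, e2, e3, e4, e5, e6⟩ :=
    BianchiI.exists_isFrameSol hγ t₁ (HR.frameConstraints hI ht₁ hF) hpos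
  refine ⟨a, ha, C, F, θ, v, w, r, hsol, hc, hp, e2, fun t ht hat => ?_⟩
  have HR' := hsol.isReduced hc
  have hmono : ∀ {h Θ J ρ} {A B : Set ℝ}, A ⊆ B → IsReduced γ B h Θ J ρ → IsReduced γ A h Θ J ρ :=
    fun hAB H => ⟨fun t ht => H.1 t (hAB ht), fun t ht => H.2 t (hAB ht), fun t ht => H.3 t (hAB ht),
      fun t ht => H.4 t (hAB ht), fun t ht => H.5 t (hAB ht), fun t ht => H.6 t (hAB ht),
      fun t ht => H.7 t (hAB ht), fun t ht => H.8 t (hAB ht)⟩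
  have hJ0 : frameForm C v w t₁ = J t₁ := by
    funext m
    refine Fin.cases ?_ (fun i => ?_) m
    · exact e5
    · change (v t₁ ᵥ* C t₁) i = spatial J t₁ i
      rw [e4, e1, Matrix.vecMul_vecMul, hFi, Matrix.vecMul_one]
  -- The frame solution starts from the data of the orbit at `t₁`, in its frame `E t₁`, so both
  -- solve the reduced equations with the same data.
  refine IsReduced.unique (I := I ∩ Ioi a) (hI.inter isOpen_Ioi) (hI'.inter ordConnected_Ioi)
    (hmono inter_subset_left HR) (hmono inter_subset_right HR') ⟨ht₁, ha⟩ ?_ ?_ hJ0.symm e6.symm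
    ⟨ht, hat⟩
  · rw [frameMetric, e1, ← hF.metric_eq]
  · rw [e1, e2, e3, Matrix.mul_assoc, Matrix.mul_assoc, hFi, Matrix.mul_one, ← Matrix.mul_assoc, hFi,
      Matrix.one_mul]

lemma expansion_congr {h h' : ℝ → Matrix (Fin 3) (Fin 3) ℝ} (hh : h =ᶠ[𝓝 t] h') :
    expansion h t = expansion h' t := by
  ext i j
  simp only [expansion, Matrix.of_apply]
  congr 1
  exact Filter.EventuallyEq.deriv_eq (hh.mono fun s hs => by simp only [hs])

lemma hubble_congr {h h' : ℝ → Matrix (Fin 3) (Fin 3) ℝ} (hh : h =ᶠ[𝓝 t] h') :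
    hubble h t = hubble h' t := by
  rw [hubble, hubble, expansion_congr hh, hh.eq_of_nhds]

lemma state_congr {h h' : ℝ → Matrix (Fin 3) (Fin 3) ℝ} {J J' : ℝ → Fin 4 → ℝ} {ρ ρ' : ℝ → ℝ}
    (hh : h =ᶠ[𝓝 t] h') (hJ : J t = J' t) (hρ : ρ t = ρ' t) (F : Matrix (Fin 3) (Fin 3) ℝ) :
    state h J ρ F t = state h' J' ρ' F t := by
  simp only [state, expansion_congr hh, hubble_congr hh, hh.eq_of_nhds, hJ, hρ]

lemma isReduced_congr {γ : ℝ} {I : Set ℝ} (hI : IsOpen I) {h h' Θ : ℝ → Matrix (Fin 3) (Fin 3) ℝ}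
    {J J' : ℝ → Fin 4 → ℝ} {ρ ρ' : ℝ → ℝ} (H : IsReduced γ I h Θ J ρ) (hh : ∀ t ∈ I, h' t = h t)
    (hJ : ∀ t ∈ I, J' t = J t) (hρ : ∀ t ∈ I, ρ' t = ρ t) : IsReduced γ I h' Θ J' ρ' := by
  have eh : ∀ t ∈ I, h' =ᶠ[𝓝 t] h := fun t ht => Filter.mem_of_superset (hI.mem_nhds ht) hh
  have eJ : ∀ t ∈ I, J' =ᶠ[𝓝 t] J := fun t ht => Filter.mem_of_superset (hI.mem_nhds ht) hJ
  have es : ∀ t ∈ I, spatial J' t = spatial J t := fun t ht => by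
    funext i; simp only [spatial, hJ t ht]
  refine ⟨fun t ht => ?_, fun t ht => ?_, fun t ht => ?_, fun t ht => ?_, fun t ht => ?_,
    fun t ht i => ?_, fun t ht i => ?_, fun t ht => ?_⟩
  · rw [hh t ht]; exact H.posDef t ht
  · rw [hρ t ht]; exact H.density_nonneg t ht
  · rw [hh t ht]; exact (H.deriv_metric t ht).congr_of_eventuallyEq (eh t ht)
  · rw [hh t ht, hρ t ht, es t ht]; exact H.deriv_mixed t ht
  · rw [hJ t ht]
    exact (H.deriv_form_zero t ht).congr_of_eventuallyEq ((eJ t ht).mono fun s hs => by simp only [hs])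
  · exact (H.deriv_form_succ t ht i).congr_of_eventuallyEq
      ((eJ t ht).mono fun s hs => by simp only [hs])
  · rw [hJ t ht]; exact H.momentum t ht i
  · rw [hJ t ht, hρ t ht, es t ht, hh t ht]; exact H.friedmann t ht

lemma IsOrbit.congr (hI : IsOpen I) (H : IsOrbit γ I h J ρ E)
    {h' : ℝ → Matrix (Fin 3) (Fin 3) ℝ} {J' : ℝ → Fin 4 → ℝ} {ρ' : ℝ → ℝ}
    {E' : ℝ → Matrix (Fin 3) (Fin 3) ℝ} (hh : ∀ t ∈ I, h' t = h t) (hJ : ∀ t ∈ I, J' t = J t)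
    (hρ : ∀ t ∈ I, ρ' t = ρ t) (hE : ∀ t ∈ I, IsFrame (h t) (E' t)) : IsOrbit γ I h' J' ρ' E' where
  solution := (isReduced_congr hI (H.solution.isReduced hI) hh hJ hρ).isTypeISolution hI
  expanding t ht := by
    rw [hubble_congr (h' := h) (Filter.mem_of_superset (hI.mem_nhds ht) hh)]
    exact H.expanding t ht
  frame t ht := by rw [hh t ht]; exact hE t ht

lemma IsOrbit.mono (H : IsOrbit γ I h J ρ E) {I' : Set ℝ} (hI : I' ⊆ I) :
    IsOrbit γ I' h J ρ E where
  solution :=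
    { metric_smooth := fun i j => (H.solution.metric_smooth i j).mono hI
      metric_posDef := fun t ht => H.solution.metric_posDef t (hI ht)
      form_smooth := fun m => (H.solution.form_smooth m).mono hI
      density_nonneg := fun t ht => H.solution.density_nonneg t (hI ht)
      einstein_eq := fun p hp => H.solution.einstein_eq p (hI hp)
      form_closed := fun p hp => H.solution.form_closed p (hI hp)
      form_coclosed := fun p hp => H.solution.form_coclosed p (hI hp) }
  expanding t ht := H.expanding t (hI ht)
  frame t ht := H.frame t (hI ht)

lemma IsOrbit.union {I' : Set ℝ} (H : IsOrbit γ I h J ρ E) (H' : IsOrbit γ I' h J ρ E)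
    (hI : IsOpen I) (hI' : IsOpen I') : IsOrbit γ (I ∪ I') h J ρ E where
  solution :=
    { metric_smooth := fun i j => (H.solution.metric_smooth i j).union_of_isOpen
        (H'.solution.metric_smooth i j) hI hI'
      metric_posDef := fun t ht => ht.elim (H.solution.metric_posDef t) (H'.solution.metric_posDef t)
      form_smooth := fun m => (H.solution.form_smooth m).union_of_isOpen
        (H'.solution.form_smooth m) hI hI'
      density_nonneg := fun t ht =>
        ht.elim (H.solution.density_nonneg t) (H'.solution.density_nonneg t)
      einstein_eq := fun p hp => hp.elim (H.solution.einstein_eq p) (H'.solution.einstein_eq p)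
      form_closed := fun p hp => hp.elim (H.solution.form_closed p) (H'.solution.form_closed p)
      form_coclosed := fun p hp =>
        hp.elim (H.solution.form_coclosed p) (H'.solution.form_coclosed p) }
  expanding t ht := ht.elim (H.expanding t) (H'.expanding t)
  frame t ht := ht.elim (H.frame t) (H'.frame t)

/-- Every orbit extends to all later times. -/
theorem IsOrbit.exists_extension (hγ : γ ∈ Icc (2 / 3 : ℝ) 2) {a b : ℝ} (hab : a < b)
    (H : IsOrbit γ (Ioo a b) h J ρ E) :
    ∃ h' J' ρ' E', IsOrbit γ (Ioi a) h' J' ρ' E' ∧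
      ∀ t ∈ Ioo a b, h' t = h t ∧ J' t = J t ∧ ρ' t = ρ t ∧ E' t = E t := by
  obtain ⟨t₁, ht₁⟩ := exists_between hab
  obtain ⟨c, hc, C, F, θ, v, w, r, hsol, hcon, hpos, -, hagree⟩ :=
    H.exists_isFrameSol hγ isOpen_Ioo ordConnected_Ioo ht₁
  have H' := (hsol.isOrbit isOpen_Ioi hcon hpos).mono (Ioi_subset_Ioi (le_max_right a c))
  -- The given orbit is continued by the frame solution. On the overlap `(max a c, b)` they agree by
  -- uniqueness, so both descriptions hold on open sets and the union is an orbit. The frame may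
  -- jump at `b`, since no continuity of frames is required.
  let h' := fun t => if t < b then h t else frameMetric C t
  let J' := fun t => if t < b then J t else frameForm C v w t
  let ρ' := fun t => if t < b then ρ t else r t
  let E' := fun t => if t < b then E t else F t
  have e1 : ∀ t ∈ Ioo a b, h' t = h t ∧ J' t = J t ∧ ρ' t = ρ t ∧ E' t = E t := fun t ht => by
    simp only [h', J', ρ', E', if_pos ht.2, and_self]
  have e2 : ∀ t ∈ Ioi (max a c), h' t = frameMetric C t ∧ J' t = frameForm C v w t ∧ ρ' t = r t :=
    fun t ht => by
      by_cases htb : t < b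
      · simp only [h', J', ρ', if_pos htb]
        exact hagree t ⟨(le_max_left a c).trans_lt ht, htb⟩ ((le_max_right a c).trans_lt ht)
      · simp only [h', J', ρ', if_neg htb, and_self]
  refine ⟨h', J', ρ', E', ?_, e1⟩
  have o1 : IsOrbit γ (Ioo a b) h' J' ρ' E' := H.congr isOpen_Ioo (fun t ht => (e1 t ht).1)
    (fun t ht => (e1 t ht).2.1) (fun t ht => (e1 t ht).2.2.1)
    (fun t ht => by rw [(e1 t ht).2.2.2]; exact H.frame t ht)
  have o2 : IsOrbit γ (Ioi (max a c)) h' J' ρ' E' := H'.congr isOpen_Ioi (fun t ht => (e2 t ht).1)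
    (fun t ht => (e2 t ht).2.1) (fun t ht => (e2 t ht).2.2) (fun t ht => by
      by_cases htb : t < b
      · simp only [E', if_pos htb, ← (e2 t ht).1, h']
        exact H.frame t ⟨(le_max_left a c).trans_lt ht, htb⟩
      · simp only [E', if_neg htb]
        exact H'.frame t ht)
  refine (o1.union o2 isOpen_Ioo isOpen_Ioi).mono fun t ht => ?_
  by_cases htb : t < b
  · exact Or.inl ⟨ht, htb⟩
  · exact Or.inr (max_lt ht (lt_of_lt_of_le (hc.trans ht₁.2) (not_lt.1 htb)))

end Orbit

/-! ### States -/

section States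

variable {γ : ℝ} {I : Set ℝ} {h Θ : ℝ → Matrix (Fin 3) (Fin 3) ℝ} {J : ℝ → Fin 4 → ℝ} {ρ : ℝ → ℝ}
  {t : ℝ}

lemma IsReduced.hubble_eq (H : IsReduced γ I h Θ J ρ) (ht : t ∈ I) :
    hubble h t = (Θ t).trace / 3 := by
  rw [hubble_eq_trace, H.mixedExpansion_eq ht]

lemma IsReduced.state_eq (H : IsReduced γ I h Θ J ρ) (ht : t ∈ I) {F : Matrix (Fin 3) (Fin 3) ℝ}
    (hF : IsFrame (h t) F) :
    state h J ρ F t = frameState (F⁻¹ * Θ t * F) (spatial J t ᵥ* F) (J t 0) (ρ t) := by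
  have htr : (F⁻¹ * Θ t * F).trace = (Θ t).trace := by
    rw [Matrix.trace_mul_comm, ← Matrix.mul_assoc, Matrix.mul_nonsing_inv _ hF.isUnit_det,
      Matrix.one_mul]
  have hm : Fᵀ * (expansion h t - hubble h t • h t) * F =
      F⁻¹ * Θ t * F - (hubble h t) • (1 : Matrix (Fin 3) (Fin 3) ℝ) := by
    rw [Matrix.mul_sub, Matrix.sub_mul, expansion_eq_of_hasMatDerivAt (H.deriv_metric t ht),
      ← Matrix.mul_assoc, ← hF.inv_eq, Matrix.mul_smul, Matrix.smul_mul, ← hF.inv_eq,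
      Matrix.nonsing_inv_mul _ hF.isUnit_det]
  simp only [state, hm]
  simp only [frameState, htr, H.hubble_eq ht]
  rfl

lemma FrameConstraints.frameState_mem {C E θ : Matrix (Fin 3) (Fin 3) ℝ} {v : Fin 3 → ℝ} {w ρ : ℝ}
    (H : FrameConstraints C E θ v w ρ) (hpos : 0 < θ.trace) :
    frameState θ v w ρ ∈ stateSpace := by
  have h6 : √6 ^ 2 = 6 := Real.sq_sqrt (by norm_num)
  have h60 : √6 ≠ 0 := by positivity
  have hτ := hpos.ne'
  refine ⟨fun a b => ?_, ?_, fun a => ?_, ?_, ?_⟩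
  · have : θ a b = θ b a := congrFun (congrFun H.symm b) a
    simp only [frameState, Matrix.sub_apply, Matrix.smul_apply, this, Matrix.one_apply,
      eq_comm (a := a)]
  · simp only [frameState, ← Finset.sum_div]
    have : ∑ a, (θ - (θ.trace / 3) • (1 : Matrix (Fin 3) (Fin 3) ℝ)) a a = 0 := by
      change (θ - (θ.trace / 3) • (1 : Matrix (Fin 3) (Fin 3) ℝ)).trace = 0
      rw [Matrix.trace_sub, Matrix.trace_smul, Matrix.trace_one]
      simp
    rw [this, zero_div]
  · simp only [frameState]
    rw [div_mul_div_comm, H.momentum, zero_div]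
  · simp only [frameState]
    exact div_nonneg H.density_nonneg (by positivity)
  · have h1 : ∑ a, ∑ b, ((θ - (θ.trace / 3) • (1 : Matrix (Fin 3) (Fin 3) ℝ)) a b) ^ 2 =
        (θ * θ).trace - θ.trace ^ 2 / 3 := by
      rw [H.trace_sq]
      simp [Fin.sum_univ_three, Matrix.trace, Matrix.one_apply]
      ring
    have h2 : ∑ a, v a ^ 2 = v ⬝ᵥ v := by simp [dotProduct, pow_two]
    simp only [frameState, div_pow, ← Finset.sum_div, h1, h2, mul_pow, h6]
    field_simp
    linarith [H.friedmann]

/-- The states of a solution lie in the state space. -/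
lemma IsReduced.state_mem (hI : IsOpen I) (H : IsReduced γ I h Θ J ρ) (ht : t ∈ I)
    (hpos : 0 < hubble h t) {F : Matrix (Fin 3) (Fin 3) ℝ} (hF : IsFrame (h t) F) :
    state h J ρ F t ∈ stateSpace := by
  rw [H.state_eq ht hF]
  refine (H.frameConstraints hI ht hF).frameState_mem ?_
  rw [Matrix.trace_mul_comm, ← Matrix.mul_assoc, Matrix.mul_nonsing_inv _ hF.isUnit_det,
    Matrix.one_mul]
  rw [H.hubble_eq ht] at hpos
  linarith

/-- Normalization is inverted in the coordinate frame: `θ = H₀ (Σ + 1)`, `v = √6 H₀ V`, `w = √6 H₀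
W`, `ρ = 3 H₀² Ω`. The conditions defining the state space are then exactly the constraints. -/
lemma exists_frameConstraints {s : State} (hs : s ∈ stateSpace) {H₀ : ℝ} (hH : 0 < H₀) :
    ∃ θ v w ρ, FrameConstraints 1 1 θ v w ρ ∧ θ.trace = 3 * H₀ ∧ frameState θ v w ρ = s := by
  obtain ⟨hsym, htr, hmom, hΩ, hfr⟩ := hs
  have h6 : √6 ^ 2 = 6 := Real.sq_sqrt (by norm_num)
  have h60 : √6 ≠ 0 := by positivity
  have hH0 := hH.ne'
  let S : Matrix (Fin 3) (Fin 3) ℝ := Matrix.of s.1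
  have htrS : S.trace = 0 := htr
  have htr3 : (H₀ • (S + 1)).trace = 3 * H₀ := by
    rw [Matrix.trace_smul, Matrix.trace_add, htrS, Matrix.trace_one]; simp; ring
  have hSS : (S * S).trace = ∑ a, ∑ b, s.1 a b ^ 2 := by
    simp only [Matrix.trace, Matrix.diag_apply, Matrix.mul_apply]
    refine Finset.sum_congr rfl fun a _ => Finset.sum_congr rfl fun b _ => ?_
    change s.1 a b * s.1 b a = _
    rw [hsym b a, pow_two]
  refine ⟨H₀ • (S + 1), fun a => √6 * H₀ * s.2.1 a, √6 * H₀ * s.2.2.1, 3 * H₀ ^ 2 * s.2.2.2,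
    ⟨by simp, ?_, fun a => ?_, ?_, by positivity⟩, htr3, ?_⟩
  · ext a b
    simp only [Matrix.transpose_apply, Matrix.smul_apply, Matrix.add_apply, S, Matrix.of_apply,
      hsym b a, Matrix.one_apply, eq_comm (a := b)]
  · linear_combination (√6 * H₀) ^ 2 * hmom a
  · have h1 : (H₀ • (S + 1) * H₀ • (S + 1)).trace = H₀ ^ 2 * ((S * S).trace + 3) := by
      rw [Matrix.smul_mul, Matrix.mul_smul, smul_smul, Matrix.trace_smul]
      simp only [Matrix.add_mul, Matrix.mul_add, Matrix.mul_one, Matrix.one_mul, Matrix.trace_add,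
        htrS, Matrix.trace_one, smul_eq_mul, Fintype.card_fin]
      push_cast; ring
    have h2 : (fun a => √6 * H₀ * s.2.1 a) ⬝ᵥ (fun a => √6 * H₀ * s.2.1 a) =
        6 * H₀ ^ 2 * ∑ a, s.2.1 a ^ 2 := by
      simp only [dotProduct, Finset.mul_sum]
      refine Finset.sum_congr rfl fun a _ => ?_
      linear_combination (H₀ * s.2.1 a) ^ 2 * h6
    rw [htr3, h1, h2, hSS]
    linear_combination (-6 * H₀ ^ 2) * hfr - (H₀ * s.2.2.1) ^ 2 * h6
  · simp only [frameState, htr3]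
    refine Prod.ext ?_ (Prod.ext ?_ (Prod.ext ?_ ?_))
    · funext a b
      simp only [Matrix.sub_apply, Matrix.smul_apply, Matrix.add_apply, S, Matrix.of_apply,
        smul_eq_mul]
      field_simp
      ring
    · funext a
      simp only
      field_simp
    · simp only
      field_simp
    · simp only
      field_simp

/-- There is an orbit through every state. -/
theorem exists_orbit_through (hγ : γ ∈ Icc (2 / 3 : ℝ) 2) {s : State} (hs : s ∈ stateSpace)
    (t₀ : ℝ) {H₀ : ℝ} (hH : 0 < H₀) : ∃ a < t₀, ∃ h J ρ E,
    IsOrbit γ (Ioi a) h J ρ E ∧ hubble h t₀ = H₀ ∧ state h J ρ (E t₀) t₀ = s := by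
  obtain ⟨θ₀, v₀, w₀, ρ₀, H₀', htr, hst⟩ := exists_frameConstraints hs hH
  obtain ⟨a, ha, C, E, θ, v, w, ρ, hsol, hc, hp, e1, e2, e3, e4, e5, e6⟩ :=
    exists_isFrameSol hγ t₀ H₀' (by rw [htr]; positivity)
  refine ⟨a, ha, _, _, _, _, hsol.isOrbit isOpen_Ioi hc hp, ?_, ?_⟩
  · rw [hsol.hubble_eq hc ha, e3, htr]; ring
  · rw [(hsol.isReduced hc).state_eq ha (IsFrameSol.isFrame (hc t₀ ha)), ← hst]
    change frameState ((E t₀)⁻¹ * (E t₀ * θ t₀ * C t₀) * E t₀) ((v t₀ ᵥ* C t₀) ᵥ* E t₀) (w t₀) _ = _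
    simp [e1, e2, e3, e4, e5, e6]

/-- The components of a state in the frame rotated by `R`. -/
def rotate (R : Matrix (Fin 3) (Fin 3) ℝ) (s : State) : State :=
  (fun a b => (Rᵀ * Matrix.of s.1 * R) a b, s.2.1 ᵥ* R, s.2.2.1, s.2.2.2)

lemma rotate_mul (R R' : Matrix (Fin 3) (Fin 3) ℝ) (s : State) :
    rotate R' (rotate R s) = rotate (R * R') s := by
  have h1 : Matrix.of (rotate R s).1 = Rᵀ * Matrix.of s.1 * R := rfl
  rw [rotate, h1]
  simp only [rotate, Matrix.vecMul_vecMul, Matrix.transpose_mul, Matrix.mul_assoc]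

lemma rotate_one (s : State) : rotate 1 s = s := by
  simp [rotate]

/-- Two orthonormal frames at one time differ by an orthogonal matrix. This makes rotation
invariants of states independent of the frames chosen along an orbit. -/
lemma state_rotate (h : ℝ → Matrix (Fin 3) (Fin 3) ℝ) (J : ℝ → Fin 4 → ℝ) (ρ : ℝ → ℝ)
    (E R : Matrix (Fin 3) (Fin 3) ℝ) (t : ℝ) :
    state h J ρ (E * R) t = rotate R (state h J ρ E t) := by
  refine Prod.ext ?_ (Prod.ext ?_ rfl)
  · funext a b
    set X := expansion h t - hubble h t • h t
    have h1 : Matrix.of (state h J ρ E t).1 = (hubble h t)⁻¹ • (Eᵀ * X * E) := by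
      ext a b
      simp [state, X, div_eq_inv_mul]
    simp only [rotate, h1, Matrix.mul_smul, Matrix.smul_mul, Matrix.smul_apply, smul_eq_mul]
    change ((E * R)ᵀ * X * (E * R)) a b / _ = _
    rw [div_eq_inv_mul, Matrix.transpose_mul]
    simp only [Matrix.mul_assoc]
  · funext a
    change (∑ i : Fin 3, J t i.succ * (E * R) i a) / _ =
      ∑ b, (∑ i : Fin 3, J t i.succ * E i b) / _ * R b a
    simp only [Matrix.mul_apply, div_mul_eq_mul_div, ← Finset.sum_div, Finset.mul_sum,
      Finset.sum_mul]
    rw [Finset.sum_comm]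
    simp only [mul_assoc]

lemma IsFrame.exists_rotation {h E F : Matrix (Fin 3) (Fin 3) ℝ} (hE : IsFrame h E)
    (hF : IsFrame h F) : ∃ R, Rᵀ * R = 1 ∧ F = E * R := by
  refine ⟨E⁻¹ * F, ?_, ?_⟩
  · rw [Matrix.transpose_mul, Matrix.mul_assoc, ← Matrix.mul_assoc (E⁻¹)ᵀ, ← hE.metric_eq,
      ← Matrix.mul_assoc]
    exact hF
  · rw [← Matrix.mul_assoc, Matrix.mul_nonsing_inv _ hE.isUnit_det, Matrix.one_mul]

lemma IsFrame.rotate {h E R : Matrix (Fin 3) (Fin 3) ℝ} (hE : IsFrame h E) (hR : Rᵀ * R = 1) :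
    IsFrame h (E * R) := by
  have : (E * R)ᵀ * h * (E * R) = Rᵀ * (Eᵀ * h * E) * R := by
    rw [Matrix.transpose_mul]; simp only [Matrix.mul_assoc]
  rw [IsFrame, this, hE, Matrix.mul_one, hR]

end States

/-! ### Rotation invariants of states -/

/-- The shear of a state as a matrix. -/
def shear (s : State) : Matrix (Fin 3) (Fin 3) ℝ := Matrix.of s.1

/-- The moment `V · V`. -/
def moment₀ (s : State) : ℝ := s.2.1 ⬝ᵥ s.2.1

/-- The moment `V · Σ V`. -/
def moment₁ (s : State) : ℝ := s.2.1 ⬝ᵥ (shear s *ᵥ s.2.1)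

/-- The moment `V · Σ² V`, for symmetric `Σ`. -/
def moment₂ (s : State) : ℝ := (shear s *ᵥ s.2.1) ⬝ᵥ (shear s *ᵥ s.2.1)

/-- The moment `V · Σ³ V`, for symmetric `Σ`. -/
def moment₃ (s : State) : ℝ := (shear s *ᵥ s.2.1) ⬝ᵥ (shear s *ᵥ (shear s *ᵥ s.2.1))

/-- The Gram determinant of `V` and `Σ V`; it vanishes iff the `j`-form does not rotate. -/
def gram (s : State) : ℝ := moment₀ s * moment₂ s - moment₁ s ^ 2

/-- The linear factor `6 - Σ_11 + Σ_33` of the monotone function, in the frame adapted to `V` and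
`Σ V`. -/
def linFactor (s : State) : ℝ :=
  6 - moment₁ s / moment₀ s - (moment₀ s * moment₃ s - moment₁ s * moment₂ s) / gram s

/-- The monotone function. -/
def lyapunov (s : State) : ℝ := moment₀ s * gram s / linFactor s ^ 8

section Rotation

variable {R : Matrix (Fin 3) (Fin 3) ℝ}

/-- Rotation commutes with forming `V, ΣV, Σ²V, ...`, hence all moments are invariant. -/
lemma rotate_mulVec (hR : Rᵀ * R = 1) (s : State) (x : Fin 3 → ℝ) :
    shear (rotate R s) *ᵥ (x ᵥ* R) = (shear s *ᵥ x) ᵥ* R := by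
  have hR' : R * Rᵀ = 1 := mul_eq_one_comm.1 hR
  have h1 : shear (rotate R s) = Rᵀ * shear s * R := rfl
  rw [h1, ← Matrix.mulVec_transpose, ← Matrix.mulVec_transpose, Matrix.mulVec_mulVec,
    Matrix.mulVec_mulVec, Matrix.mul_assoc, hR', Matrix.mul_one]

lemma vecMul_dotProduct_vecMul (hR : Rᵀ * R = 1) (x y : Fin 3 → ℝ) :
    (x ᵥ* R) ⬝ᵥ (y ᵥ* R) = x ⬝ᵥ y := by
  have hR' : R * Rᵀ = 1 := mul_eq_one_comm.1 hR
  rw [← Matrix.dotProduct_mulVec, ← Matrix.mulVec_transpose, Matrix.mulVec_mulVec, hR',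
    Matrix.one_mulVec]

lemma moment₀_rotate (hR : Rᵀ * R = 1) (s : State) : moment₀ (rotate R s) = moment₀ s :=
  vecMul_dotProduct_vecMul hR _ _

lemma moment₁_rotate (hR : Rᵀ * R = 1) (s : State) : moment₁ (rotate R s) = moment₁ s := by
  rw [moment₁, show (rotate R s).2.1 = s.2.1 ᵥ* R from rfl, rotate_mulVec hR,
    vecMul_dotProduct_vecMul hR, moment₁]

lemma moment₂_rotate (hR : Rᵀ * R = 1) (s : State) : moment₂ (rotate R s) = moment₂ s := by
  rw [moment₂, show (rotate R s).2.1 = s.2.1 ᵥ* R from rfl, rotate_mulVec hR,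
    vecMul_dotProduct_vecMul hR, moment₂]

lemma moment₃_rotate (hR : Rᵀ * R = 1) (s : State) : moment₃ (rotate R s) = moment₃ s := by
  rw [moment₃, show (rotate R s).2.1 = s.2.1 ᵥ* R from rfl, rotate_mulVec hR, rotate_mulVec hR,
    vecMul_dotProduct_vecMul hR, moment₃]

lemma gram_rotate (hR : Rᵀ * R = 1) (s : State) : gram (rotate R s) = gram s := by
  rw [gram, gram, moment₀_rotate hR, moment₁_rotate hR, moment₂_rotate hR]

lemma linFactor_rotate (hR : Rᵀ * R = 1) (s : State) : linFactor (rotate R s) = linFactor s := by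
  rw [linFactor, linFactor, gram_rotate hR, moment₀_rotate hR, moment₁_rotate hR, moment₂_rotate hR,
    moment₃_rotate hR]

lemma lyapunov_rotate (hR : Rᵀ * R = 1) (s : State) : lyapunov (rotate R s) = lyapunov s := by
  rw [lyapunov, lyapunov, linFactor_rotate hR, gram_rotate hR, moment₀_rotate hR]

lemma rotate_mem (hR : Rᵀ * R = 1) {s : State} (hs : s ∈ stateSpace) :
    rotate R s ∈ stateSpace := by
  obtain ⟨hsym, htr, hmom, hΩ, hfr⟩ := hs
  have hR' : R * Rᵀ = 1 := mul_eq_one_comm.1 hR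
  have h1 : shear (rotate R s) = Rᵀ * shear s * R := rfl
  have hsS : (shear s)ᵀ = shear s := by ext a b; exact hsym b a
  have hsR : (shear (rotate R s))ᵀ = shear (rotate R s) := by
    rw [h1, Matrix.transpose_mul, Matrix.transpose_mul, hsS, Matrix.transpose_transpose,
      Matrix.mul_assoc]
  have hnorm : ∀ s : State, (shear s)ᵀ = shear s →
      ∑ a, ∑ b, s.1 a b ^ 2 = (shear s * shear s).trace := fun s hs => by
    simp only [Matrix.trace, Matrix.diag_apply, Matrix.mul_apply]
    refine Finset.sum_congr rfl fun a _ => Finset.sum_congr rfl fun b _ => ?_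
    rw [show shear s b a = shear s a b from congrFun (congrFun hs a) b, pow_two]
    rfl
  refine ⟨fun a b => congrFun (congrFun hsR b) a, ?_, fun a => ?_, hΩ, ?_⟩
  · change (shear (rotate R s)).trace = 0
    rw [h1, Matrix.trace_mul_comm, ← Matrix.mul_assoc, hR', Matrix.one_mul]
    exact htr
  · change s.2.2.1 * ∑ b, s.2.1 b * R b a = 0
    rw [Finset.mul_sum]
    exact Finset.sum_eq_zero fun b _ => by rw [← mul_assoc, hmom, zero_mul]
  · have h2 : (shear (rotate R s) * shear (rotate R s)).trace = (shear s * shear s).trace := by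
      have : Rᵀ * shear s * R * (Rᵀ * shear s * R) = Rᵀ * (shear s * shear s * R) := by
        simp only [Matrix.mul_assoc]
        rw [← Matrix.mul_assoc R, hR', Matrix.one_mul]
      rw [h1, this, Matrix.trace_mul_comm, Matrix.mul_assoc, hR', Matrix.mul_one]
    have h3 : ∀ s : State, ∑ a, s.2.1 a ^ 2 = moment₀ s := fun s => by
      simp [moment₀, dotProduct, pow_two]
    rw [hnorm _ hsR, h2, ← hnorm _ hsS, h3, moment₀_rotate hR, ← h3]
    exact hfr

end Rotation

/-- A state with `V = (v, 0, 0)` and tridiagonal shear. -/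
def triState (A Y b k v Ω : ℝ) : State :=
  (![![A, Y, 0], ![Y, b, k], ![0, k, -A - b]], ![v, 0, 0], 0, Ω)

/-! ### Invariants of a tridiagonal state -/

section Tridiagonal

variable {A Y b k v Ω : ℝ}

lemma moment₀_tri : moment₀ (triState A Y b k v Ω) = v ^ 2 := by
  simp [moment₀, triState, dotProduct, Fin.sum_univ_three, pow_two]

lemma moment₁_tri : moment₁ (triState A Y b k v Ω) = v ^ 2 * A := by
  simp [moment₁, shear, triState, dotProduct, Matrix.mulVec, Fin.sum_univ_three]
  ring

lemma moment₂_tri : moment₂ (triState A Y b k v Ω) = v ^ 2 * (A ^ 2 + Y ^ 2) := by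
  simp [moment₂, shear, triState, dotProduct, Matrix.mulVec, Fin.sum_univ_three]
  ring

lemma moment₃_tri : moment₃ (triState A Y b k v Ω) =
    v ^ 2 * (A ^ 3 + 2 * A * Y ^ 2 + b * Y ^ 2) := by
  simp [moment₃, shear, triState, dotProduct, Matrix.mulVec, Fin.sum_univ_three]
  ring

lemma gram_tri : gram (triState A Y b k v Ω) = v ^ 4 * Y ^ 2 := by
  rw [gram, moment₀_tri, moment₁_tri, moment₂_tri]; ring

lemma linFactor_tri (hv : v ≠ 0) (hY : Y ≠ 0) :
    linFactor (triState A Y b k v Ω) = 6 - 2 * A - b := by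
  rw [linFactor, gram_tri, moment₀_tri, moment₁_tri, moment₂_tri, moment₃_tri]
  field_simp
  ring

lemma lyapunov_tri (hv : v ≠ 0) (hY : Y ≠ 0) :
    lyapunov (triState A Y b k v Ω) = v ^ 6 * Y ^ 2 / (6 - 2 * A - b) ^ 8 := by
  rw [lyapunov, linFactor_tri hv hY, gram_tri, moment₀_tri]
  ring

end Tridiagonal

/-- Gram-Schmidt for `V, SV`, completed by the cross product. Since `SV` lies in the span of the
first two vectors, the entry `(0, 2)` vanishes. The hypothesis says that `V` and `SV` are linearly
independent. -/
lemma exists_tridiagonalizing {S : Matrix (Fin 3) (Fin 3) ℝ} (hS : Sᵀ = S) {V : Fin 3 → ℝ}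
    (hD : (V ⬝ᵥ V) * ((S *ᵥ V) ⬝ᵥ (S *ᵥ V)) - (V ⬝ᵥ (S *ᵥ V)) ^ 2 ≠ 0) :
    ∃ R : Matrix (Fin 3) (Fin 3) ℝ, Rᵀ * R = 1 ∧ ∃ v > 0, ∃ Y > 0, V ᵥ* R = ![v, 0, 0] ∧
      (Rᵀ * S * R) 0 1 = Y ∧ (Rᵀ * S * R) 0 2 = 0 := by
  have hV0 : V ⬝ᵥ V ≠ 0 := fun h0 => by
    have : V = 0 := dotProduct_self_eq_zero.1 h0
    simp [this] at hD
  have hVpos : 0 < V ⬝ᵥ V := lt_of_le_of_ne (FrameConstraints.dotProduct_self_nonneg' V) hV0.symm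
  set v := √(V ⬝ᵥ V) with hv
  have hvpos : 0 < v := Real.sqrt_pos.2 hVpos
  have hv2 : v ^ 2 = V ⬝ᵥ V := Real.sq_sqrt hVpos.le
  set e : Fin 3 → ℝ := v⁻¹ • V with he
  have hee : e ⬝ᵥ e = 1 := by
    rw [he, smul_dotProduct, dotProduct_smul, ← hv2]
    simp only [smul_eq_mul]; field_simp
  clear_value e
  set A := e ⬝ᵥ (S *ᵥ e) with hA
  set y : Fin 3 → ℝ := S *ᵥ e - A • e with hy
  have hey : e ⬝ᵥ y = 0 := by rw [hy, dotProduct_sub, dotProduct_smul, hee, ← hA]; simp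
  have hyy : y ⬝ᵥ y = (S *ᵥ e) ⬝ᵥ (S *ᵥ e) - A ^ 2 := by
    rw [hy, sub_dotProduct, dotProduct_sub, dotProduct_sub, smul_dotProduct, dotProduct_smul,
      dotProduct_smul, smul_dotProduct, hee, dotProduct_comm (S *ᵥ e) e, ← hA]
    simp only [smul_eq_mul]; ring
  have hyy0 : y ⬝ᵥ y ≠ 0 := fun h0 => by
    apply hD
    have hVe : V = v • e := by rw [he, smul_smul, mul_inv_cancel₀ hvpos.ne', one_smul]
    rw [hVe]
    simp only [Matrix.mulVec_smul, smul_dotProduct, dotProduct_smul, hee, smul_eq_mul, ← hA]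
    rw [hyy] at h0
    linear_combination v ^ 4 * h0
  have hypos : 0 < y ⬝ᵥ y := lt_of_le_of_ne (FrameConstraints.dotProduct_self_nonneg' y) hyy0.symm
  set Y := √(y ⬝ᵥ y) with hYdef
  have hYpos : 0 < Y := Real.sqrt_pos.2 hypos
  have hY2 : Y ^ 2 = y ⬝ᵥ y := Real.sq_sqrt hypos.le
  set f : Fin 3 → ℝ := Y⁻¹ • y with hf
  have hff : f ⬝ᵥ f = 1 := by
    rw [hf, smul_dotProduct, dotProduct_smul, ← hY2]
    simp only [smul_eq_mul]; field_simp
  have hef : e ⬝ᵥ f = 0 := by rw [hf, dotProduct_smul, hey, smul_zero]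
  set g : Fin 3 → ℝ := crossProduct e f with hg
  have heg : e ⬝ᵥ g = 0 := dot_self_cross e f
  have hfg : f ⬝ᵥ g = 0 := dot_cross_self e f
  have hgg : g ⬝ᵥ g = 1 := by
    rw [hg, cross_dot_cross, hee, hff, hef, dotProduct_comm f e, hef]; ring
  have hSe : S *ᵥ e = A • e + Y • f := by
    rw [hf, smul_smul Y, mul_inv_cancel₀ hYpos.ne', one_smul, hy]; abel
  let R : Matrix (Fin 3) (Fin 3) ℝ := (Matrix.of ![e, f, g])ᵀ
  have hcol : ∀ x : Fin 3 → ℝ, x ᵥ* R = ![x ⬝ᵥ e, x ⬝ᵥ f, x ⬝ᵥ g] := fun x => by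
    funext a
    fin_cases a <;> rfl
  have hent : ∀ a, (Rᵀ * S * R) 0 a = (![(S *ᵥ e) ⬝ᵥ e, (S *ᵥ e) ⬝ᵥ f, (S *ᵥ e) ⬝ᵥ g]) a := fun a => by
    rw [← hcol]
    have h1 : (Rᵀ * S * R) 0 = ((e ᵥ* S) ᵥ* R) := by
      rw [Matrix.vecMul_vecMul, Matrix.mul_assoc]
      funext b
      rfl
    rw [h1, ← Matrix.mulVec_transpose S, hS]
  refine ⟨R, ?_, v, hvpos, Y, hYpos, ?_, ?_, ?_⟩
  · ext a b
    have h1 : (Rᵀ * R) a b = (![e, f, g] a) ⬝ᵥ (![e, f, g] b) := rfl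
    rw [h1]
    fin_cases a <;> fin_cases b <;>
      simp [hee, hff, hgg, hef, heg, hfg, dotProduct_comm f e, dotProduct_comm g e,
        dotProduct_comm g f]
  · have hVe : V = v • e := by rw [he, smul_smul, mul_inv_cancel₀ hvpos.ne', one_smul]
    rw [hcol, hVe]
    simp [hee, hef, heg]
  · rw [hent]
    simp [hSe, hef, hff]
  · rw [hent]
    simp [hSe, heg, hfg]

/-- A rotating state is tridiagonal in a suitable frame. -/
theorem exists_rotate_eq_triState {s : State} (hs : s ∈ stateSpace) (hD : gram s ≠ 0) :
    ∃ R : Matrix (Fin 3) (Fin 3) ℝ, Rᵀ * R = 1 ∧ ∃ A Y b k v Ω : ℝ, 0 < v ∧ 0 < Y ∧ 0 ≤ Ω ∧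
      (A ^ 2 + A * b + b ^ 2 + Y ^ 2 + k ^ 2) / 3 + v ^ 2 + Ω = 1 ∧
      rotate R s = triState A Y b k v Ω := by
  have hsS : (shear s)ᵀ = shear s := by ext a b; exact hs.1 b a
  obtain ⟨R, hR, v, hv, Y, hY, hV, h01, h02⟩ := exists_tridiagonalizing hsS hD
  obtain ⟨hsym, htr, hmom, hΩ, hfr⟩ := rotate_mem hR hs
  have hV' : (rotate R s).2.1 = ![v, 0, 0] := hV
  -- The momentum constraint removes the temporal part because `v` is nonzero.
  have hW : s.2.2.1 = 0 := by
    have := hmom 0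
    rw [hV'] at this
    exact (mul_eq_zero.1 this).resolve_right hv.ne'
  have h01' : (rotate R s).1 0 1 = Y := h01
  have h02' : (rotate R s).1 0 2 = 0 := h02
  have h10 : (rotate R s).1 1 0 = Y := by rw [hsym, h01']
  have h20 : (rotate R s).1 2 0 = 0 := by rw [hsym, h02']
  have h21 := hsym 2 1
  rw [Fin.sum_univ_three] at htr
  have h22 : (rotate R s).1 2 2 = -(rotate R s).1 0 0 - (rotate R s).1 1 1 := by linarith
  have htri : rotate R s = triState ((rotate R s).1 0 0) Y ((rotate R s).1 1 1) ((rotate R s).1 1 2) v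
      s.2.2.2 := by
    refine Prod.ext ?_ (Prod.ext hV' (Prod.ext hW rfl))
    funext a b
    fin_cases a <;> fin_cases b <;> simp [triState, h01', h02', h10, h20, h21, h22]
  refine ⟨R, hR, _, Y, _, _, v, _, hv, hY, hΩ, ?_, htri⟩
  rw [hV'] at hfr
  have hW' : (rotate R s).2.2.1 = 0 := hW
  have hΩ' : (rotate R s).2.2.2 = s.2.2.2 := rfl
  simp only [Fin.sum_univ_three, h01', h02', h10, h20, h21, h22, hW', hΩ'] at hfr
  simp at hfr
  linarith

/-! ### The maximum of the monotone function -/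

section Maximum

variable {A Y b k v Ω : ℝ}

/-- From `(2A + b)² + 3b² = 4 (A² + Ab + b²) ≤ 12` one gets `|2A + b| < 4`. So the denominator of
the monotone function stays away from zero. -/
lemma two_le_factor {A b r : ℝ} (hr : 0 ≤ r) (h : (A ^ 2 + A * b + b ^ 2) / 3 + r = 1) :
    2 ≤ 6 - 2 * A - b := by
  nlinarith [sq_nonneg b, sq_nonneg (2 * A + b)]

/-- The quadratic form that governs the growth of the monotone function. -/
def growth (A b : ℝ) : ℝ := 12 * (A - 1) ^ 2 + 12 * (A - 1) * b + 9 * b ^ 2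

/-- The form equals `3 (2 (A - 1) + b)² + 6 b²`. -/
lemma growth_nonneg (A b : ℝ) : 0 ≤ growth A b := by
  unfold growth
  nlinarith [sq_nonneg (2 * (A - 1) + b), sq_nonneg b]

lemma growth_eq_zero {A b : ℝ} (h : growth A b = 0) : A = 1 ∧ b = 0 := by
  unfold growth at h
  have hb : b = 0 := by
    have : b ^ 2 = 0 := by nlinarith [sq_nonneg (2 * (A - 1) + b), sq_nonneg b]
    exact pow_eq_zero_iff (two_ne_zero) |>.1 this
  subst hb
  have : (A - 1) ^ 2 = 0 := by nlinarith
  exact ⟨by linarith [pow_eq_zero_iff (two_ne_zero) |>.1 this], rfl⟩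

/-- With the Friedmann constraint this becomes `(6 - 2A - b)² = 24 (v² + Y²/3 + r) + growth A b`,
where `r` collects `k²/3` and `Ω`. It ties the denominator of the monotone function to its
numerator. -/
lemma sq_factor_eq (A b : ℝ) :
    (6 - 2 * A - b) ^ 2 = 24 - 8 * (A ^ 2 + A * b + b ^ 2) + growth A b := by
  unfold growth; ring

/-- Arithmetic and geometric mean of `x/3, x/3, x/3, y/3`, with the difference written out
explicitly; equality forces `x = y`. -/
lemma pow_three_mul_le {x y : ℝ} (hx : 0 ≤ x) (hy : 0 ≤ y) :
    x ^ 3 * y ≤ 81 * ((x + y / 3) / 4) ^ 4 := by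
  have : 81 * ((x + y / 3) / 4) ^ 4 - x ^ 3 * y =
      (x - y) ^ 2 * (81 * x ^ 2 + 14 * x * y + y ^ 2) / 256 := by ring
  have h2 : 0 ≤ (x - y) ^ 2 * (81 * x ^ 2 + 14 * x * y + y ^ 2) / 256 := by positivity
  linarith

/-- The monotone function in terms of the invariants `v²`, `Y²`, `A`, `b`. -/
lemma pow_three_mul_div_le {x y A b r : ℝ} (hx : 0 ≤ x) (hy : 0 ≤ y) (hr : 0 ≤ r)
    (h : (A ^ 2 + A * b + b ^ 2 + y) / 3 + x + r = 1) :
    x ^ 3 * y / (6 - 2 * A - b) ^ 8 ≤ 1 / 2 ^ 20 := by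
  have hf : 2 ≤ 6 - 2 * A - b := two_le_factor (r := y / 3 + x + r) (by positivity) (by linarith)
  have h1 : x + y / 3 ≤ (6 - 2 * A - b) ^ 2 / 24 := by
    rw [sq_factor_eq]; linarith [growth_nonneg A b]
  rw [div_le_iff₀ (by positivity)]
  refine (pow_three_mul_le hx hy).trans ?_
  have h2 : ((x + y / 3) / 4) ^ 4 ≤ ((6 - 2 * A - b) ^ 2 / 24 / 4) ^ 4 := by gcongr
  calc 81 * ((x + y / 3) / 4) ^ 4 ≤ 81 * ((6 - 2 * A - b) ^ 2 / 24 / 4) ^ 4 := by linarith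
    _ = 1 / 2 ^ 20 * (6 - 2 * A - b) ^ 8 := by ring

/-- Equality must hold in both estimates behind the bound: the one by the squared factor gives
`growth A b = 0` and `r = 0`, the one between the means gives `x = y`, and the constraint fixes
their common value. -/
lemma eq_of_pow_three_mul_div_eq {x y A b r : ℝ} (hx : 0 ≤ x) (hy : 0 ≤ y) (hr : 0 ≤ r)
    (h : (A ^ 2 + A * b + b ^ 2 + y) / 3 + x + r = 1)
    (heq : x ^ 3 * y / (6 - 2 * A - b) ^ 8 = 1 / 2 ^ 20) :
    A = 1 ∧ b = 0 ∧ r = 0 ∧ x = 1 / 2 ∧ y = 1 / 2 := by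
  have hf : 2 ≤ 6 - 2 * A - b := two_le_factor (r := y / 3 + x + r) (by positivity) (by linarith)
  have h1 : x + y / 3 = (6 - 2 * A - b) ^ 2 / 24 - growth A b / 24 - r := by
    rw [sq_factor_eq]; linarith
  rw [div_eq_iff (by positivity)] at heq
  have hQ := growth_nonneg A b
  have hle := pow_three_mul_le hx hy
  have h3 : (6 - 2 * A - b) ^ 2 / 24 ≤ x + y / 3 := by
    have h4 : ((6 - 2 * A - b) ^ 2 / 24 / 4) ^ 4 ≤ ((x + y / 3) / 4) ^ 4 := by
      have : ((6 - 2 * A - b) ^ 2 / 24 / 4) ^ 4 * 81 = 1 / 2 ^ 20 * (6 - 2 * A - b) ^ 8 := by ring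
      linarith
    have := (pow_le_pow_iff_left₀ (by positivity) (by positivity) (by norm_num : (4 : ℕ) ≠ 0)).1 h4
    linarith
  have hr0 : r = 0 := by linarith
  obtain ⟨hA, hb⟩ := growth_eq_zero (show growth A b = 0 by linarith)
  subst hA hb hr0
  have hy' : y = 2 - 3 * x := by linarith
  have h5 : (x - y) ^ 2 * (81 * x ^ 2 + 14 * x * y + y ^ 2) = 0 := by
    have e1 : 81 * ((x + y / 3) / 4) ^ 4 - x ^ 3 * y =
      (x - y) ^ 2 * (81 * x ^ 2 + 14 * x * y + y ^ 2) / 256 := by ring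
    have e2 : 81 * ((x + y / 3) / 4) ^ 4 = 1 / 2 ^ 20 * (6 - 2 * 1 - 0) ^ 8 := by
      rw [show x + y / 3 = 2 / 3 by linarith]; norm_num
    linarith
  rcases mul_eq_zero.1 h5 with h6 | h6
  · have : x - y = 0 := pow_eq_zero_iff (two_ne_zero) |>.1 h6
    exact ⟨rfl, rfl, rfl, by linarith, by linarith⟩
  · exfalso
    have hx0 : x = 0 := by nlinarith [mul_nonneg hx hy, sq_nonneg x, sq_nonneg y]
    have hy0 : y = 0 := by nlinarith [mul_nonneg hx hy, sq_nonneg x, sq_nonneg y]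
    linarith

end Maximum

/-- The Edge in the frame adapted to `V` and `Σ V`. -/
def edgeTri : State := triState 1 (√(1 / 2)) 0 0 (√(1 / 2)) 0

lemma two_le_linFactor {s : State} (hs : s ∈ stateSpace) (hD : gram s ≠ 0) : 2 ≤ linFactor s := by
  obtain ⟨R, hR, A, Y, b, k, v, Ω, hv, hY, hΩ, hcon, htri⟩ := exists_rotate_eq_triState hs hD
  rw [← linFactor_rotate hR, htri, linFactor_tri hv.ne' hY.ne']
  exact two_le_factor (r := (Y ^ 2 + k ^ 2) / 3 + v ^ 2 + Ω) (by positivity) (by linarith)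

lemma gram_nonneg {s : State} (hs : s ∈ stateSpace) : 0 ≤ gram s := by
  by_cases hD : gram s = 0
  · exact hD.ge
  obtain ⟨R, hR, A, Y, b, k, v, Ω, hv, hY, hΩ, hcon, htri⟩ := exists_rotate_eq_triState hs hD
  rw [← gram_rotate hR, htri, gram_tri]
  positivity

lemma moment₀_nonneg (s : State) : 0 ≤ moment₀ s := FrameConstraints.dotProduct_self_nonneg' _

lemma moment₀_ne_zero {s : State} (hD : gram s ≠ 0) : moment₀ s ≠ 0 := fun h0 => by
  have hV : s.2.1 = 0 := dotProduct_self_eq_zero.1 h0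
  simp [gram, moment₀, moment₁, hV] at hD

lemma lyapunov_of_gram_eq_zero {s : State} (hD : gram s = 0) : lyapunov s = 0 := by
  rw [lyapunov, hD, mul_zero, zero_div]

lemma gram_ne_zero_of_lyapunov_pos {s : State} (h : 0 < lyapunov s) : gram s ≠ 0 := fun h0 =>
  h.ne' (lyapunov_of_gram_eq_zero h0)

lemma lyapunov_pos {s : State} (hs : s ∈ stateSpace) (hD : gram s ≠ 0) : 0 < lyapunov s := by
  have h1 := two_le_linFactor hs hD
  have h2 := lt_of_le_of_ne (gram_nonneg hs) hD.symm
  have h3 := lt_of_le_of_ne (moment₀_nonneg s) (moment₀_ne_zero hD).symm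
  rw [lyapunov]
  positivity

lemma lyapunov_nonneg {s : State} (hs : s ∈ stateSpace) : 0 ≤ lyapunov s := by
  by_cases hD : gram s = 0
  · rw [lyapunov_of_gram_eq_zero hD]
  · exact (lyapunov_pos hs hD).le

lemma lyapunov_le {s : State} (hs : s ∈ stateSpace) : lyapunov s ≤ 1 / 2 ^ 20 := by
  by_cases hD : gram s = 0
  · rw [lyapunov_of_gram_eq_zero hD]; positivity
  obtain ⟨R, hR, A, Y, b, k, v, Ω, hv, hY, hΩ, hcon, htri⟩ := exists_rotate_eq_triState hs hD
  rw [← lyapunov_rotate hR, htri, lyapunov_tri hv.ne' hY.ne', show v ^ 6 = (v ^ 2) ^ 3 by ring]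
  exact pow_three_mul_div_le (r := k ^ 2 / 3 + Ω) (by positivity) (by positivity) (by positivity)
    (by linarith)

lemma exists_rotate_eq_edgeTri {s : State} (hs : s ∈ stateSpace) (h : lyapunov s = 1 / 2 ^ 20) :
    ∃ R : Matrix (Fin 3) (Fin 3) ℝ, Rᵀ * R = 1 ∧ rotate R s = edgeTri := by
  have hD : gram s ≠ 0 := gram_ne_zero_of_lyapunov_pos (by rw [h]; positivity)
  obtain ⟨R, hR, A, Y, b, k, v, Ω, hv, hY, hΩ, hcon, htri⟩ := exists_rotate_eq_triState hs hD
  refine ⟨R, hR, ?_⟩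
  rw [← lyapunov_rotate hR, htri, lyapunov_tri hv.ne' hY.ne', show v ^ 6 = (v ^ 2) ^ 3 by ring] at h
  obtain ⟨rfl, rfl, hr, hx, hy⟩ := eq_of_pow_three_mul_div_eq (r := k ^ 2 / 3 + Ω) (by positivity)
    (by positivity) (by positivity) (by linarith) h
  have hΩ0 : Ω = 0 := by nlinarith [sq_nonneg k]
  have hk0 : k = 0 := by
    have : k ^ 2 = 0 := by linarith
    exact pow_eq_zero_iff (two_ne_zero) |>.1 this
  rw [htri, hΩ0, hk0, edgeTri, ← hx]
  rw [← hy] at hx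
  rw [Real.sqrt_sq hv.le, show Y = v from (pow_left_inj₀ hY.le hv.le two_ne_zero).1 hx.symm]

/-! ### Topology of the state space -/

lemma continuous_shear_mulVec {f : State → Fin 3 → ℝ} (hf : Continuous f) :
    Continuous fun s => shear s *ᵥ f s := by
  refine continuous_pi fun a => ?_
  simp only [Matrix.mulVec, dotProduct, shear, Matrix.of_apply]
  have h1 : ∀ i j, Continuous fun s : State => s.1 i j := fun i j => by fun_prop
  have h2 : ∀ i, Continuous fun s : State => f s i := fun i => by fun_prop
  exact continuous_finsetSum _ fun i _ => (h1 a i).mul (h2 i)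

lemma continuous_dotProduct' {f g : State → Fin 3 → ℝ} (hf : Continuous f) (hg : Continuous g) :
    Continuous fun s => f s ⬝ᵥ g s := by
  simp only [dotProduct]
  exact continuous_finsetSum _ fun i _ => ((continuous_apply i).comp hf).mul ((continuous_apply i).comp hg)

lemma continuous_spatialPart : Continuous fun s : State => s.2.1 := by fun_prop

lemma continuous_moment₀ : Continuous moment₀ :=
  continuous_dotProduct' continuous_spatialPart continuous_spatialPart

lemma continuous_moment₁ : Continuous moment₁ :=
  continuous_dotProduct' continuous_spatialPart (continuous_shear_mulVec continuous_spatialPart)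

lemma continuous_moment₂ : Continuous moment₂ :=
  continuous_dotProduct' (continuous_shear_mulVec continuous_spatialPart)
    (continuous_shear_mulVec continuous_spatialPart)

lemma continuous_moment₃ : Continuous moment₃ :=
  continuous_dotProduct' (continuous_shear_mulVec continuous_spatialPart)
    (continuous_shear_mulVec (continuous_shear_mulVec continuous_spatialPart))

lemma continuous_gram : Continuous gram :=
  (continuous_moment₀.mul continuous_moment₂).sub (continuous_moment₁.pow 2)

/-- The linear factor has no limit in general where the Gram determinant vanishes. But its eighth
power is at least `1` wherever the determinant is nonzero, so the function is squeezed between `0`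
and the numerator, which tends to `0`. -/
lemma continuousOn_lyapunov : ContinuousOn lyapunov stateSpace := by
  intro s hs
  by_cases hD : gram s = 0
  · have hup : Tendsto (fun s => moment₀ s * gram s) (𝓝[stateSpace] s) (𝓝 0) := by
      have := (continuous_moment₀.mul continuous_gram).continuousWithinAt (s := stateSpace) (x := s)
      change Tendsto (fun s => moment₀ s * gram s) _ (𝓝 (moment₀ s * gram s)) at this
      rwa [hD, mul_zero] at this
    rw [ContinuousWithinAt, lyapunov_of_gram_eq_zero hD]
    refine tendsto_of_tendsto_of_tendsto_of_le_of_le' tendsto_const_nhds hup ?_ ?_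
    · filter_upwards [self_mem_nhdsWithin] with x hx using lyapunov_nonneg hx
    · filter_upwards [self_mem_nhdsWithin] with x hx
      have h0 : 0 ≤ moment₀ x * gram x := mul_nonneg (moment₀_nonneg x) (gram_nonneg hx)
      by_cases hDx : gram x = 0
      · rw [lyapunov_of_gram_eq_zero hDx]; exact h0
      · have h1 := two_le_linFactor hx hDx
        exact div_le_self h0 (one_le_pow₀ (by linarith))
  · have h1 := two_le_linFactor hs hD
    refine ContinuousAt.continuousWithinAt ?_
    have hf : ContinuousAt linFactor s :=
      (continuousAt_const.sub (continuous_moment₁.continuousAt.div continuous_moment₀.continuousAt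
        (moment₀_ne_zero hD))).sub
        (((continuous_moment₀.mul continuous_moment₃).sub
          (continuous_moment₁.mul continuous_moment₂)).continuousAt.div continuous_gram.continuousAt hD)
    exact (continuous_moment₀.mul continuous_gram).continuousAt.div (hf.pow 8) (by positivity)

lemma isCompact_stateSpace : IsCompact stateSpace := by
  have c1 : ∀ i j, Continuous fun s : State => s.1 i j := fun i j => by fun_prop
  have c2 : ∀ i, Continuous fun s : State => s.2.1 i := fun i => by fun_prop
  have c3 : Continuous fun s : State => s.2.2.1 := by fun_prop
  have c4 : Continuous fun s : State => s.2.2.2 := by fun_prop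
  refine Metric.isCompact_of_isClosed_isBounded ?_ ?_
  · simp only [stateSpace, ofPred_and]
    refine IsClosed.inter ?_ (IsClosed.inter ?_ (IsClosed.inter ?_ (IsClosed.inter ?_ ?_)))
    · simp only [ofPred_forall]
      exact isClosed_iInter fun i => isClosed_iInter fun j => isClosed_eq (c1 i j) (c1 j i)
    · exact isClosed_eq (continuous_finsetSum _ fun i _ => c1 i i) continuous_const
    · simp only [ofPred_forall]
      exact isClosed_iInter fun i => isClosed_eq (c3.mul (c2 i)) continuous_const
    · exact isClosed_le continuous_const c4
    · refine isClosed_eq ?_ continuous_const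
      exact (((continuous_const.mul (continuous_finsetSum _ fun i _ => continuous_finsetSum _ fun j _ =>
        (c1 i j).pow 2)).add (continuous_finsetSum _ fun i _ => (c2 i).pow 2)).add (c3.pow 2)).add c4
  · refine (Metric.isBounded_iff_subset_closedBall (0 : State)).2 ⟨3, fun s hs => ?_⟩
    obtain ⟨-, -, -, hΩ, hfr⟩ := hs
    have h1 : 0 ≤ ∑ a, ∑ b, s.1 a b ^ 2 := Finset.sum_nonneg fun a _ =>
      Finset.sum_nonneg fun b _ => sq_nonneg _
    have h2 : 0 ≤ ∑ a, s.2.1 a ^ 2 := Finset.sum_nonneg fun a _ => sq_nonneg _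
    have h3 := sq_nonneg s.2.2.1
    have hs1 : ‖s.1‖ ≤ 3 := (pi_norm_le_iff_of_nonneg (by norm_num)).2 fun a =>
      (pi_norm_le_iff_of_nonneg (by norm_num)).2 fun b => by
        refine abs_le_of_sq_le_sq ?_ (by norm_num)
        have h4 : s.1 a b ^ 2 ≤ ∑ a, ∑ b, s.1 a b ^ 2 :=
          (Finset.single_le_sum (f := fun b => s.1 a b ^ 2) (fun _ _ => sq_nonneg _)
            (Finset.mem_univ b)).trans (Finset.single_le_sum (f := fun a => ∑ b, s.1 a b ^ 2)
            (fun _ _ => Finset.sum_nonneg fun _ _ => sq_nonneg _) (Finset.mem_univ a))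
        linarith
    have hs2 : ‖s.2.1‖ ≤ 3 := (pi_norm_le_iff_of_nonneg (by norm_num)).2 fun a => by
        refine abs_le_of_sq_le_sq ?_ (by norm_num)
        have h4 : s.2.1 a ^ 2 ≤ ∑ a, s.2.1 a ^ 2 :=
          Finset.single_le_sum (f := fun a => s.2.1 a ^ 2) (fun _ _ => sq_nonneg _)
            (Finset.mem_univ a)
        linarith
    have hs3 : ‖s.2.2.1‖ ≤ 3 := abs_le_of_sq_le_sq (by linarith) (by norm_num)
    have hs4 : ‖s.2.2.2‖ ≤ 3 := by
      rw [Real.norm_eq_abs, abs_of_nonneg hΩ]; linarith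
    rw [mem_closedBall_zero_iff]
    simp only [Prod.norm_def]
    exact max_le hs1 (max_le hs2 (max_le hs3 hs4))

/-! ### Neighbourhoods of the maximizers on a compact set -/

section Sublevel

variable {X : Type*} [MetricSpace X] {K : Set X} {f : X → ℝ} {m : ℝ}

/-- Points of a compact set at which `f` is close to its maximum are close to the maximizers. -/
lemma exists_infDist_lt_of_lt (hK : IsCompact K) (hf : ContinuousOn f K) (hm : ∀ x ∈ K, f x ≤ m)
    {ε : ℝ} (hε : 0 < ε) :
    ∃ c < m, ∀ x ∈ K, c < f x → Metric.infDist x {x ∈ K | f x = m} < ε := by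
  set L := K ∩ {x | ε ≤ Metric.infDist x {x ∈ K | f x = m}}
  have hL : IsCompact L := hK.inter_right
    (isClosed_le continuous_const (Metric.continuous_infDist_pt _))
  rcases L.eq_empty_or_nonempty with h | h
  -- No point of `K` is `ε` away from the maximizers, so any level below `m` serves.
  · refine ⟨m - 1, by linarith, fun x hx _ => ?_⟩
    by_contra! hc
    exact (h ▸ (⟨hx, hc⟩ : x ∈ L) : x ∈ (∅ : Set X))
  · obtain ⟨x₀, hx₀, hmax⟩ := hL.exists_isMaxOn h (hf.mono inter_subset_left)
    refine ⟨f x₀, lt_of_le_of_ne (hm x₀ hx₀.1) fun heq => ?_, fun x hx hlt => ?_⟩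
    · have h1 : ε ≤ Metric.infDist x₀ {x ∈ K | f x = m} := hx₀.2
      rw [Metric.infDist_zero_of_mem (show x₀ ∈ {x ∈ K | f x = m} from ⟨hx₀.1, heq⟩)] at h1
      linarith
    · by_contra! hc
      exact absurd (hmax (show x ∈ L from ⟨hx, hc⟩)) (not_le.2 hlt)

/-- Points of a compact set that are close to the maximizers have values close to the maximum. -/
lemma exists_lt_of_infDist_lt (hK : IsCompact K) (hf : ContinuousOn f K)
    (hne : {x ∈ K | f x = m}.Nonempty) {c : ℝ} (hc : c < m) :
    ∃ δ > 0, ∀ x ∈ K, Metric.infDist x {x ∈ K | f x = m} < δ → c < f x := by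
  set L := K ∩ f ⁻¹' Iic c
  have hL : IsCompact L := hK.of_isClosed_subset
    (hf.preimage_isClosed_of_isClosed hK.isClosed isClosed_Iic) inter_subset_left
  have hMc : IsClosed {x ∈ K | f x = m} :=
    hf.preimage_isClosed_of_isClosed hK.isClosed isClosed_singleton
  rcases L.eq_empty_or_nonempty with h | h
  · refine ⟨1, one_pos, fun x hx _ => ?_⟩
    by_contra! hcon
    exact (h ▸ (⟨hx, hcon⟩ : x ∈ L) : x ∈ (∅ : Set X))
  · obtain ⟨x₀, hx₀, hmin⟩ := hL.exists_isMinOn h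
      (Metric.continuous_infDist_pt {x ∈ K | f x = m}).continuousOn
    refine ⟨Metric.infDist x₀ {x ∈ K | f x = m}, ?_, fun x hx hlt => ?_⟩
    · refine (hMc.notMem_iff_infDist_pos hne).1 fun hmem => ?_
      have h1 : f x₀ ≤ c := hx₀.2
      linarith [hmem.2]
    · by_contra! hcon
      exact absurd (hmin (show x ∈ L from ⟨hx, hcon⟩)) (not_le.2 hlt)

end Sublevel

/-! ### The Edge -/

/-- The mixed expansion tensor of the Edge. -/
def edgeMixed (t : ℝ) : Matrix (Fin 3) (Fin 3) ℝ :=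
  !![3 / 2 * t⁻¹, 0, 3 * √2 / 4 * (√t * t⁻¹ ^ 2); 0, 0, 0; -(√2 / 4) * (√t * t⁻¹), 0, 0]

/-- The dual frame of the coframe of the Edge. -/
def edgeFrame (t : ℝ) : Matrix (Fin 3) (Fin 3) ℝ :=
  !![t⁻¹, 0, -√2 * t⁻¹; 0, 1, 0; 0, 0, √t * t⁻¹]

/-- The state of the Edge in the frame dual to its coframe. -/
def edgeState : State :=
  (![![1, 0, -(√2 / 2)], ![0, -1, 0], ![-(√2 / 2), 0, 0]], ![1 / √6, 0, -√2 / √6], 0, 0)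

lemma sqrt_two_sq : √2 ^ 2 = (2 : ℝ) := Real.sq_sqrt (by norm_num)

lemma edgeCoframe_eq {t : ℝ} (ht : 0 < t) :
    edgeCoframe t = !![t, 0, √2 * √t; 0, 1, 0; 0, 0, √t] := by
  have h1 : t ^ (1 / 2 : ℝ) = √t := (Real.sqrt_eq_rpow t).symm
  have h2 : t * (√2 * t ^ (-(1 / 2) : ℝ)) = √2 * √t := by
    rw [Real.rpow_neg ht.le, h1]
    have : √t ^ 2 = t := Real.sq_sqrt ht.le
    have h3 : √t ≠ 0 := (Real.sqrt_pos.2 ht).ne'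
    field_simp
    linarith
  rw [edgeCoframe, h1, h2]

lemma edgeMetric_eq {t : ℝ} (ht : 0 < t) :
    edgeMetric t = !![t ^ 2, 0, √2 * (t * √t); 0, 1, 0; √2 * (t * √t), 0, 3 * t] := by
  have h2 := sqrt_two_sq
  have h3 : √t ^ 2 = t := Real.sq_sqrt ht.le
  rw [edgeMetric, edgeCoframe_eq ht]
  ext i j
  fin_cases i <;> fin_cases j <;> simp [Matrix.mul_apply, Fin.sum_univ_three]
  · ring
  · ring
  · ring
  · linear_combination √t ^ 2 * h2 + 3 * h3

lemma edgeFrame_mul {t : ℝ} (ht : 0 < t) : edgeFrame t * edgeCoframe t = 1 := by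
  have h3 : √t ^ 2 = t := Real.sq_sqrt ht.le
  rw [edgeFrame, edgeCoframe_eq ht]
  ext i j
  fin_cases i <;> fin_cases j <;> simp [Matrix.mul_apply, Fin.sum_univ_three, ht.ne'] <;>
    (try field_simp) <;> linarith

lemma edgeCoframe_mul {t : ℝ} (ht : 0 < t) : edgeCoframe t * edgeFrame t = 1 :=
  mul_eq_one_comm.1 (edgeFrame_mul ht)

lemma edgeCoframe_inv {t : ℝ} (ht : 0 < t) : (edgeCoframe t)⁻¹ = edgeFrame t :=
  Matrix.inv_eq_right_inv (edgeCoframe_mul ht)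

lemma edgeFrame_inv {t : ℝ} (ht : 0 < t) : (edgeFrame t)⁻¹ = edgeCoframe t :=
  Matrix.inv_eq_right_inv (edgeFrame_mul ht)

lemma isFrame_edgeFrame {t : ℝ} (ht : 0 < t) : IsFrame (edgeMetric t) (edgeFrame t) := by
  rw [IsFrame, edgeMetric, Matrix.mul_assoc, Matrix.mul_assoc, edgeCoframe_mul ht, Matrix.mul_one,
    ← Matrix.transpose_mul, edgeCoframe_mul ht, Matrix.transpose_one]

lemma edgeMetric_inv {t : ℝ} (ht : 0 < t) : (edgeMetric t)⁻¹ = edgeFrame t * (edgeFrame t)ᵀ := by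
  rw [edgeMetric, Matrix.mul_inv_rev, ← Matrix.transpose_nonsing_inv, edgeCoframe_inv ht]

lemma edgeMetric_inv_mulVec {t : ℝ} (ht : 0 < t) : (edgeMetric t)⁻¹ *ᵥ spatial edgeForm t =
    ![3 / 2 * t⁻¹ ^ 2, 0, -(√2 / 2) * (√t * t⁻¹ ^ 2)] := by
  have h2 := sqrt_two_sq
  rw [edgeMetric_inv ht, ← Matrix.mulVec_mulVec]
  have h1 : (edgeFrame t)ᵀ *ᵥ spatial edgeForm t = ![t⁻¹ / 2, 0, -√2 * t⁻¹ / 2] := by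
    funext a
    fin_cases a <;>
      simp [Matrix.mulVec, dotProduct, Fin.sum_univ_three, edgeFrame, spatial, edgeForm] <;> ring
  rw [h1]
  funext a
  fin_cases a <;> simp [Matrix.mulVec, dotProduct, Fin.sum_univ_three, edgeFrame] <;> ring_nf
  rw [h2]
  ring

lemma edgeMetric_posDef {t : ℝ} (ht : 0 < t) : (edgeMetric t).PosDef := by
  have hu : IsUnit (edgeCoframe t) := IsUnit.of_mul_eq_one _ (edgeCoframe_mul ht)
  have := Matrix.PosDef.conjTranspose_mul_self (edgeCoframe t)
    (Matrix.mulVec_injective_iff_isUnit.2 hu)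
  rwa [conjTranspose_eq_transpose_of_trivial] at this

lemma trace_edgeMixed (t : ℝ) : (edgeMixed t).trace = 3 / 2 * t⁻¹ := by
  simp [edgeMixed, Matrix.trace, Fin.sum_univ_three]

lemma hasDerivAt_sqrt' {t : ℝ} (ht : 0 < t) : HasDerivAt Real.sqrt (√t * t⁻¹ / 2) t := by
  refine (Real.hasDerivAt_sqrt ht.ne').congr_deriv ?_
  have h3 : √t ^ 2 = t := Real.sq_sqrt ht.le
  have h4 : √t ≠ 0 := (Real.sqrt_pos.2 ht).ne'
  field_simp
  linarith

lemma hasMatDerivAt_edgeMetric {t : ℝ} (ht' : 0 < t) : HasMatDerivAt edgeMetric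
    !![2 * t, 0, 3 * √2 / 2 * √t; 0, 0, 0; 3 * √2 / 2 * √t, 0, 3] t := by
  have e : edgeMetric =ᶠ[𝓝 t] fun t =>
      !![t ^ 2, 0, √2 * (t * √t); 0, 1, 0; √2 * (t * √t), 0, 3 * t] :=
    Filter.mem_of_superset (Ioi_mem_nhds ht') fun s hs => edgeMetric_eq hs
  have d1 : HasDerivAt (fun s : ℝ => s ^ 2) (2 * t) t := by simpa using hasDerivAt_pow 2 t
  have d2 : HasDerivAt (fun s : ℝ => √2 * (s * √s)) (3 * √2 / 2 * √t) t := by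
    refine (((hasDerivAt_id t).mul (hasDerivAt_sqrt' ht')).const_mul √2).congr_deriv ?_
    simp only [id]
    field_simp
    ring
  have d3 : HasDerivAt (fun s : ℝ => 3 * s) 3 t := by simpa using (hasDerivAt_id t).const_mul 3
  have d : HasMatDerivAt (fun t : ℝ =>
      !![t ^ 2, 0, √2 * (t * √t); 0, 1, 0; √2 * (t * √t), 0, 3 * t])
      !![2 * t, 0, 3 * √2 / 2 * √t; 0, 0, 0; 3 * √2 / 2 * √t, 0, 3] t := by
    intro i j
    fin_cases i <;> fin_cases j <;>
      first | exact hasDerivAt_const t _ | exact d1 | exact d2 | exact d3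
  exact d.congr_of_eventuallyEq e

/-- Without fluid, `γ` enters only through a multiple of `ρ = 0`, so one computation serves all
values of `γ`. -/
theorem isReduced_edge (γ : ℝ) :
    IsReduced γ (Ioi 0) edgeMetric edgeMixed edgeForm edgeDensity where
  posDef _ ht := edgeMetric_posDef ht
  density_nonneg _ _ := le_rfl
  deriv_metric t ht := by
    have ht' : 0 < t := ht
    have h2 := sqrt_two_sq
    have h3 : √t ^ 2 = t := Real.sq_sqrt ht'.le
    refine (hasMatDerivAt_edgeMetric ht').congr_deriv ?_
    rw [edgeMetric_eq ht', edgeMixed]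
    ext i j
    fin_cases i <;> fin_cases j <;> simp
    all_goals
      field_simp
      try simp only [h2, h3]
      try ring
  deriv_mixed t ht := by
    have ht' : 0 < t := ht
    have h2 := sqrt_two_sq
    have h3 : √t ^ 2 = t := Real.sq_sqrt ht'.le
    have di : HasDerivAt (fun s : ℝ => s⁻¹) (-t⁻¹ ^ 2) t := by
      simpa using hasDerivAt_inv ht'.ne'
    have d1 : HasDerivAt (fun s : ℝ => 3 / 2 * s⁻¹) (3 / 2 * (-t⁻¹ ^ 2)) t := di.const_mul _
    have d2 : HasDerivAt (fun s : ℝ => 3 * √2 / 4 * (√s * s⁻¹ ^ 2))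
        (-(9 * √2 / 8) * (√t * t⁻¹ ^ 3)) t := by
      refine (((hasDerivAt_sqrt' ht').mul (di.pow 2)).const_mul _).congr_deriv ?_
      simp
      ring
    have d3 : HasDerivAt (fun s : ℝ => -(√2 / 4) * (√s * s⁻¹)) (√2 / 8 * (√t * t⁻¹ ^ 2)) t := by
      refine (((hasDerivAt_sqrt' ht').mul di).const_mul _).congr_deriv ?_
      ring
    have d : HasMatDerivAt edgeMixed !![3 / 2 * (-t⁻¹ ^ 2), 0, -(9 * √2 / 8) * (√t * t⁻¹ ^ 3);
        0, 0, 0; √2 / 8 * (√t * t⁻¹ ^ 2), 0, 0] t := by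
      intro i j
      fin_cases i <;> fin_cases j <;>
        first | exact hasDerivAt_const t _ | exact d1 | exact d2 | exact d3
    refine d.congr_deriv ?_
    rw [mixedRate, trace_edgeMixed, edgeMetric_inv_mulVec ht']
    ext i j
    fin_cases i <;> fin_cases j <;>
      simp [edgeMixed, edgeDensity, spatial, edgeForm, vecMulVec_apply, - vecMulVec_cons, - cons_vecMulVec] <;> ring
  deriv_form_zero t _ := by
    simpa [edgeForm] using hasDerivAt_const t (0 : ℝ)
  deriv_form_succ t _ i := hasDerivAt_const t _
  momentum t _ i := by simp [edgeForm]
  friedmann t ht := by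
    have h2 := sqrt_two_sq
    have h3 : √t ^ 2 = t := Real.sq_sqrt (le_of_lt ht)
    have ht0 : t ≠ 0 := ne_of_gt ht
    rw [trace_edgeMixed, edgeMetric_inv_mulVec ht]
    simp [edgeMixed, edgeDensity, spatial, edgeForm, dotProduct, Fin.sum_univ_three,
      Matrix.trace]
    field_simp
    simp only [h2, h3]
    ring

lemma hubble_edge {t : ℝ} (ht : 0 < t) : hubble edgeMetric t = 1 / 2 * t⁻¹ := by
  rw [(isReduced_edge 0).hubble_eq ht, trace_edgeMixed]
  ring

lemma hasDerivAt_hubble_edge {t : ℝ} (ht : 0 < t) :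
    HasDerivAt (hubble edgeMetric) (-(1 + 1) * hubble edgeMetric t ^ 2) t := by
  have di : HasDerivAt (fun s : ℝ => s⁻¹) (-t⁻¹ ^ 2) t := by
    simpa using hasDerivAt_inv ht.ne'
  refine ((di.const_mul (1 / 2)).congr_of_eventuallyEq
    (Filter.mem_of_superset (Ioi_mem_nhds ht) fun s hs => hubble_edge hs)).congr_deriv ?_
  rw [hubble_edge ht]
  ring

theorem isRotatingAt_edge {t : ℝ} (ht : 0 < t) : IsRotatingAt edgeMetric edgeForm t := by
  rintro p rfl ⟨c, hc⟩
  have h := hc (Fin.succ 2)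
  rw [covDeriv_zero_succ (posDef_det_ne_zero (edgeMetric_posDef ht)),
    (isReduced_edge 0).mixedExpansion_eq ht] at h
  have h2 : (√2 : ℝ) ≠ 0 := by positivity
  have h3 : √(p 0) ≠ 0 := (Real.sqrt_pos.2 ht).ne'
  have h4 : p 0 ≠ 0 := ht.ne'
  simp [edgeForm, edgeMixed, Fin.sum_univ_three, h2, h3, h4] at h

lemma state_edge {t : ℝ} (ht : 0 < t) :
    state edgeMetric edgeForm edgeDensity (edgeFrame t) t = edgeState := by
  have h2 := sqrt_two_sq
  have h3 : √t ^ 2 = t := Real.sq_sqrt ht.le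
  have h6 : (√6 : ℝ) ≠ 0 := by positivity
  have hD : edgeCoframe t * edgeMixed t * edgeFrame t =
      t⁻¹ • !![1, 0, -(√2 / 4); 0, 0, 0; -(√2 / 4), 0, 1 / 2] := by
    rw [edgeCoframe_eq ht, edgeMixed, edgeFrame]
    ext i j
    fin_cases i <;> fin_cases j <;> simp [Matrix.mul_apply, Fin.sum_univ_three]
    all_goals (field_simp; simp only [h2, h3]; try ring)
  rw [(isReduced_edge 0).state_eq ht (isFrame_edgeFrame ht), edgeFrame_inv ht, hD, frameState,
    edgeState]
  have htr : (t⁻¹ • !![1, 0, -(√2 / 4); 0, 0, 0; -(√2 / 4), 0, 1 / 2]).trace = 3 / 2 * t⁻¹ := by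
    simp [Matrix.trace, Fin.sum_univ_three]
    ring
  simp only [htr]
  refine Prod.ext ?_ (Prod.ext ?_ (Prod.ext ?_ ?_))
  · funext a b
    fin_cases a <;> fin_cases b <;> simp
    · field_simp; norm_num
    · field_simp; norm_num
    · field_simp
    · field_simp; norm_num
    · left; ring
  · funext a
    fin_cases a <;> simp [spatial, edgeForm, edgeFrame, Matrix.vecMul, dotProduct, Fin.sum_univ_three]
    all_goals field_simp
  · simp [edgeForm]
  · simp [edgeDensity]

theorem isSelfSimilar_edge : IsSelfSimilar (Ioi 0) edgeMetric := by
  -- This field generates `t ↦ λ t`, `x ↦ x`, `y ↦ λ y`, `z ↦ λ^(1/2) z`, under which each term of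
  -- the line element scales by `λ²`.
  refine ⟨fun p => ![p 0, 0, p 2, p 3 / 2], ?_, fun p hp => ⟨hp.ne', fun m n => ?_⟩⟩
  · refine contDiffOn_pi.2 fun i => ?_
    fin_cases i <;> simp <;> fun_prop
  · have ht : 0 < p 0 := hp
    have h2 := sqrt_two_sq
    have h3 : √(p 0) ^ 2 = p 0 := Real.sq_sqrt ht.le
    have hg : ∀ m n, metric edgeMetric p m n =
        (!![-1, 0, 0, 0; 0, p 0 ^ 2, 0, √2 * (p 0 * √(p 0)); 0, 0, 1, 0;
          0, √2 * (p 0 * √(p 0)), 0, 3 * p 0] : Matrix (Fin 4) (Fin 4) ℝ) m n := fun m n => by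
      rw [metric, edgeMetric_eq ht]
      fin_cases m <;> fin_cases n <;> rfl
    have hd : ∀ m n, pd 0 (fun x => metric edgeMetric x m n) p =
        (!![0, 0, 0, 0; 0, 2 * p 0, 0, 3 * √2 / 2 * √(p 0); 0, 0, 0, 0;
          0, 3 * √2 / 2 * √(p 0), 0, 3] : Matrix (Fin 4) (Fin 4) ℝ) m n := by
      have e := hasMatDerivAt_edgeMetric ht
      refine fun m n => (pd_zero_of_time (fun s => metric edgeMetric (fun _ => s) m n) p).trans ?_
      refine Fin.cases ?_ (fun i => ?_) m <;> refine Fin.cases ?_ (fun j => ?_) n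
      · exact deriv_const _ _
      · refine (deriv_const _ (0 : ℝ)).trans ?_
        fin_cases j <;> rfl
      · refine (deriv_const _ (0 : ℝ)).trans ?_
        fin_cases i <;> rfl
      · refine (e i j).deriv.trans ?_
        fin_cases i <;> fin_cases j <;> rfl
    have hs : ∀ (i : Fin 3) m n, pd i.succ (fun x => metric edgeMetric x m n) p = 0 :=
      fun i m n => pd_succ_of_time (fun s => metric edgeMetric (fun _ => s) m n) p i
    have hX : ∀ m s, pd m (fun x : Fin 4 → ℝ => (![x 0, 0, x 2, x 3 / 2] : Fin 4 → ℝ) s) p =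
        (!![1, 0, 0, 0; 0, 0, 0, 0; 0, 0, 1, 0; 0, 0, 0, 1 / 2] : Matrix (Fin 4) (Fin 4) ℝ) m s := by
      intro m s
      fin_cases m <;> fin_cases s <;> simp [pd, Function.update]
    have hs1 := hs 0 m n
    have hs2 := hs 1 m n
    have hs3 := hs 2 m n
    simp only [Fin.succ_zero_eq_one, Fin.succ_one_eq_two] at hs1 hs2
    rw [show Fin.succ (2 : Fin 3) = 3 from rfl] at hs3
    simp only [lieDerivMetric, hX, hg, Fin.sum_univ_four, hd, hs1, hs2, hs3]
    fin_cases m <;> fin_cases n <;> simp <;> try ring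

/-! ### The states of the Edge -/

lemma rotate_transpose_rotate {R : Matrix (Fin 3) (Fin 3) ℝ} (hR : Rᵀ * R = 1) (s : State) :
    rotate Rᵀ (rotate R s) = s := by
  rw [rotate_mul, mul_eq_one_comm.1 hR, rotate_one]

lemma edgeState_mem : edgeState ∈ stateSpace := by
  rw [← state_edge one_pos]
  refine (isReduced_edge 0).state_mem isOpen_Ioi (mem_Ioi.2 one_pos) ?_ (isFrame_edgeFrame one_pos)
  rw [hubble_edge one_pos]
  norm_num

/-- The dual frame of the coframe is not adapted to `V`, so the value is computed from the moments
`1/2, 1/2, 3/4, 1`: the Gram determinant is `1/8` and the linear factor is `4`. -/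
lemma lyapunov_edgeState : lyapunov edgeState = 1 / 2 ^ 20 := by
  have h2 := sqrt_two_sq
  have h6 : √6 ^ 2 = (6 : ℝ) := Real.sq_sqrt (by norm_num)
  have h60 : (√6 : ℝ) ≠ 0 := by positivity
  have m0 : moment₀ edgeState = 1 / 2 := by
    simp [moment₀, edgeState, dotProduct, Fin.sum_univ_three]
    field_simp
    linarith
  have hv : shear edgeState *ᵥ edgeState.2.1 = ![2 / √6, 0, -(√2 / 2) / √6] := by
    funext a
    fin_cases a <;>
      simp [shear, edgeState, Matrix.mulVec, dotProduct, Fin.sum_univ_three]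
    · field_simp
      linarith
    · field_simp
  have hv2 : shear edgeState *ᵥ (shear edgeState *ᵥ edgeState.2.1) =
      ![5 / 2 / √6, 0, -√2 / √6] := by
    rw [hv]
    funext a
    fin_cases a <;>
      simp [shear, edgeState, Matrix.mulVec, dotProduct, Fin.sum_univ_three]
    · field_simp
      linarith
    · field_simp
  have m1 : moment₁ edgeState = 1 / 2 := by
    rw [moment₁, hv]
    simp [edgeState, dotProduct, Fin.sum_univ_three]
    field_simp
    linarith
  have m2 : moment₂ edgeState = 3 / 4 := by
    rw [moment₂, hv]
    simp [dotProduct, Fin.sum_univ_three]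
    field_simp
    linarith
  have m3 : moment₃ edgeState = 1 := by
    rw [moment₃, hv2, hv]
    simp [dotProduct, Fin.sum_univ_three]
    field_simp
    linarith
  rw [lyapunov, linFactor, gram, m0, m1, m2, m3]
  norm_num

/-- The states of the Edge are the maximizers of the monotone function. -/
theorem edgeStates_eq : edgeStates = {s ∈ stateSpace | lyapunov s = 1 / 2 ^ 20} := by
  ext s
  constructor
  · rintro ⟨t, ht, E, hE, rfl⟩
    obtain ⟨R, hR, rfl⟩ := (isFrame_edgeFrame ht).exists_rotation hE
    rw [state_rotate, state_edge ht]
    exact ⟨rotate_mem hR edgeState_mem, (lyapunov_rotate hR _).trans lyapunov_edgeState⟩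
  · rintro ⟨hs, hl⟩
    obtain ⟨R, hR, h1⟩ := exists_rotate_eq_edgeTri hs hl
    obtain ⟨R', hR', h2⟩ := exists_rotate_eq_edgeTri edgeState_mem lyapunov_edgeState
    -- Both states are rotated into the same normal form `edgeTri`, hence into each other.
    have h3 : rotate (R' * Rᵀ) edgeState = s := by
      rw [← rotate_mul, h2, ← h1, rotate_transpose_rotate hR]
    have hR'' : (R' * Rᵀ)ᵀ * (R' * Rᵀ) = 1 := by
      rw [Matrix.transpose_mul, Matrix.transpose_transpose, Matrix.mul_assoc,
        ← Matrix.mul_assoc R'ᵀ, hR', Matrix.one_mul, mul_eq_one_comm.1 hR]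
    refine ⟨1, one_pos, edgeFrame 1 * (R' * Rᵀ), (isFrame_edgeFrame one_pos).rotate hR'', ?_⟩
    rw [state_rotate, state_edge one_pos, h3]

/-! ### Rotating states -/

/-- This is the equality case of Cauchy-Schwarz: the square norm of `m₀ ΣV - m₁ V` is `m₀` times the
Gram determinant. -/
lemma gram_eq_zero_iff {s : State} :
    gram s = 0 ↔ ∃ c : ℝ, ∀ a, ∑ b, s.1 a b * s.2.1 b = c * s.2.1 a := by
  constructor
  · intro h
    by_cases hm : moment₀ s = 0
    · have hV : s.2.1 = 0 := dotProduct_self_eq_zero.1 hm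
      exact ⟨0, fun a => by simp [hV]⟩
    · refine ⟨moment₁ s / moment₀ s, fun a => ?_⟩
      have h1 : (moment₀ s • (shear s *ᵥ s.2.1) - moment₁ s • s.2.1) ⬝ᵥ
          (moment₀ s • (shear s *ᵥ s.2.1) - moment₁ s • s.2.1) = moment₀ s * gram s := by
        simp only [sub_dotProduct, dotProduct_sub, smul_dotProduct, dotProduct_smul, smul_eq_mul,
          dotProduct_comm (shear s *ᵥ s.2.1) s.2.1, ← moment₀.eq_1, ← moment₁.eq_1, ← moment₂.eq_1]
        rw [gram]
        ring
      rw [h, mul_zero] at h1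
      have h2 := congrFun (dotProduct_self_eq_zero.1 h1) a
      have h3 : moment₀ s * ∑ b, s.1 a b * s.2.1 b - moment₁ s * s.2.1 a = 0 := h2
      field_simp
      linarith
  · rintro ⟨c, hc⟩
    have h1 : shear s *ᵥ s.2.1 = c • s.2.1 := funext hc
    rw [gram, moment₂, moment₁, h1]
    simp only [smul_dotProduct, dotProduct_smul, smul_eq_mul, ← moment₀.eq_1]
    ring

lemma spatialStates_of_gram_ne_zero {s : State} (hs : s ∈ stateSpace) (hD : gram s ≠ 0) :
    s ∈ spatialStates := by
  refine ⟨hs, ?_⟩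
  by_contra hW
  have hV : s.2.1 = 0 := funext fun a => (mul_eq_zero.1 (hs.2.2.1 a)).resolve_left hW
  simp [gram, moment₀, moment₁, hV] at hD

lemma rotatingStates_eq : rotatingStates = {s | gram s ≠ 0} ∩ spatialStates := by
  ext s
  constructor
  · rintro ⟨hs, h⟩
    exact ⟨fun h0 => h (gram_eq_zero_iff.1 h0), hs⟩
  · rintro ⟨h, hs⟩
    exact ⟨hs, fun h0 => h (gram_eq_zero_iff.2 h0)⟩

lemma edgeStates_subset {s : State} (hs : s ∈ edgeStates) :
    s ∈ rotatingStates ∧ s.2.2.2 = 0 := by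
  constructor
  · rw [edgeStates_eq] at hs
    have hD : gram s ≠ 0 := gram_ne_zero_of_lyapunov_pos (by rw [hs.2]; positivity)
    rw [rotatingStates_eq]
    exact ⟨hD, spatialStates_of_gram_ne_zero hs.1 hD⟩
  · obtain ⟨t, ht, E, hE, rfl⟩ := hs
    simp [state, edgeDensity]

/-! ### Evolution of the normalized state -/

/-- The deceleration parameter of a state. -/
def deceleration (γ : ℝ) (s : State) : ℝ := 2 - 2 * moment₀ s - 3 / 2 * (2 - γ) * s.2.2.2

/-- The evolution equations of the Hubble parameter `H` and of the normalized state `s`, in a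
parallel frame. -/
structure Evolves (γ : ℝ) (s : ℝ → State) (H : ℝ → ℝ) (t : ℝ) : Prop where
  mem : s t ∈ stateSpace
  pos : 0 < H t
  continuousAt : ContinuousAt s t
  deriv_hubble : HasDerivAt H (-(1 + deceleration γ (s t)) * H t ^ 2) t
  deriv_shear : HasMatDerivAt (fun τ => shear (s τ)) (H t • ((deceleration γ (s t) - 2) • shear (s t) +
    (6 : ℝ) • vecMulVec (s t).2.1 (s t).2.1 -
    (2 * moment₀ (s t)) • (1 : Matrix (Fin 3) (Fin 3) ℝ))) t
  deriv_spatial : ∀ a, HasDerivAt (fun τ => (s τ).2.1 a)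
    ((H t • (deceleration γ (s t) • (s t).2.1 - shear (s t) *ᵥ (s t).2.1)) a) t

/-- Quotient rule with `H = tr θ / 3`; all equations become homogeneous in `H`. For `W` and `Ω`
continuity suffices, since their derivatives never enter the rates used below. -/
lemma IsFrameSol.evolves {γ : ℝ} {I : Set ℝ} {C E θ : ℝ → Matrix (Fin 3) (Fin 3) ℝ}
    {v : ℝ → Fin 3 → ℝ} {w ρ : ℝ → ℝ} {t : ℝ} (H : IsFrameSol γ I C E θ v w ρ) (ht : t ∈ I)
    (hc : FrameConstraints (C t) (E t) (θ t) (v t) (w t) (ρ t)) (hpos : 0 < (θ t).trace) :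
    Evolves γ (fun t => frameState (θ t) (v t) (w t) (ρ t)) (fun t => (θ t).trace / 3) t := by
  have h6 : √6 ^ 2 = 6 := Real.sq_sqrt (by norm_num)
  have h60 : √6 ≠ 0 := by positivity
  set τ := (θ t).trace with hτ
  have hτ0 : τ ≠ 0 := hpos.ne'
  have hH := (H.deriv_trace ht).div_const 3
  have hm : moment₀ (frameState (θ t) (v t) (w t) (ρ t)) = 3 / 2 * (v t ⬝ᵥ v t) / τ ^ 2 := by
    simp only [moment₀, frameState, dotProduct, ← hτ]
    rw [Finset.mul_sum, Finset.sum_div]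
    refine Finset.sum_congr rfl fun a _ => ?_
    field_simp
    rw [h6]
    ring
  have hq : deceleration γ (frameState (θ t) (v t) (w t) (ρ t)) =
      2 - 3 * (v t ⬝ᵥ v t) / τ ^ 2 - 9 / 2 * (2 - γ) * ρ t / τ ^ 2 := by
    rw [deceleration, hm]
    simp only [frameState, ← hτ]
    field_simp
    ring
  have hS : HasMatDerivAt (fun r => shear (frameState (θ r) (v r) (w r) (ρ r)))
      ((τ / 3) • ((deceleration γ (frameState (θ t) (v t) (w t) (ρ t)) - 2) •
        shear (frameState (θ t) (v t) (w t) (ρ t)) + (6 : ℝ) •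
        vecMulVec (frameState (θ t) (v t) (w t) (ρ t)).2.1 (frameState (θ t) (v t) (w t) (ρ t)).2.1 -
        (2 * moment₀ (frameState (θ t) (v t) (w t) (ρ t))) • (1 : Matrix (Fin 3) (Fin 3) ℝ))) t := by
    intro a b
    have := (((H.deriv_expansion t ht a b).sub
      (hH.mul_const ((1 : Matrix (Fin 3) (Fin 3) ℝ) a b))).div hH
      (div_ne_zero hτ0 three_ne_zero))
    refine this.congr_deriv ?_
    rw [hq, hm]
    simp only [shear, frameState, mixedRate, Matrix.add_apply, Matrix.sub_apply, Matrix.smul_apply,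
      Matrix.neg_apply, vecMulVec_apply, Matrix.one_mulVec, Matrix.of_apply, smul_eq_mul,
      Pi.sub_apply, ← hτ]
    field_simp
    rw [h6]
    ring
  have hV : ∀ a, HasDerivAt (fun r => (frameState (θ r) (v r) (w r) (ρ r)).2.1 a)
      (((τ / 3) • (deceleration γ (frameState (θ t) (v t) (w t) (ρ t)) •
        (frameState (θ t) (v t) (w t) (ρ t)).2.1 - shear (frameState (θ t) (v t) (w t) (ρ t)) *ᵥ
          (frameState (θ t) (v t) (w t) (ρ t)).2.1)) a) t := fun a => by
    have hSV : shear (frameState (θ t) (v t) (w t) (ρ t)) *ᵥ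
        (frameState (θ t) (v t) (w t) (ρ t)).2.1 =
        (9 / (√6 * τ ^ 2)) • (θ t *ᵥ v t) - (3 / (√6 * τ)) • v t := by
      have e1 : shear (frameState (θ t) (v t) (w t) (ρ t)) =
          (3 / τ) • (θ t - (τ / 3) • (1 : Matrix (Fin 3) (Fin 3) ℝ)) := by
        ext i j
        simp only [shear, frameState, ← hτ, Matrix.of_apply, Matrix.smul_apply, smul_eq_mul]
        field_simp
      have e2 : (frameState (θ t) (v t) (w t) (ρ t)).2.1 = (3 / (√6 * τ)) • v t := by
        funext i
        simp only [frameState, ← hτ, Pi.smul_apply, smul_eq_mul]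
        field_simp
      rw [e1, e2, Matrix.smul_mulVec, Matrix.mulVec_smul, Matrix.sub_mulVec, Matrix.smul_mulVec,
        Matrix.one_mulVec]
      funext i
      simp only [Pi.smul_apply, Pi.sub_apply, smul_eq_mul]
      field_simp
      ring
    have := (H.deriv_spatial t ht a).div (hH.const_mul √6)
      (mul_ne_zero h60 (div_ne_zero hτ0 three_ne_zero))
    refine this.congr_deriv ?_
    rw [hSV, hq]
    simp only [frameState, Pi.smul_apply, Pi.sub_apply, smul_eq_mul, ← hτ]
    field_simp
    ring
  refine ⟨hc.frameState_mem hpos, by positivity, ?_, ?_, hS, hV⟩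
  · refine ContinuousAt.prodMk (continuousAt_pi.2 fun a => continuousAt_pi.2 fun b =>
      (hS a b).continuousAt) (ContinuousAt.prodMk (continuousAt_pi.2 fun a => (hV a).continuousAt)
      (ContinuousAt.prodMk ?_ ?_))
    · exact (H.deriv_temporal t ht).continuousAt.div (hH.continuousAt.const_mul _)
        (mul_ne_zero h60 (div_ne_zero hτ0 three_ne_zero))
    · exact (H.deriv_density t ht).continuousAt.div ((hH.continuousAt.pow 2).const_mul _)
        (mul_ne_zero three_ne_zero (pow_ne_zero 2 (div_ne_zero hτ0 three_ne_zero)))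
  · refine hH.congr_deriv ?_
    rw [hq]
    simp only [← hτ]
    field_simp
    ring

/-- To the future of a given time, an orbit is described by the evolution equations of the
normalized state. -/
theorem IsOrbit.exists_evolves {γ : ℝ} (hγ : γ ∈ Icc (2 / 3 : ℝ) 2) {a : ℝ}
    {h : ℝ → Matrix (Fin 3) (Fin 3) ℝ} {J : ℝ → Fin 4 → ℝ} {ρ : ℝ → ℝ}
    {E : ℝ → Matrix (Fin 3) (Fin 3) ℝ} (H : IsOrbit γ (Ioi a) h J ρ E) {t₁ : ℝ} (ht₁ : a < t₁) :
    ∃ s η, ∀ t ≥ t₁, Evolves γ s η t ∧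
      ∃ R : Matrix (Fin 3) (Fin 3) ℝ, Rᵀ * R = 1 ∧ state h J ρ (E t) t = rotate R (s t) := by
  obtain ⟨a', ha', C, F, θ, v, w, r, hsol, hc, hpos, -, hagree⟩ :=
    H.exists_isFrameSol hγ isOpen_Ioi ordConnected_Ioi ht₁
  refine ⟨_, _, fun t ht => ⟨hsol.evolves (ha'.trans_le ht) (hc t (ha'.trans_le ht))
    (hpos t (ha'.trans_le ht)), ?_⟩⟩
  have hta : a < t := ht₁.trans_le ht
  have hta' : a' < t := ha'.trans_le ht
  have hF := IsFrameSol.isFrame (hc t hta')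
  have hE : IsFrame (frameMetric C t) (E t) := (hagree t hta hta').1 ▸ H.frame t hta
  obtain ⟨R, hR, hER⟩ := hF.exists_rotation hE
  refine ⟨R, hR, ?_⟩
  rw [hER, state_rotate]
  congr 1
  rw [state_congr (h' := frameMetric C) (Filter.mem_of_superset
    (inter_mem (Ioi_mem_nhds hta) (Ioi_mem_nhds hta')) fun τ hτ => (hagree τ hτ.1 hτ.2).1)
    (hagree t hta hta').2.1 (hagree t hta hta').2.2, (hsol.isReduced hc).state_eq hta' hF]
  have h1 : (F t)⁻¹ = C t := Matrix.inv_eq_right_inv (hc t hta').dual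
  have h2 : spatial (frameForm C v w) t = v t ᵥ* C t := rfl
  have h3 : (F t)⁻¹ * (F t * θ t * C t) * F t = θ t := by
    rw [h1]
    simp only [Matrix.mul_assoc]
    rw [(hc t hta').dual', Matrix.mul_one, ← Matrix.mul_assoc, (hc t hta').dual', Matrix.one_mul]
  rw [h2, Matrix.vecMul_vecMul, (hc t hta').dual', Matrix.vecMul_one]
  exact congrArg (fun X => frameState X (v t) (w t) (r t)) h3

/-! ### Evolution of the rotation invariants -/

/-- The moment `V · Σ⁴ V`, for symmetric `Σ`. -/
def moment₄ (s : State) : ℝ :=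
  (shear s *ᵥ (shear s *ᵥ s.2.1)) ⬝ᵥ (shear s *ᵥ (shear s *ᵥ s.2.1))

section Moments

variable {γ : ℝ} {s : ℝ → State} {H : ℝ → ℝ} {t : ℝ}

lemma dotProduct_shear_mulVec {s : State} (hs : s ∈ stateSpace) (x y : Fin 3 → ℝ) :
    x ⬝ᵥ (shear s *ᵥ y) = (shear s *ᵥ x) ⬝ᵥ y := by
  have hsS : (shear s)ᵀ = shear s := by ext a b; exact hs.1 b a
  rw [Matrix.dotProduct_mulVec, ← Matrix.mulVec_transpose, hsS]

namespace Evolves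

lemma deriv_shear_mulVec (D : Evolves γ s H t) {x : ℝ → Fin 3 → ℝ} {x' : Fin 3 → ℝ}
    (hx : ∀ a, HasDerivAt (fun τ => x τ a) ((H t • x') a) t) (a : Fin 3) :
    HasDerivAt (fun τ => (shear (s τ) *ᵥ x τ) a)
      ((H t • ((deceleration γ (s t) - 2) • (shear (s t) *ᵥ x t) +
        (6 * ((s t).2.1 ⬝ᵥ x t)) • (s t).2.1 - (2 * moment₀ (s t)) • x t + shear (s t) *ᵥ x')) a) t := by
  refine (D.deriv_shear.mulVec hx a).congr_deriv (congrFun ?_ a)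
  rw [Matrix.smul_mulVec, Matrix.sub_mulVec, Matrix.add_mulVec, Matrix.smul_mulVec,
    Matrix.smul_mulVec, Matrix.smul_mulVec, Matrix.one_mulVec, Matrix.mulVec_smul, smul_add,
    Matrix.vecMulVec_mulVec]
  congr 4
  ext i
  simp
  ring

/-- The source `6 V ⊗ V` contributes a multiple of `V`, so the vectors `V, ΣV, Σ²V, ...` evolve
among themselves, each coupled to the next one. The moments inherit this hierarchy. -/
lemma deriv_first (D : Evolves γ s H t) (a : Fin 3) :
    HasDerivAt (fun τ => (shear (s τ) *ᵥ (s τ).2.1) a)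
      ((H t • ((2 * deceleration γ (s t) - 2) • (shear (s t) *ᵥ (s t).2.1) +
        (4 * moment₀ (s t)) • (s t).2.1 - shear (s t) *ᵥ (shear (s t) *ᵥ (s t).2.1))) a) t := by
  refine (D.deriv_shear_mulVec D.deriv_spatial a).congr_deriv (congrFun ?_ a)
  rw [Matrix.mulVec_sub, Matrix.mulVec_smul, ← moment₀.eq_1]
  module

lemma deriv_second (D : Evolves γ s H t) (a : Fin 3) :
    HasDerivAt (fun τ => (shear (s τ) *ᵥ (shear (s τ) *ᵥ (s τ).2.1)) a)
      ((H t • ((3 * deceleration γ (s t) - 4) • (shear (s t) *ᵥ (shear (s t) *ᵥ (s t).2.1)) +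
        (6 * moment₁ (s t)) • (s t).2.1 + (2 * moment₀ (s t)) • (shear (s t) *ᵥ (s t).2.1) -
        shear (s t) *ᵥ (shear (s t) *ᵥ (shear (s t) *ᵥ (s t).2.1)))) a) t := by
  refine (D.deriv_shear_mulVec D.deriv_first a).congr_deriv (congrFun ?_ a)
  rw [Matrix.mulVec_sub, Matrix.mulVec_add, Matrix.mulVec_smul, Matrix.mulVec_smul, ← moment₁.eq_1]
  module

lemma deriv_moment₀ (D : Evolves γ s H t) : HasDerivAt (fun τ => moment₀ (s τ))
    (H t * (2 * deceleration γ (s t) * moment₀ (s t) - 2 * moment₁ (s t))) t := by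
  refine (hasDerivAt_dotProduct D.deriv_spatial D.deriv_spatial).congr_deriv ?_
  simp only [smul_dotProduct, dotProduct_smul, sub_dotProduct, dotProduct_sub, smul_eq_mul,
    dotProduct_comm (shear (s t) *ᵥ (s t).2.1) (s t).2.1, ← moment₀.eq_1, ← moment₁.eq_1]
  ring

lemma deriv_moment₁ (D : Evolves γ s H t) : HasDerivAt (fun τ => moment₁ (s τ))
    (H t * ((3 * deceleration γ (s t) - 2) * moment₁ (s t) - 2 * moment₂ (s t) +
      4 * moment₀ (s t) ^ 2)) t := by
  refine (hasDerivAt_dotProduct D.deriv_spatial D.deriv_first).congr_deriv ?_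
  simp only [smul_dotProduct, dotProduct_smul, sub_dotProduct, dotProduct_sub,
    dotProduct_add, smul_eq_mul, dotProduct_shear_mulVec D.mem (s t).2.1 (shear (s t) *ᵥ (s t).2.1),
    ← moment₀.eq_1, ← moment₁.eq_1, ← moment₂.eq_1]
  ring

lemma deriv_moment₂ (D : Evolves γ s H t) : HasDerivAt (fun τ => moment₂ (s τ))
    (H t * ((4 * deceleration γ (s t) - 4) * moment₂ (s t) - 2 * moment₃ (s t) +
      8 * moment₀ (s t) * moment₁ (s t))) t := by
  refine (hasDerivAt_dotProduct D.deriv_first D.deriv_first).congr_deriv ?_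
  simp only [smul_dotProduct, dotProduct_smul, sub_dotProduct, dotProduct_sub, add_dotProduct,
    dotProduct_add, smul_eq_mul, dotProduct_comm (shear (s t) *ᵥ (s t).2.1) (s t).2.1,
    dotProduct_comm (shear (s t) *ᵥ (shear (s t) *ᵥ (s t).2.1)) (shear (s t) *ᵥ (s t).2.1),
    ← moment₁.eq_1, ← moment₂.eq_1, ← moment₃.eq_1]
  ring

lemma deriv_moment₃ (D : Evolves γ s H t) : HasDerivAt (fun τ => moment₃ (s τ))
    (H t * ((5 * deceleration γ (s t) - 6) * moment₃ (s t) - 2 * moment₄ (s t) +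
      6 * moment₀ (s t) * moment₂ (s t) + 6 * moment₁ (s t) ^ 2)) t := by
  refine (hasDerivAt_dotProduct D.deriv_first D.deriv_second).congr_deriv ?_
  simp only [smul_dotProduct, dotProduct_smul, sub_dotProduct, dotProduct_sub, add_dotProduct,
    dotProduct_add, smul_eq_mul, dotProduct_comm (shear (s t) *ᵥ (s t).2.1) (s t).2.1,
    dotProduct_shear_mulVec D.mem (s t).2.1 (shear (s t) *ᵥ (s t).2.1),
    dotProduct_shear_mulVec D.mem (shear (s t) *ᵥ (s t).2.1)
      (shear (s t) *ᵥ (shear (s t) *ᵥ (s t).2.1)),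
    ← moment₁.eq_1, ← moment₂.eq_1, ← moment₃.eq_1, ← moment₄.eq_1]
  ring

end Evolves

end Moments

/-! ### Monotonicity -/

/-- The component `Σ_11` in the frame adapted to `V` and `Σ V`. -/
def axial (s : State) : ℝ := moment₁ s / moment₀ s

/-- The component `Σ_12²` in the frame adapted to `V` and `Σ V`. -/
def tilt (s : State) : ℝ := gram s / moment₀ s ^ 2

/-- The component `Σ_11 + Σ_22` in the frame adapted to `V` and `Σ V`. -/
def planar (s : State) : ℝ := (moment₀ s * moment₃ s - moment₁ s * moment₂ s) / gram s

lemma linFactor_eq (s : State) : linFactor s = 6 - axial s - planar s := rfl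

lemma lyapunov_eq (s : State) (h : moment₀ s ≠ 0) :
    lyapunov s = moment₀ s ^ 3 * tilt s / (6 - axial s - planar s) ^ 8 := by
  rw [lyapunov, linFactor_eq, tilt]
  congr 1
  field_simp

section Tridiagonal

variable {A Y b k v Ω : ℝ}

lemma moment₄_tri : moment₄ (triState A Y b k v Ω) =
    v ^ 2 * ((A ^ 2 + Y ^ 2) ^ 2 + Y ^ 2 * (A + b) ^ 2 + Y ^ 2 * k ^ 2) := by
  simp [moment₄, shear, triState, dotProduct, Matrix.mulVec, Fin.sum_univ_three]
  ring

lemma moment₄_rotate {R : Matrix (Fin 3) (Fin 3) ℝ} (hR : Rᵀ * R = 1) (s : State) :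
    moment₄ (rotate R s) = moment₄ s := by
  rw [moment₄, show (rotate R s).2.1 = s.2.1 ᵥ* R from rfl, rotate_mulVec hR, rotate_mulVec hR,
    vecMul_dotProduct_vecMul hR, moment₄]

end Tridiagonal

/-- The parameters `A Y b k v` are those of a tridiagonal form of the state `s`. -/
structure HasTri (s : State) (A Y b k v : ℝ) : Prop where
  spatial_pos : 0 < v
  tilt_pos : 0 < Y
  density_nonneg : 0 ≤ s.2.2.2
  friedmann : (A ^ 2 + A * b + b ^ 2 + Y ^ 2 + k ^ 2) / 3 + v ^ 2 + s.2.2.2 = 1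
  moment₀_eq : moment₀ s = v ^ 2
  moment₁_eq : moment₁ s = v ^ 2 * A
  moment₂_eq : moment₂ s = v ^ 2 * (A ^ 2 + Y ^ 2)
  moment₃_eq : moment₃ s = v ^ 2 * (A ^ 3 + 2 * A * Y ^ 2 + b * Y ^ 2)
  moment₄_eq : moment₄ s = v ^ 2 * ((A ^ 2 + Y ^ 2) ^ 2 + Y ^ 2 * (A + b) ^ 2 + Y ^ 2 * k ^ 2)

lemma exists_hasTri {s : State} (hs : s ∈ stateSpace) (hD : gram s ≠ 0) :
    ∃ A Y b k v, HasTri s A Y b k v := by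
  obtain ⟨R, hR, A, Y, b, k, v, Ω, hv, hY, hΩ, hcon, htri⟩ := exists_rotate_eq_triState hs hD
  have hΩs : s.2.2.2 = Ω := congrArg (fun s : State => s.2.2.2) htri
  refine ⟨A, Y, b, k, v, hv, hY, by rwa [hΩs], by rwa [hΩs], ?_, ?_, ?_, ?_, ?_⟩
  · rw [← moment₀_rotate hR, htri, moment₀_tri]
  · rw [← moment₁_rotate hR, htri, moment₁_tri]
  · rw [← moment₂_rotate hR, htri, moment₂_tri]
  · rw [← moment₃_rotate hR, htri, moment₃_tri]
  · rw [← moment₄_rotate hR, htri, moment₄_tri]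

namespace HasTri

variable {s : State} {A Y b k v : ℝ}

lemma gram_eq (T : HasTri s A Y b k v) : gram s = v ^ 4 * Y ^ 2 := by
  rw [gram, T.moment₀_eq, T.moment₁_eq, T.moment₂_eq]; ring

lemma axial_eq (T : HasTri s A Y b k v) : axial s = A := by
  have := T.spatial_pos
  rw [axial, T.moment₀_eq, T.moment₁_eq]; field_simp

lemma tilt_eq (T : HasTri s A Y b k v) : tilt s = Y ^ 2 := by
  have := T.spatial_pos
  rw [tilt, T.gram_eq, T.moment₀_eq]; field_simp

lemma planar_eq (T : HasTri s A Y b k v) : planar s = A + b := by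
  have := T.spatial_pos
  have := T.tilt_pos
  rw [planar, T.gram_eq, T.moment₀_eq, T.moment₁_eq, T.moment₂_eq, T.moment₃_eq]; field_simp; ring

lemma two_le (T : HasTri s A Y b k v) : 2 ≤ 6 - 2 * A - b := by
  have := T.density_nonneg
  exact two_le_factor (r := (Y ^ 2 + k ^ 2) / 3 + v ^ 2 + s.2.2.2) (by positivity)
    (by linarith [T.friedmann])

lemma lyapunov_eq (T : HasTri s A Y b k v) :
    lyapunov s = (v ^ 2) ^ 3 * Y ^ 2 / (6 - 2 * A - b) ^ 8 := by
  rw [BianchiI.lyapunov_eq s (by rw [T.moment₀_eq]; exact (pow_pos T.spatial_pos 2).ne'),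
    T.moment₀_eq, T.tilt_eq, T.axial_eq, T.planar_eq]
  ring

end HasTri

namespace Evolves

variable {γ : ℝ} {s : ℝ → State} {H : ℝ → ℝ} {t A Y b k v : ℝ}

/-- The components in the adapted frame are rational functions of the moments. Differentiating these
avoids differentiating the adapted frame, which is chosen separately at each time. -/
lemma deriv_axial (D : Evolves γ s H t) (T : HasTri (s t) A Y b k v) :
    HasDerivAt (fun τ => axial (s τ))
      (H t * ((deceleration γ (s t) - 2) * A + 4 * v ^ 2 - 2 * Y ^ 2)) t := by
  have hv := T.spatial_pos
  refine (D.deriv_moment₁.div D.deriv_moment₀ (by rw [T.moment₀_eq]; positivity)).congr_deriv ?_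
  rw [T.moment₀_eq, T.moment₁_eq, T.moment₂_eq]
  field_simp
  ring

lemma deriv_gram (D : Evolves γ s H t) : HasDerivAt (fun τ => gram (s τ))
    (H t * (2 * deceleration γ (s t) * moment₀ (s t) - 2 * moment₁ (s t)) * moment₂ (s t) +
      moment₀ (s t) * (H t * ((4 * deceleration γ (s t) - 4) * moment₂ (s t) - 2 * moment₃ (s t) +
      8 * moment₀ (s t) * moment₁ (s t))) - 2 * moment₁ (s t) * (H t * ((3 * deceleration γ (s t) - 2) *
      moment₁ (s t) - 2 * moment₂ (s t) + 4 * moment₀ (s t) ^ 2))) t := by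
  refine ((D.deriv_moment₀.mul D.deriv_moment₂).sub (D.deriv_moment₁.pow 2)).congr_deriv ?_
  simp

lemma deriv_tilt (D : Evolves γ s H t) (T : HasTri (s t) A Y b k v) :
    HasDerivAt (fun τ => tilt (s τ))
      (H t * (2 * Y ^ 2 * (deceleration γ (s t) - 2 + A - b))) t := by
  have hv := T.spatial_pos
  have hm : moment₀ (s t) ≠ 0 := by rw [T.moment₀_eq]; positivity
  refine (D.deriv_gram.div (D.deriv_moment₀.pow 2)
    (pow_ne_zero 2 hm)).congr_deriv ?_
  simp only [Nat.cast_ofNat, Nat.add_one_sub_one, pow_one, Pi.pow_apply]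
  rw [T.gram_eq, T.moment₀_eq, T.moment₁_eq, T.moment₂_eq, T.moment₃_eq]
  field_simp
  ring

/-- Here the fourth moment enters, and through it the entry `k`, which is not visible in the lower
moments. -/
lemma deriv_planar (D : Evolves γ s H t) (T : HasTri (s t) A Y b k v) :
    HasDerivAt (fun τ => planar (s τ))
      (H t * ((deceleration γ (s t) - 2) * (A + b) + 2 * v ^ 2 - 2 * k ^ 2)) t := by
  have hv := T.spatial_pos
  have hY := T.tilt_pos
  refine (((D.deriv_moment₀.mul D.deriv_moment₃).sub (D.deriv_moment₁.mul D.deriv_moment₂)).div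
    D.deriv_gram (by rw [T.gram_eq]; positivity)).congr_deriv ?_
  simp only [Pi.mul_apply, Pi.sub_apply]
  rw [T.gram_eq, T.moment₀_eq, T.moment₁_eq, T.moment₂_eq, T.moment₃_eq, T.moment₄_eq]
  field_simp
  ring

/-- The rate of change of the monotone function. -/
lemma deriv_lyapunov (D : Evolves γ s H t) (T : HasTri (s t) A Y b k v) :
    HasDerivAt (fun τ => lyapunov (s τ)) (lyapunov (s t) *
      (2 * H t * (growth A b + 12 * (3 * γ - 4) * (s t).2.2.2) / (6 - 2 * A - b))) t := by
  have hv := T.spatial_pos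
  have hY := T.tilt_pos
  have hf := T.two_le
  have hf0 : 6 - 2 * A - b ≠ 0 := by positivity
  have hm : moment₀ (s t) ≠ 0 := by rw [T.moment₀_eq]; positivity
  have e : (fun τ => lyapunov (s τ)) =ᶠ[𝓝 t] fun τ =>
      moment₀ (s τ) ^ 3 * tilt (s τ) / (6 - axial (s τ) - planar (s τ)) ^ 8 := by
    filter_upwards [D.deriv_moment₀.continuousAt.eventually_ne hm] with τ hτ
    exact lyapunov_eq _ hτ
  have hf' : 6 - axial (s t) - planar (s t) = 6 - 2 * A - b := by
    rw [T.axial_eq, T.planar_eq]; ring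
  have d := ((D.deriv_moment₀.pow 3).mul (D.deriv_tilt T)).div
    ((((D.deriv_axial T).const_sub 6).sub (D.deriv_planar T)).pow 8)
    (pow_ne_zero 8 (by rw [Pi.sub_apply, hf']; exact hf0))
  refine (d.congr_of_eventuallyEq e).congr_deriv ?_
  simp only [Pi.mul_apply, Pi.sub_apply, Pi.pow_apply, hf', Nat.cast_ofNat]
  rw [T.lyapunov_eq, T.moment₀_eq, T.moment₁_eq, T.tilt_eq]
  have hq : deceleration γ (s t) = 2 - 2 * v ^ 2 - 3 / 2 * (2 - γ) * (s t).2.2.2 := by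
    rw [deceleration, T.moment₀_eq]
  -- Up to the factor `6 - 2A - b`, the left side is the logarithmic derivative relative to `H`. The
  -- exponent `8 = 6 + 2` makes the coefficient of `q` the constant `48`; the Friedmann constraint
  -- with multiplier `-48` then eliminates `k²`, `Y²` and `v²`.
  have key : (6 * (deceleration γ (s t) - A) + 2 * (deceleration γ (s t) - 2 + A - b)) *
      (6 - 2 * A - b) + 8 * ((deceleration γ (s t) - 2) * (2 * A + b) + 6 * v ^ 2 - 2 * Y ^ 2 -
        2 * k ^ 2) = 2 * (growth A b + 12 * (3 * γ - 4) * (s t).2.2.2) := by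
    rw [hq, growth]
    linear_combination (-48) * T.friedmann
  generalize 6 - 2 * A - b = f at key hf0 ⊢
  field_simp
  linear_combination v ^ 4 * H t * f ^ 7 * key

end Evolves

/-- A function that does not decrease as long as it is positive does not decrease. -/
lemma le_of_hasDerivAt_nonneg_of_pos {f f' : ℝ → ℝ} {a : ℝ} (hf : ContinuousOn f (Ici a))
    (ha : 0 < f a) (hd : ∀ t ≥ a, 0 < f t → HasDerivAt f (f' t) t ∧ 0 ≤ f' t) {b : ℝ} (hab : a ≤ b) :
    f a ≤ f b := by
  have hfab : ContinuousOn f (Icc a b) := hf.mono Icc_subset_Ici_self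
  have hcl : IsClosed ({t | f a ≤ f t} ∩ Icc a b) := by
    rw [inter_comm]
    exact hfab.preimage_isClosed_of_isClosed isClosed_Icc isClosed_Ici
  refine hcl.Icc_subset_of_forall_mem_nhdsWithin (by simp) ?_ (right_mem_Icc.2 hab)
  rintro x ⟨hx, hxab⟩
  have hx0 : 0 < f x := ha.trans_le hx
  have hxa : a ≤ x := hxab.1
  have hev : ∀ᶠ y in 𝓝 x, 0 < f y := (hd x hxa hx0).1.continuousAt.eventually (lt_mem_nhds hx0)
  obtain ⟨u, hu, hpos⟩ := (mem_nhdsGE_iff_exists_Ico_subset (a := x)).1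
    (mem_nhdsWithin_of_mem_nhds hev)
  refine mem_of_superset (Ioo_mem_nhdsGT hu) fun y hy => ?_
  have hsub : ∀ τ ∈ Icc x y, a ≤ τ ∧ 0 < f τ := fun τ hτ =>
    ⟨hxa.trans hτ.1, hpos ⟨hτ.1, hτ.2.trans_lt hy.2⟩⟩
  have hmono : MonotoneOn f (Icc x y) := monotoneOn_of_hasDerivWithinAt_nonneg (convex_Icc x y)
    (hf.mono fun τ hτ => (hsub τ hτ).1)
    (fun τ hτ => (hd τ (hsub τ (interior_subset hτ)).1
      (hsub τ (interior_subset hτ)).2).1.hasDerivWithinAt)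
    (fun τ hτ => (hd τ (hsub τ (interior_subset hτ)).1 (hsub τ (interior_subset hτ)).2).2)
  exact le_trans hx (hmono (left_mem_Icc.2 hy.1.le) (right_mem_Icc.2 hy.1.le) hy.1.le)

/-- On a compact set, a function that is positive where `Q ≥ 0` vanishes becomes uniformly positive
after addition of a multiple of `Q`. -/
lemma exists_pos_le_mul_add {X : Type*} [TopologicalSpace X] [T2Space X] {K : Set X} (hK : IsCompact K)
    {Q g : X → ℝ} (hQ : ContinuousOn Q K) (hg : ContinuousOn g K) (hQ0 : ∀ x ∈ K, 0 ≤ Q x)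
    (h : ∀ x ∈ K, Q x = 0 → 0 < g x) : ∃ N ≥ 0, ∃ c > 0, ∀ x ∈ K, c ≤ N * Q x + g x := by
  have hmain : ∃ N ≥ 0, ∀ x ∈ K, 0 < N * Q x + g x := by
    set L := K ∩ g ⁻¹' Iic 0
    have hL : IsCompact L := hK.of_isClosed_subset
      (hg.preimage_isClosed_of_isClosed hK.isClosed isClosed_Iic) inter_subset_left
    rcases L.eq_empty_or_nonempty with hL0 | hL0
    · refine ⟨0, le_rfl, fun x hx => ?_⟩
      rw [zero_mul, zero_add]
      by_contra! hc
      exact (hL0 ▸ (⟨hx, hc⟩ : x ∈ L) : x ∈ (∅ : Set X))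
    · obtain ⟨x₀, hx₀, hmin⟩ := hL.exists_isMinOn hL0 (hQ.mono inter_subset_left)
      obtain ⟨x₁, hx₁, hmin'⟩ := hL.exists_isMinOn hL0 (hg.mono inter_subset_left)
      have hx₁' : g x₁ ≤ 0 := hx₁.2
      have hpos : 0 < Q x₀ := lt_of_le_of_ne (hQ0 x₀ hx₀.1) fun h0 =>
        absurd (h x₀ hx₀.1 h0.symm) (not_lt.2 hx₀.2)
      -- On the compact set where `g ≤ 0`, `Q` is at least `Q x₀ > 0` and `g` at least `g x₁`, so
      -- this multiple of `Q` raises the sum to at least `1`.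
      refine ⟨(1 - g x₁) / Q x₀, by apply div_nonneg <;> linarith, fun x hx => ?_⟩
      by_cases hgx : g x ≤ 0
      · have h1 : Q x₀ ≤ Q x := hmin ⟨hx, hgx⟩
        have h2 : g x₁ ≤ g x := hmin' ⟨hx, hgx⟩
        have h3 : 1 - g x₁ ≤ (1 - g x₁) / Q x₀ * Q x := by
          rw [div_mul_eq_mul_div, le_div_iff₀ hpos]
          exact mul_le_mul_of_nonneg_left h1 (by linarith)
        linarith
      · have h1 : 0 ≤ (1 - g x₁) / Q x₀ * Q x :=
          mul_nonneg (by apply div_nonneg <;> linarith) (hQ0 x hx)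
        linarith
  obtain ⟨N, hN, hpos⟩ := hmain
  refine ⟨N, hN, ?_⟩
  rcases K.eq_empty_or_nonempty with hK0 | hK0
  · exact ⟨1, one_pos, fun x hx => absurd (hK0 ▸ hx : x ∈ (∅ : Set X)) (notMem_empty x)⟩
  · obtain ⟨x₀, hx₀, hmin⟩ := hK.exists_isMinOn hK0 ((hQ.const_smul N).add hg)
    exact ⟨N * Q x₀ + g x₀, hpos x₀ hx₀, fun x hx => hmin hx⟩

/-! ### Monotonicity, and strict growth away from the Edge -/

section Growth

variable {γ : ℝ} {s : ℝ → State} {H : ℝ → ℝ} {t₁ : ℝ}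

lemma continuousOn_lyapunov_comp (D : ∀ t ≥ t₁, Evolves γ s H t) :
    ContinuousOn (fun t => lyapunov (s t)) (Ici t₁) :=
  continuousOn_lyapunov.comp (fun t ht => (D t ht).continuousAt.continuousWithinAt)
    fun t ht => (D t ht).mem

/-- The monotone function does not decrease. -/
theorem lyapunov_mono (hγ : 4 / 3 ≤ γ) (D : ∀ t ≥ t₁, Evolves γ s H t) {t : ℝ} (ht : t₁ ≤ t) :
    lyapunov (s t₁) ≤ lyapunov (s t) := by
  rcases (lyapunov_nonneg (D t₁ le_rfl).mem).eq_or_lt with h0 | h0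
  · rw [← h0]
    exact lyapunov_nonneg (D t ht).mem
  refine le_of_hasDerivAt_nonneg_of_pos (f := fun t => lyapunov (s t))
    (f' := fun t => deriv (fun t => lyapunov (s t)) t) (continuousOn_lyapunov_comp D) h0
    (fun τ hτ hpos => ?_) ht
  have Dτ := D τ hτ
  obtain ⟨A, Y, b, k, v, T⟩ := exists_hasTri Dτ.mem (gram_ne_zero_of_lyapunov_pos hpos)
  have hd := Dτ.deriv_lyapunov T
  refine ⟨hd.differentiableAt.hasDerivAt, ?_⟩
  rw [hd.deriv]
  have h1 := T.two_le
  have h2 := growth_nonneg A b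
  have h3 : 0 ≤ 12 * (3 * γ - 4) * (s τ).2.2.2 := mul_nonneg (by linarith) T.density_nonneg
  have h4 := Dτ.pos
  positivity

/-- The rate of change, relative to the Hubble parameter, of the auxiliary function
`-(A + b) + (A - 1) (x - y) / 6`. -/
def auxRate (γ x y A b z Ω : ℝ) : ℝ :=
  -((-2 * x - 3 / 2 * (2 - γ) * Ω) * (A + b) + 2 * x - 2 * z) +
    (1 / 6) * (((-2 * x - 3 / 2 * (2 - γ) * Ω) * A + 4 * x - 2 * y) * (x - y) +
      (A - 1) * (2 * x * (2 - 2 * x - 3 / 2 * (2 - γ) * Ω - A) -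
        2 * y * (-2 * x - 3 / 2 * (2 - γ) * Ω + A - b)))

/-- At `A = 1`, `b = 0` the rate is a sum of nonnegative terms in `Ω`, `z` and `(x - y)²`. If all
vanish, the constraint gives `x = y = 1/2`, the Edge, which the bound below the maximum excludes;
there `6 - 2A - b = 4`. -/
lemma auxRate_pos {x y z Ω m : ℝ} (hγ : γ < 2) (hy : 0 ≤ y) (hz : 0 ≤ z) (hΩ : 0 ≤ Ω)
    (hcon : (1 + y + z) / 3 + x + Ω = 1) (hm : m < 1 / 2 ^ 20) (hlt : x ^ 3 * y ≤ m * 4 ^ 8) :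
    0 < auxRate γ x y 1 0 z Ω := by
  have e : auxRate γ x y 1 0 z Ω = 3 / 2 * (2 - γ) * Ω * (1 - (x - y) / 6) + 2 * z +
      (x - y) ^ 2 / 3 := by
    rw [auxRate]; ring
  have h1 : 0 ≤ 3 / 2 * (2 - γ) * Ω := mul_nonneg (by linarith) hΩ
  have h2 : 0 < 1 - (x - y) / 6 := by linarith
  have h3 : 0 ≤ 3 / 2 * (2 - γ) * Ω * (1 - (x - y) / 6) := mul_nonneg h1 h2.le
  rw [e]
  by_contra! hle
  have h4 := sq_nonneg (x - y)
  have hz0 : z = 0 := by linarith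
  have hd : (x - y) ^ 2 = 0 := by linarith
  have hd' : x - y = 0 := pow_eq_zero_iff two_ne_zero |>.1 hd
  have hΩ0 : Ω = 0 := by
    have h5 : 3 / 2 * (2 - γ) * Ω * (1 - (x - y) / 6) = 0 := by linarith
    have h6 := (mul_eq_zero.1 h5).resolve_right h2.ne'
    exact (mul_eq_zero.1 h6).resolve_left (by linarith)
  have hx' : x = 1 / 2 := by linarith
  have hy' : y = 1 / 2 := by linarith
  rw [hx', hy'] at hlt
  norm_num at hlt hm
  linarith

/-- Away from the maximum of the monotone function the auxiliary function grows. -/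
lemma exists_le_auxRate (hγ : γ ∈ Ico (4 / 3 : ℝ) 2) {m : ℝ} (hm : m < 1 / 2 ^ 20) :
    ∃ N ≥ 0, ∃ c > 0, ∀ (s : State) (A Y b k v : ℝ), HasTri s A Y b k v → lyapunov s ≤ m →
      c ≤ N * (growth A b + 12 * (3 * γ - 4) * s.2.2.2) +
        auxRate γ (v ^ 2) (Y ^ 2) A b (k ^ 2) s.2.2.2 := by
  have c1 : ∀ i j, Continuous fun s : State => s.1 i j := fun i j => by fun_prop
  have c2 : ∀ i, Continuous fun s : State => s.2.1 i := fun i => by fun_prop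
  have c4 : Continuous fun s : State => s.2.2.2 := by fun_prop
  -- Clearing the denominator in `lyapunov s ≤ m` gives a closed condition that makes sense also
  -- where `V` or the entry `(0, 1)` vanishes, so the set of tridiagonal states obeying it is
  -- compact.
  set P : Set State := stateSpace ∩ {s | s.1 0 2 = 0 ∧ s.2.1 1 = 0 ∧ s.2.1 2 = 0 ∧ s.2.2.1 = 0 ∧
    (s.2.1 0 ^ 2) ^ 3 * s.1 0 1 ^ 2 ≤ m * (6 - 2 * s.1 0 0 - s.1 1 1) ^ 8} with hP
  have hPc : IsCompact P := by
    refine isCompact_stateSpace.inter_right ?_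
    simp only [ofPred_and]
    refine (isClosed_eq (c1 0 2) continuous_const).inter ((isClosed_eq (c2 1) continuous_const).inter
      ((isClosed_eq (c2 2) continuous_const).inter ((isClosed_eq (by fun_prop)
        continuous_const).inter (isClosed_le ?_ ?_))))
    · exact (((c2 0).pow 2).pow 3).mul ((c1 0 1).pow 2)
    · exact continuous_const.mul (((continuous_const.sub (continuous_const.mul (c1 0 0))).sub
        (c1 1 1)).pow 8)
  have a1 := c1 0 0
  have a2 := c1 0 1
  have a3 := c1 1 1
  have a4 := c1 1 2
  have a5 := c2 0
  have hQc : Continuous fun s : State => growth (s.1 0 0) (s.1 1 1) + 12 * (3 * γ - 4) * s.2.2.2 := by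
    simp only [growth]
    fun_prop
  have hgc : Continuous fun s : State => auxRate γ (s.2.1 0 ^ 2) (s.1 0 1 ^ 2) (s.1 0 0) (s.1 1 1)
      (s.1 1 2 ^ 2) s.2.2.2 := by
    simp only [auxRate]
    fun_prop
  have hcon : ∀ s ∈ P, (s.1 0 0 ^ 2 + s.1 0 0 * s.1 1 1 + s.1 1 1 ^ 2 + s.1 0 1 ^ 2 +
      s.1 1 2 ^ 2) / 3 + s.2.1 0 ^ 2 + s.2.2.2 = 1 := by
    rintro s ⟨⟨hsym, htr, -, -, hfr⟩, h02, h1, h2, hW, -⟩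
    have h20 : s.1 2 0 = 0 := by rw [hsym, h02]
    rw [Fin.sum_univ_three] at htr
    have h22 : s.1 2 2 = -s.1 0 0 - s.1 1 1 := by linarith
    simp only [Fin.sum_univ_three, h02, h1, h2, hW, h20, h22, hsym 1 0, hsym 2 1] at hfr
    linarith
  have hΩ : ∀ s ∈ P, 0 ≤ s.2.2.2 := fun s hs => hs.1.2.2.2.1
  obtain ⟨N, hN, c, hc, hle⟩ := exists_pos_le_mul_add hPc hQc.continuousOn hgc.continuousOn
    (fun s hs => add_nonneg (growth_nonneg _ _) (mul_nonneg (by linarith [hγ.1]) (hΩ s hs)))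
    (fun s hs h0 => by
      have h1 := growth_nonneg (s.1 0 0) (s.1 1 1)
      have h2 : 0 ≤ 12 * (3 * γ - 4) * s.2.2.2 := mul_nonneg (by linarith [hγ.1]) (hΩ s hs)
      obtain ⟨hA, hb⟩ := growth_eq_zero (show growth (s.1 0 0) (s.1 1 1) = 0 by linarith)
      have hcon' := hcon s hs
      have hlt := hs.2.2.2.2.2
      rw [hA, hb] at hcon' hlt
      rw [hA, hb]
      refine auxRate_pos hγ.2 (by positivity) (by positivity) (hΩ s hs)
        (by linarith) hm ?_
      norm_num at hlt ⊢
      exact hlt)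
  refine ⟨N, hN, c, hc, fun s A Y b k v T hl => ?_⟩
  refine hle (triState A Y b k v s.2.2.2) ⟨⟨fun i j => ?_, ?_, fun i => ?_, T.density_nonneg, ?_⟩,
    rfl, rfl, rfl, rfl, ?_⟩
  · fin_cases i <;> fin_cases j <;> rfl
  · simp [triState, Fin.sum_univ_three]
  · simp [triState]
  · have := T.friedmann
    simp [triState, Fin.sum_univ_three]
    linarith
  · rw [T.lyapunov_eq, div_le_iff₀ (by have := T.two_le; positivity)] at hl
    exact hl

end Growth

/-! ### The monotone function reaches every level below its maximum -/

section Attraction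

variable {γ : ℝ} {s : ℝ → State} {H : ℝ → ℝ} {t₁ : ℝ}

/-- For `γ ≥ 4/3` the coefficient of `Ω` in `q` is at most `1`, and the Friedmann constraint gives
`m₀ + Ω ≤ 1`. Hence `1/H` grows at least as fast as `t`. -/
lemma Evolves.deceleration_nonneg (hγ : γ ∈ Ico (4 / 3 : ℝ) 2) {t : ℝ} (D : Evolves γ s H t) :
    0 ≤ deceleration γ (s t) := by
  obtain ⟨-, -, -, hΩ, hfr⟩ := D.mem
  have h1 : 0 ≤ ∑ a, ∑ b, (s t).1 a b ^ 2 := Finset.sum_nonneg fun a _ =>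
    Finset.sum_nonneg fun b _ => sq_nonneg _
  have h2 : ∑ a, (s t).2.1 a ^ 2 = moment₀ (s t) := by simp [moment₀, dotProduct, pow_two]
  rw [h2] at hfr
  have h3 : 3 / 2 * (2 - γ) * (s t).2.2.2 ≤ 1 * (s t).2.2.2 :=
    mul_le_mul_of_nonneg_right (by linarith [hγ.1]) hΩ
  rw [deceleration]
  nlinarith [sq_nonneg (s t).2.2.1]

lemma Evolves.deceleration_le (hγ : γ ∈ Ico (4 / 3 : ℝ) 2) {t : ℝ} (D : Evolves γ s H t) :
    deceleration γ (s t) ≤ 2 := by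
  have h1 := moment₀_nonneg (s t)
  have h2 : 0 ≤ 3 / 2 * (2 - γ) * (s t).2.2.2 := mul_nonneg (by linarith [hγ.2]) D.mem.2.2.2.1
  rw [deceleration]
  linarith

/-- The Hubble parameter decays at least as fast as `1 / t`. -/
lemma hubble_le (hγ : γ ∈ Ico (4 / 3 : ℝ) 2) (D : ∀ t ≥ t₁, Evolves γ s H t) {t : ℝ} (ht : t₁ < t) :
    H t ≤ (t - t₁)⁻¹ := by
  have hd : ∀ τ ∈ Icc t₁ t, HasDerivAt (fun τ => (H τ)⁻¹ - τ) (deceleration γ (s τ)) τ := by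
    intro τ hτ
    have Dτ := D τ hτ.1
    have hp := Dτ.pos
    refine ((Dτ.deriv_hubble.inv hp.ne').sub (hasDerivAt_id τ)).congr_deriv ?_
    field_simp
    ring
  have hmono : MonotoneOn (fun τ => (H τ)⁻¹ - τ) (Icc t₁ t) :=
    monotoneOn_of_hasDerivWithinAt_nonneg (convex_Icc t₁ t)
      (fun τ hτ => (hd τ hτ).continuousAt.continuousWithinAt)
      (fun τ hτ => (hd τ (interior_subset hτ)).hasDerivWithinAt)
      (fun τ hτ => (D τ (interior_subset hτ).1).deceleration_nonneg hγ)
  have h1 := hmono (left_mem_Icc.2 ht.le) (right_mem_Icc.2 ht.le) ht.le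
  simp only at h1
  have h2 : 0 < (H t₁)⁻¹ := inv_pos.2 (D t₁ le_rfl).pos
  rw [le_inv_comm₀ (D t ht.le).pos (by linarith)]
  linarith

/-- The function whose growth, as long as the monotone function stays away from its maximum,
excludes such a behavior. -/
def auxFunction (N c : ℝ) (s : State) (η : ℝ) : ℝ :=
  5 * N * Real.log (lyapunov s) - planar s + 1 / 6 * ((axial s - 1) * (moment₀ s - tilt s)) +
    c / 3 * Real.log η

/-- The logarithm of the monotone function is at most zero, and the Friedmann constraint bounds the
polynomial terms by `2 + 9/6 ≤ 4`. -/
lemma HasTri.auxFunction_le {s : State} {A Y b k v : ℝ} (T : HasTri s A Y b k v)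
    (hs : s ∈ stateSpace) {N : ℝ} (hN : 0 ≤ N) (c η : ℝ) :
    auxFunction N c s η ≤ 4 + c / 3 * Real.log η := by
  have hΩ := T.density_nonneg
  have hfr := T.friedmann
  have h1 : Real.log (lyapunov s) ≤ 0 := Real.log_nonpos (lyapunov_nonneg hs)
    ((lyapunov_le hs).trans (by norm_num))
  have h2 : 5 * N * Real.log (lyapunov s) ≤ 0 := mul_nonpos_of_nonneg_of_nonpos (by positivity) h1
  have hY2 := sq_nonneg Y
  have hv2 := sq_nonneg v
  have hk2 := sq_nonneg k
  have hAb : A ^ 2 + A * b + b ^ 2 ≤ 3 := by linarith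
  have hpos : 0 ≤ A ^ 2 + A * b + b ^ 2 := by nlinarith [sq_nonneg (A + b), sq_nonneg A, sq_nonneg b]
  have h3 : |A + b| ≤ 2 := abs_le_of_sq_le_sq (by nlinarith [sq_nonneg (A - b)]) (by norm_num)
  have h4 : |A| ≤ 2 := abs_le_of_sq_le_sq (by nlinarith [sq_nonneg (A + 2 * b)]) (by norm_num)
  have h5 : |A - 1| ≤ 3 := by rw [abs_le] at h4 ⊢; constructor <;> linarith
  have h6 : |v ^ 2 - Y ^ 2| ≤ 3 := by rw [abs_le]; constructor <;> linarith
  have h7 : (A - 1) * (v ^ 2 - Y ^ 2) ≤ 9 := by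
    refine (le_abs_self _).trans ?_
    rw [abs_mul]
    exact (mul_le_mul h5 h6 (abs_nonneg _) (by norm_num)).trans (by norm_num)
  rw [auxFunction, T.planar_eq, T.axial_eq, T.moment₀_eq, T.tilt_eq]
  linarith [(abs_le.1 h3).1]

/-- The term with `log η` contributes `-(c/3)(1 + q)`. It takes the place of the logarithmic time
variable: its divergence expresses that the integral of `H` is infinite. -/
lemma Evolves.deriv_auxFunction {t A Y b k v : ℝ} (D : Evolves γ s H t) (T : HasTri (s t) A Y b k v)
    (N c : ℝ) : HasDerivAt (fun τ => auxFunction N c (s τ) (H τ))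
      (H t * (10 * N * (growth A b + 12 * (3 * γ - 4) * (s t).2.2.2) / (6 - 2 * A - b) +
        auxRate γ (v ^ 2) (Y ^ 2) A b (k ^ 2) (s t).2.2.2 -
        c / 3 * (1 + deceleration γ (s t)))) t := by
  have hH := D.pos
  have hv := T.spatial_pos
  have hY := T.tilt_pos
  have hf := T.two_le
  have hl : 0 < lyapunov (s t) := by rw [T.lyapunov_eq]; positivity
  have hd := ((((D.deriv_lyapunov T).log hl.ne').const_mul (5 * N)).sub (D.deriv_planar T)).add
    ((((D.deriv_axial T).sub_const 1).mul (D.deriv_moment₀.sub (D.deriv_tilt T))).const_mul (1 / 6))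
  refine (hd.add ((D.deriv_hubble.log hH.ne').const_mul (c / 3))).congr_deriv ?_
  have hq : deceleration γ (s t) = 2 - 2 * v ^ 2 - 3 / 2 * (2 - γ) * (s t).2.2.2 := by
    rw [deceleration, T.moment₀_eq]
  simp only [Pi.sub_apply]
  rw [T.axial_eq, T.moment₀_eq, T.tilt_eq, T.moment₁_eq, mul_div_cancel_left₀ _ hl.ne', hq, auxRate]
  have hf0 : 6 - 2 * A - b ≠ 0 := by positivity
  field_simp
  ring

/-- The monotone function of a rotating cosmology tends to its maximum. -/
theorem exists_lt_lyapunov (hγ : γ ∈ Ico (4 / 3 : ℝ) 2) (D : ∀ t ≥ t₁, Evolves γ s H t)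
    (h0 : 0 < lyapunov (s t₁)) {m : ℝ} (hm : m < 1 / 2 ^ 20) : ∃ t ≥ t₁, m < lyapunov (s t) := by
  by_contra! hcon
  obtain ⟨N, hN, c, hc, hrate⟩ := exists_le_auxRate hγ hm
  have hpos : ∀ t ≥ t₁, 0 < lyapunov (s t) := fun t ht => h0.trans_le (lyapunov_mono hγ.1 D ht)
  have htri : ∀ t ≥ t₁, ∃ A Y b k v, HasTri (s t) A Y b k v := fun t ht =>
    exists_hasTri (D t ht).mem (gram_ne_zero_of_lyapunov_pos (hpos t ht))
  have hd : ∀ t ≥ t₁, ∃ d ≥ 0, HasDerivAt (fun τ => auxFunction N c (s τ) (H τ)) d t := by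
    intro t ht
    obtain ⟨A, Y, b, k, v, T⟩ := htri t ht
    refine ⟨_, mul_nonneg (D t ht).pos.le ?_, (D t ht).deriv_auxFunction T N c⟩
    have h1 := hrate (s t) A Y b k v T (hcon t ht)
    have hf := T.two_le
    have hΩ := T.density_nonneg
    have hQ : 0 ≤ growth A b + 12 * (3 * γ - 4) * (s t).2.2.2 :=
      add_nonneg (growth_nonneg A b) (mul_nonneg (by linarith [hγ.1]) hΩ)
    -- The factor `5 N` in `auxFunction` yields `10 N` in the rate, which compensates the
    -- denominator because of this bound; `c / 3` is matched to `1 + q ≤ 3`. Together the rate is at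
    -- least `H (c - c) = 0`.
    have hf' : 6 - 2 * A - b ≤ 10 := by
      have h4 : |2 * A + b| ≤ 4 := abs_le_of_sq_le_sq
        (by nlinarith [T.friedmann, sq_nonneg b, sq_nonneg Y, sq_nonneg k, sq_nonneg v]) (by norm_num)
      linarith [(abs_le.1 h4).1]
    have h2 : N * (growth A b + 12 * (3 * γ - 4) * (s t).2.2.2) ≤
        10 * N * (growth A b + 12 * (3 * γ - 4) * (s t).2.2.2) / (6 - 2 * A - b) := by
      rw [le_div_iff₀ (by linarith)]
      nlinarith [mul_nonneg hN hQ]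
    have h3 : c / 3 * (1 + deceleration γ (s t)) ≤ c / 3 * 3 :=
      mul_le_mul_of_nonneg_left (by linarith [(D t ht).deceleration_le hγ]) (by positivity)
    linarith
  choose! d hd0 hd using hd
  have hmono : MonotoneOn (fun τ => auxFunction N c (s τ) (H τ)) (Ici t₁) :=
    monotoneOn_of_hasDerivWithinAt_nonneg (convex_Ici t₁)
      (fun τ hτ => (hd τ hτ).continuousAt.continuousWithinAt)
      (fun τ hτ => (hd τ (interior_subset hτ)).hasDerivWithinAt)
      (fun τ hτ => hd0 τ (interior_subset hτ))
  set G := auxFunction N c (s t₁) (H t₁) with hG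
  -- At time `t₁ + exp M` one has `log H ≤ -M`, and `M` is such that the upper bound of the
  -- auxiliary function becomes `G - c/3`, below its initial value `G`.
  set M := 3 * (4 - G) / c + 1 with hM
  have ht : t₁ < t₁ + Real.exp M := by linarith [Real.exp_pos M]
  obtain ⟨A, Y, b, k, v, T⟩ := htri _ ht.le
  have h1 := hmono self_mem_Ici ht.le ht.le
  have h2 := T.auxFunction_le (D _ ht.le).mem hN c (H (t₁ + Real.exp M))
  have h3 : Real.log (H (t₁ + Real.exp M)) ≤ -M := by
    have h4 := Real.log_le_log (D _ ht.le).pos (hubble_le hγ D ht)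
    rwa [add_sub_cancel_left, Real.log_inv, Real.log_exp] at h4
  have h5 : c / 3 * Real.log (H (t₁ + Real.exp M)) ≤ c / 3 * -M :=
    mul_le_mul_of_nonneg_left h3 (by positivity)
  have h6 : c / 3 * -M = G - 4 - c / 3 := by
    rw [hM]; field_simp; ring
  simp only at h1
  linarith

end Attraction

/-! ### Attraction and stability for orbits in arbitrary frames -/

section Orbits

variable {γ a : ℝ} {h : ℝ → Matrix (Fin 3) (Fin 3) ℝ} {J : ℝ → Fin 4 → ℝ} {ρ : ℝ → ℝ}
  {E : ℝ → Matrix (Fin 3) (Fin 3) ℝ}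

lemma IsOrbit.state_mem {I : Set ℝ} (hI : IsOpen I) (O : IsOrbit γ I h J ρ E) {t : ℝ} (ht : t ∈ I) :
    state h J ρ (E t) t ∈ stateSpace :=
  (O.solution.isReduced hI).state_mem hI ht (O.expanding t ht) (O.frame t ht)

/-- The monotone function does not decrease along orbits. -/
theorem IsOrbit.lyapunov_mono (hγ : γ ∈ Ico (4 / 3 : ℝ) 2) (O : IsOrbit γ (Ioi a) h J ρ E)
    {t₁ t : ℝ} (ha : a < t₁) (ht : t₁ ≤ t) :
    lyapunov (state h J ρ (E t₁) t₁) ≤ lyapunov (state h J ρ (E t) t) := by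
  obtain ⟨s, η, hs⟩ := O.exists_evolves ⟨by linarith [hγ.1], hγ.2.le⟩ ha
  obtain ⟨-, R₁, hR₁, e₁⟩ := hs t₁ le_rfl
  obtain ⟨-, R, hR, e⟩ := hs t ht
  rw [e₁, e, lyapunov_rotate hR₁, lyapunov_rotate hR]
  exact BianchiI.lyapunov_mono hγ.1 (fun τ hτ => (hs τ hτ).1) ht

/-- Rotating cosmologies approach the Edge. -/
theorem IsOrbit.tendsto_infDist (hγ : γ ∈ Ico (4 / 3 : ℝ) 2) (O : IsOrbit γ (Ioi a) h J ρ E) {t₁ : ℝ}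
    (ha : a < t₁) (hrot : state h J ρ (E t₁) t₁ ∈ rotatingStates) :
    Tendsto (fun t => Metric.infDist (state h J ρ (E t) t) edgeStates) atTop (𝓝 0) := by
  rw [rotatingStates_eq] at hrot
  have hpos := lyapunov_pos hrot.2.1 hrot.1
  obtain ⟨s, η, hs⟩ := O.exists_evolves ⟨by linarith [hγ.1], hγ.2.le⟩ ha
  have hl : ∀ t ≥ t₁, lyapunov (state h J ρ (E t) t) = lyapunov (s t) := fun t ht => by
    obtain ⟨-, R, hR, e⟩ := hs t ht
    rw [e, lyapunov_rotate hR]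
  rw [Metric.tendsto_atTop]
  intro ε hε
  -- States with monotone function above `m` are `ε`-close to the Edge. The level `m` is exceeded at
  -- some time, and by monotonicity at all later times.
  obtain ⟨m, hm, hclose⟩ := exists_infDist_lt_of_lt isCompact_stateSpace continuousOn_lyapunov
    (fun x hx => lyapunov_le hx) hε
  obtain ⟨t₂, ht₂, hlt⟩ := exists_lt_lyapunov hγ (fun τ hτ => (hs τ hτ).1)
    (by rw [← hl t₁ le_rfl]; exact hpos) hm
  refine ⟨t₂, fun t ht => ?_⟩
  rw [Real.dist_eq, sub_zero, abs_of_nonneg Metric.infDist_nonneg, edgeStates_eq]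
  refine hclose _ (O.state_mem isOpen_Ioi (ha.trans_le (ht₂.trans ht))) ?_
  rw [← hl t₂ ht₂] at hlt
  exact hlt.trans_le (O.lyapunov_mono hγ (ha.trans_le ht₂) ht)

/-- The Edge is stable. -/
theorem exists_infDist_lt_of_orbit (hγ : γ ∈ Ico (4 / 3 : ℝ) 2) {ε : ℝ} (hε : 0 < ε) :
    ∃ δ > 0, ∀ a : ℝ, ∀ h J ρ E, IsOrbit γ (Ioi a) h J ρ E → ∀ t₁ > a,
      Metric.infDist (state h J ρ (E t₁) t₁) edgeStates < δ →
      ∀ t ≥ t₁, Metric.infDist (state h J ρ (E t) t) edgeStates < ε := by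
  obtain ⟨m, hm, hclose⟩ := exists_infDist_lt_of_lt isCompact_stateSpace continuousOn_lyapunov
    (fun x hx => lyapunov_le hx) hε
  obtain ⟨δ, hδ, hδ'⟩ := exists_lt_of_infDist_lt isCompact_stateSpace continuousOn_lyapunov
    ⟨edgeState, edgeState_mem, lyapunov_edgeState⟩ hm
  refine ⟨δ, hδ, fun a h J ρ E O t₁ ht₁ hd t ht => ?_⟩
  rw [edgeStates_eq] at hd ⊢
  refine hclose _ (O.state_mem isOpen_Ioi (ht₁.trans_le ht)) ?_
  exact (hδ' _ (O.state_mem isOpen_Ioi ht₁) hd).trans_le (O.lyapunov_mono hγ ht₁ ht)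

end Orbits

/-! ### Genericity of rotating states -/

/-- The quadratic form of the Friedmann constraint, on states without temporal part. -/
def friedmannForm (s : State) : ℝ :=
  (1 / 6) * ∑ a, ∑ b, s.1 a b ^ 2 + ∑ a, s.2.1 a ^ 2 + s.2.2.2

/-- The rescaling of a state to one that obeys the Friedmann constraint. -/
def normalize (s : State) : State :=
  (fun a b => s.1 a b / √(friedmannForm s), fun a => s.2.1 a / √(friedmannForm s), 0,
    s.2.2.2 / friedmannForm s)

lemma normalize_mem {s : State} (hsym : ∀ a b, s.1 a b = s.1 b a) (htr : ∑ a, s.1 a a = 0)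
    (hΩ : 0 ≤ s.2.2.2) (hpos : 0 < friedmannForm s) : normalize s ∈ spatialStates := by
  have hsq : √(friedmannForm s) ^ 2 = friedmannForm s := Real.sq_sqrt hpos.le
  refine ⟨⟨fun a b => by simp only [normalize, hsym], ?_, fun a => by simp [normalize],
    div_nonneg hΩ hpos.le, ?_⟩, rfl⟩
  · simp only [normalize]
    rw [← Finset.sum_div, htr, zero_div]
  · simp only [normalize, div_pow, ← Finset.sum_div, hsq]
    field_simp
    rw [friedmannForm]
    ring

lemma normalize_eq {s : State} (hs : s ∈ spatialStates) : normalize s = s := by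
  have h1 : friedmannForm s = 1 := by
    have := hs.1.2.2.2.2
    rw [hs.2] at this
    rw [friedmannForm]
    linarith
  refine Prod.ext ?_ (Prod.ext ?_ (Prod.ext hs.2.symm ?_)) <;> simp [normalize, h1]

/-- The Gram determinant is homogeneous of degree six in `(Σ, V)`, so rescaling does not create
zeros. -/
lemma gram_normalize_ne_zero {s : State} (hpos : 0 < friedmannForm s) (hD : gram s ≠ 0) :
    gram (normalize s) ≠ 0 := by
  set n := √(friedmannForm s) with hn
  have hn0 : n ≠ 0 := (Real.sqrt_pos.2 hpos).ne'
  have hS : shear (normalize s) = n⁻¹ • shear s := by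
    ext a b
    simp [shear, normalize, div_eq_inv_mul, hn]
  have hV : (normalize s).2.1 = n⁻¹ • s.2.1 := by
    funext a
    simp [normalize, div_eq_inv_mul, hn]
  have : gram (normalize s) = n⁻¹ ^ 6 * gram s := by
    simp only [gram, moment₀, moment₁, moment₂, hS, hV, Matrix.smul_mulVec, Matrix.mulVec_smul,
      smul_dotProduct, dotProduct_smul, smul_eq_mul]
    ring
  rw [this]
  exact mul_ne_zero (pow_ne_zero 6 (inv_ne_zero hn0)) hD

lemma continuous_friedmannForm : Continuous friedmannForm := by
  have c1 : ∀ i j, Continuous fun s : State => s.1 i j := fun i j => by fun_prop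
  have c2 : ∀ i, Continuous fun s : State => s.2.1 i := fun i => by fun_prop
  have c4 : Continuous fun s : State => s.2.2.2 := by fun_prop
  exact ((continuous_const.mul (continuous_finsetSum _ fun i _ => continuous_finsetSum _ fun j _ =>
    (c1 i j).pow 2)).add (continuous_finsetSum _ fun i _ => (c2 i).pow 2)).add c4

lemma continuousAt_normalize {s : State} (hpos : 0 < friedmannForm s) : ContinuousAt normalize s := by
  have c1 : ∀ i j, Continuous fun s : State => s.1 i j := fun i j => by fun_prop
  have c2 : ∀ i, Continuous fun s : State => s.2.1 i := fun i => by fun_prop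
  have c4 : Continuous fun s : State => s.2.2.2 := by fun_prop
  have hn : ContinuousAt (fun s => √(friedmannForm s)) s :=
    (Real.continuous_sqrt.comp continuous_friedmannForm).continuousAt
  have hn0 : √(friedmannForm s) ≠ 0 := (Real.sqrt_pos.2 hpos).ne'
  exact ContinuousAt.prodMk (continuousAt_pi.2 fun a => continuousAt_pi.2 fun b =>
      (c1 a b).continuousAt.div hn hn0)
    (ContinuousAt.prodMk (continuousAt_pi.2 fun a => (c2 a).continuousAt.div hn hn0)
      (ContinuousAt.prodMk continuousAt_const
        (c4.continuousAt.div continuous_friedmannForm.continuousAt hpos.ne')))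

/-- Along a line the Gram determinant is a polynomial in `ε`, so it vanishes identically if its
zeros accumulate. -/
lemma analyticOnNhd_gram_line (s s' : State) :
    AnalyticOnNhd ℝ (fun ε : ℝ => gram ((1 - ε) • s + ε • s')) univ := by
  intro ε _
  simp only [gram, moment₀, moment₁, moment₂, dotProduct, Matrix.mulVec, shear, Fin.sum_univ_three,
    Matrix.of_apply, Prod.fst_add, Prod.snd_add, Prod.smul_fst, Prod.smul_snd, Pi.add_apply,
    Pi.smul_apply, smul_eq_mul]
  fun_prop

/-- A state is moved along the segment to the Edge and rescaled to restore the Friedmann constraint,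
which is not affine. The Gram determinant is nonzero at the end of the segment, hence also for all
small positive parameters. -/
theorem spatialStates_subset_closure : spatialStates ⊆ closure rotatingStates := by
  intro s hs
  have hE := (edgeStates_eq ▸ ⟨edgeState_mem, lyapunov_edgeState⟩ : edgeState ∈ edgeStates)
  have hE' := (edgeStates_subset hE).1
  rw [rotatingStates_eq] at hE' ⊢
  have hne : ∀ᶠ ε in 𝓝[>] (0 : ℝ), gram ((1 - ε) • s + ε • edgeState) ≠ 0 := by
    by_contra hcon
    rw [not_eventually] at hcon
    have hfreq : ∃ᶠ ε in 𝓝[≠] (0 : ℝ), gram ((1 - ε) • s + ε • edgeState) = 0 :=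
      (hcon.mono fun ε h => not_not.1 h).filter_mono (nhdsWithin_mono _ fun x hx => (ne_of_gt hx))
    have h1 := (analyticOnNhd_gram_line s edgeState).eqOn_zero_of_preconnected_of_frequently_eq_zero
      isPreconnected_univ (mem_univ 0) hfreq (mem_univ 1)
    simp only [sub_self, zero_smul, one_smul, zero_add] at h1
    exact hE'.1 h1
  have hline : Continuous fun ε : ℝ => (1 - ε) • s + ε • edgeState := by fun_prop
  have hline0 : (1 - (0 : ℝ)) • s + (0 : ℝ) • edgeState = s := by simp
  have hfr : friedmannForm s = 1 := by
    have := hs.1.2.2.2.2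
    rw [hs.2] at this
    rw [friedmannForm]
    linarith
  have hpos : ∀ᶠ ε in 𝓝[>] (0 : ℝ), 0 < friedmannForm ((1 - ε) • s + ε • edgeState) := by
    refine ((continuous_friedmannForm.comp hline).continuousAt.eventually
      (lt_mem_nhds ?_)).filter_mono nhdsWithin_le_nhds
    simp only [Function.comp_apply, hline0, hfr, one_pos]
  have hlim : Tendsto (fun ε : ℝ => normalize ((1 - ε) • s + ε • edgeState)) (𝓝[>] 0) (𝓝 s) := by
    have h1 : ContinuousAt normalize ((1 - (0 : ℝ)) • s + (0 : ℝ) • edgeState) :=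
      continuousAt_normalize (by rw [hline0, hfr]; exact one_pos)
    have h2 := (ContinuousAt.comp (f := fun ε : ℝ => (1 - ε) • s + ε • edgeState) h1
      hline.continuousAt).tendsto
    simp only [Function.comp_apply, hline0, normalize_eq hs] at h2
    exact h2.mono_left nhdsWithin_le_nhds
  refine mem_closure_of_tendsto hlim ?_
  filter_upwards [hne, hpos, Ioo_mem_nhdsGT one_pos] with ε h1 h2 h3
  refine ⟨gram_normalize_ne_zero h2 h1, normalize_mem (fun a b => ?_) ?_ ?_ h2⟩
  · simp only [Prod.fst_add, Prod.smul_fst, Pi.add_apply, Pi.smul_apply, hs.1.1 a b,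
      edgeState_mem.1 a b]
  · simp only [Prod.fst_add, Prod.smul_fst, Pi.add_apply, Pi.smul_apply, smul_eq_mul,
      Finset.sum_add_distrib, ← Finset.mul_sum, hs.1.2.1, edgeState_mem.2.1, mul_zero, add_zero]
  · simp only [Prod.snd_add, Prod.smul_snd, smul_eq_mul]
    exact add_nonneg (mul_nonneg (by linarith [h3.2]) hs.1.2.2.2.1)
      (mul_nonneg h3.1.le edgeState_mem.2.2.2.1)

/-! ### The global attractor -/

theorem isGlobalAttractor_edgeStates {γ : ℝ} (hγ : γ ∈ Ico (4 / 3 : ℝ) 2) :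
    IsGlobalAttractor γ edgeStates where
  exists_orbit _ hs t₀ _ hH := exists_orbit_through ⟨by linarith [hγ.1], hγ.2.le⟩ hs t₀ hH
  mem_and_extends _ _ hab _ _ _ _ O := ⟨fun _ ht => O.state_mem isOpen_Ioo ht,
    O.exists_extension ⟨by linarith [hγ.1], hγ.2.le⟩ hab⟩
  attracts _ _ _ _ _ O _ ht₁ hrot := O.tendsto_infDist hγ ht₁ hrot
  stable _ hε := exists_infDist_lt_of_orbit hγ hε
  basin_open := ⟨{s | gram s ≠ 0}, isOpen_ne_fun continuous_gram continuous_const,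
    rotatingStates_eq⟩
  basin_dense := spatialStates_subset_closure

end BianchiI

end

theorem mainTheorem5 :
    -- the Edge is a solution without perfect fluid, for all `γ` in `[0, 2]`
    (∀ γ ∈ Set.Icc (0 : ℝ) 2, BianchiI.IsTypeISolution γ (Set.Ioi 0)
      BianchiI.edgeMetric BianchiI.edgeForm BianchiI.edgeDensity) ∧
    -- it is self-similar
    BianchiI.IsSelfSimilar (Set.Ioi 0) BianchiI.edgeMetric ∧
    -- it is an equilibrium: its state in the frame dual to its coframe is constant
    (∃ s : BianchiI.State, ∀ t > 0,
      BianchiI.IsFrame (BianchiI.edgeMetric t) (BianchiI.edgeCoframe t)⁻¹ ∧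
      BianchiI.state BianchiI.edgeMetric BianchiI.edgeForm BianchiI.edgeDensity
        (BianchiI.edgeCoframe t)⁻¹ t = s) ∧
    -- its `j`-form is spatial and rotating
    (∀ t > 0, BianchiI.IsRotatingAt BianchiI.edgeMetric BianchiI.edgeForm t) ∧
    (∀ s ∈ BianchiI.edgeStates, s ∈ BianchiI.rotatingStates ∧ s.2.2.2 = 0) ∧
    -- it expands with deceleration parameter `q = 1`, where `dH/dt = -(1 + q) H²`
    (∀ t > 0, 0 < BianchiI.hubble BianchiI.edgeMetric t ∧
      HasDerivAt (BianchiI.hubble BianchiI.edgeMetric)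
        (-(1 + 1) * BianchiI.hubble BianchiI.edgeMetric t ^ 2) t) ∧
    -- it is the global attractor for `γ` in `[4/3, 2)`
    (∀ γ ∈ Set.Ico (4 / 3 : ℝ) 2, BianchiI.IsGlobalAttractor γ BianchiI.edgeStates) := by
  exact ⟨fun γ _ => (BianchiI.isReduced_edge γ).isTypeISolution isOpen_Ioi,
    BianchiI.isSelfSimilar_edge,
    ⟨BianchiI.edgeState, fun t ht => by
      rw [BianchiI.edgeCoframe_inv ht]
      exact ⟨BianchiI.isFrame_edgeFrame ht, BianchiI.state_edge ht⟩⟩,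
    fun t ht => BianchiI.isRotatingAt_edge ht, fun s hs => BianchiI.edgeStates_subset hs,
    fun t ht => ⟨by rw [BianchiI.hubble_edge ht]; positivity, BianchiI.hasDerivAt_hubble_edge ht⟩,
    fun γ hγ => BianchiI.isGlobalAttractor_edgeStates hγ⟩
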